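/- Let $r,n$ be positive integers, $\zeta=e^{2\pi i/r}$, $W=G(r,1,n)$, and let $\zeta_i$ be the diagonal matrix with $\zeta$ in position $i$ and $1$'s elsewhere, $s_{ij}$ the transposition $(ij)$, $s_i=s_{i,i+1}$. Let $F\supseteq\mathbb{C}$ be a field and $\kappa,c_0,d_1,\dots,d_{r-1}\in F$; put $d_0=-d_1-\cdots-d_{r-1}$ and read the subscripts of the $d_j$ modulo $r$. The rational Cherednik algebra $\mathbb{H}$ is the $F$-algebra generated by $F[x_1,\dots,x_n]$, $F[y_1,\dots,y_n]$ and $FW$ (with basis $t_w$, $w\in W$) with relations $t_w x=(wx)t_w$, $t_w y=(wy)t_w$ (where $y_1,\dots,y_n$ is the standard basis of $\mathbb{C}^n$ and $x_1,\dots,x_n$ the dual basis), $$y_ix_j=x_jy_i+c_0\sum_{l=0}^{r-1}\zeta^{-l}t_{\zeta_i^ls_{ij}\zeta_i^{-l}}\quad(i\neq j),$$ $$y_ix_i=x_iy_i+\kappa-\sum_{j=0}^{r-1}(d_j-d_{j-1})e_{ij}-c_0\sum_{j\neq i}\sum_{l=0}^{r-1}t_{\zeta_i^ls_{ij}\zeta_i^{-l}},\qquad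 e_{ij}=\frac1r\sum_{l=0}^{r-1}\zeta^{-lj}t_{\zeta_i^l}.$$ Put $\phi_i=\sum_{1\le j<i}\sum_{l=0}^{r-1}t_{\zeta_i^ls_{ij}\zeta_i^{-l}}$, $z_i=y_ix_i+c_0\phi_i$ and $\pi_i=\sum_{l=0}^{r-1}t_{\zeta_i\zeta_{i+1}^{-1}}^l$, and let $\mathfrak{t}$ be the commutative subalgebra of $\mathbb{H}$ generated by $z_1,\dots,z_n,t_{\zeta_1},\dots,t_{\zeta_n}$. For an $\mathbb{H}$-module $M$ and an $F$-algebra homomorphism $\alpha:\mathfrak{t}\to F$ let $$M_\alpha=\{m\in M\mid \text{there is } q\in\mathbb{Z}_{>0}\text{ with }(f-\alpha(f))^q.m=0\text{ for all }f\in\mathfrak{t}\}.$$ Let $\lambda=(\lambda^0,\dots,\lambda^{r-1})$ be an $r$-partition of $n$ (superscripts read modulo $r$). For a box $b$ in row $i$ and column $j$ of $\lambda^l$ put $\mathrm{ct}(b)=j-i$ and $\beta(b)=l$. Let $\mathrm{SYT}(\lambda)$ be the set of standard Young tableaux on $\lambda$, and write $T(i)$ for the box of $T$ containing $i$. Let $S^\lambda$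 be the irreducible $FW$-module with basis $(v_T)_{T\in\mathrm{SYT}(\lambda)}$ on which $\phi_i.v_T=r\,\mathrm{ct}(T(i))v_T$, $t_{\zeta_i}.v_T=\zeta^{\beta(T(i))}v_T$, and $\tau_i=t_{s_i}+\frac{1}{\phi_i-\phi_{i+1}}\pi_i$ (the second term being $0$ where $\pi_i=0$) acts by Young's orthonormal form: $\tau_i.v_T=0$ if $s_i.T$ is not standard; $\tau_i.v_T=v_{s_i.T}$ if $\beta(T(i))\ne\beta(T(i+1))$; and $\tau_i.v_T=\bigl(1-(\mathrm{ct}(T(i+1))-\mathrm{ct}(T(i)))^{-2}\bigr)^{1/2}v_{s_i.T}$ otherwise. Let $M(\lambda)=\mathrm{Ind}_{FW\otimes F[y_1,\dots,y_n]}^{\mathbb{H}}S^\lambda$, where each $y_i$ acts on $S^\lambda$ by $0$. For $\mu\in\mathbb{Z}_{\ge0}^n$ let $\mu^+$ and $\mu^-$ be its non-increasing and non-decreasing rearrangements, let $w_\mu\in S_n$ be the longest permutation with $w_\mu.\mu=\mu^-$, where $(w.\mu)_i=\mu_{w^{-1}(i)}$, and put $v_T^\mu=t_{w_\mu}^{-1}.v_T$.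 Write $\nu<\mu$ if $\nu^+$ is strictly smaller than $\mu^+$ in dominance order, or $\nu^+=\mu^+$ and $w_\nu<w_\mu$ in Bruhat order. Over $F=\mathbb{C}(\kappa,c_0,d_1,\dots,d_{r-1})$, with the parameters indeterminates, let $f_{\mu,T}\in M(\lambda)$ be the $\mathfrak{t}$-eigenvector of the form $x^\mu v_T^\mu+\sum_{\nu<\mu,\,S}c_{\nu,S}\,x^\nu v_S^\nu$. It is called well-defined at a point of the parameter space $\mathbb{C}^{r+1}$ if none of its coefficients in the basis $x^\nu v_S^\nu$ has a pole there. From now on let $\kappa=1$ and $c_0,d_1,\dots,d_{r-1}\in\mathbb{C}$. For $\mu\in\mathbb{Z}_{\ge0}^n$, $T\in\mathrm{SYT}(\lambda)$ and $1\le i\le n$ put, with $b=T(w_\mu(i))$, $$\mathrm{wt}(\mu,T)_i=\bigl(\mu_i+1-(d_{\beta(b)}-d_{\beta(b)-\mu_i-1})-c_0r\,\mathrm{ct}(b),\ \zeta^{\beta(b)-\mu_i}\bigr).$$ Let $\mathrm{ct}^+(\nu)$ and $\mathrm{ct}^-(\nu)$ be the maximal and minimal content of a box of a non-empty partition $\nu$.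 Let $\mathcal{E}_\lambda$ be the set of the following hyperplanes in $\mathbb{C}^r$ (with coordinates $c_0,d_1,\dots,d_{r-1}$): * $k=d_l-d_{l-k}+mrc_0$, for integers $k>0$ with $k\not\equiv0\bmod r$, $0\le l\le r-1$ and $m$ with $\lambda^l\ne\emptyset$, $\lambda^{l-k}\neq\emptyset$ and $\mathrm{ct}^-(\lambda^l)-\mathrm{ct}^+(\lambda^{l-k})\le m\le\mathrm{ct}^+(\lambda^l)-\mathrm{ct}^-(\lambda^{l-k})$; * $k=c_0m$, for integers $k>0$ and $m$ and each $i$ with $\lambda^i\ne\emptyset$, where $0<m\le\mathrm{ct}^+(\lambda^i)$ if $\lambda^i$ is a single row, $\mathrm{ct}^-(\lambda^i)\le m<0$ if $\lambda^i$ is a single column, and $\mathrm{ct}^-(\lambda^i)-\mathrm{ct}^+(\lambda^i)\le m\le\mathrm{ct}^+(\lambda^i)-\mathrm{ct}^-(\lambda^i)$, $m\ne0$, otherwise. Then $\mathcal{E}_\lambda$ is locally finite, and if $c_0\neq0$ the following are equivalent: (a) every non-zero (generalized) $\mathfrak{t}$-weight space $M(\lambda)_\alpha$ is one-dimensional; (b)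 $\mathrm{wt}(\mu,T)_i\ne\mathrm{wt}(\mu,T)_{i+1}$ for all $\mu\in\mathbb{Z}_{\ge0}^n$, $T\in\mathrm{SYT}(\lambda)$ and $1\le i\le n-1$; (c) the point $(c_0,d_1,\dots,d_{r-1})$ lies on no hyperplane of $\mathcal{E}_\lambda$; (d) for all $\mu\in\mathbb{Z}_{\ge0}^n$ and $T\in\mathrm{SYT}(\lambda)$, $f_{\mu,T}$ is well-defined at the point $(1,c_0,d_1,\dots,d_{r-1})$; (e) the intertwiners $\sigma_i=t_{s_i}+\frac{c_0}{z_i-z_{i+1}}\pi_i$, $1\le i\le n-1$, are well-defined on all of $M(\lambda)$, that is, on every weight space $M(\lambda)_\alpha$ the operator $z_i-z_{i+1}$ is invertible or $\pi_i$ is zero. -/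

import Mathlib

open scoped TensorProduct

noncomputable section

namespace RCA

/-! ### Compositions, the permutations `w_μ`, and the order on compositions

All indices `1, …, n` of the informal text are shifted to `Fin n = {0, …, n - 1}`. -/

/-- The position `w_μ(i)`: here `w_μ` is the longest permutation that sorts `μ` into
non-decreasing order, so `w_μ(i)` is the number of `j < i` with `μ_j < μ_i` plus the number of
`j > i` with `μ_j ≤ μ_i` (positions are counted from `0`). -/
def wFun {n : ℕ} (μ : Fin n → ℕ) (i : Fin n) : ℕ :=
  (Finset.univ.filter fun j => (j < i ∧ μ j < μ i) ∨ (i < j ∧ μ j ≤ μ i)).card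

theorem wFun_lt {n : ℕ} (μ : Fin n → ℕ) (i : Fin n) : wFun μ i < n := by
  have h : (Finset.univ.filter fun j => (j < i ∧ μ j < μ i) ∨ (i < j ∧ μ j ≤ μ i)) ⊂
      (Finset.univ : Finset (Fin n)) := by
    rw [Finset.ssubset_univ_iff]
    intro h
    have := h.symm ▸ Finset.mem_univ i
    simp at this
  simpa [wFun] using Finset.card_lt_card h

theorem wFun_lt_wFun {n : ℕ} (μ : Fin n → ℕ) {i k : Fin n}
    (h : (i < k ∧ μ i < μ k) ∨ (k < i ∧ μ i ≤ μ k)) : wFun μ i < wFun μ k := by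
  apply Finset.card_lt_card
  rw [Finset.ssubset_iff_of_subset]
  · exact ⟨i, by simpa using h, by simp⟩
  · intro j hj
    simp only [Finset.mem_filter, Finset.mem_univ, true_and] at hj ⊢
    grind

theorem wFun_bijective {n : ℕ} (μ : Fin n → ℕ) :
    Function.Bijective fun i : Fin n => (⟨wFun μ i, wFun_lt μ i⟩ : Fin n) := by
  rw [← Finite.injective_iff_bijective]
  intro i k hik
  have hik' : wFun μ i = wFun μ k := by simpa using hik
  by_contra hne
  rcases lt_or_gt_of_ne hne with h | h <;> rcases lt_or_ge (μ i) (μ k) with h' | h' <;>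
    rcases lt_or_ge (μ k) (μ i) with h'' | h''
  all_goals
    first
      | (have := wFun_lt_wFun μ (i := i) (k := k) (by grind); omega)
      | (have := wFun_lt_wFun μ (i := k) (k := i) (by grind); omega)

/-- The permutation `w_μ`. -/
def wPerm {n : ℕ} (μ : Fin n → ℕ) : Equiv.Perm (Fin n) :=
  Equiv.ofBijective _ (wFun_bijective μ)

/-- The non-decreasing rearrangement `μ⁻ = w_μ.μ`, where `(w.μ)_i = μ_{w⁻¹(i)}`. -/
def antiPart {n : ℕ} (μ : Fin n → ℕ) (i : Fin n) : ℕ := μ ((wPerm μ)⁻¹ i)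

/-- The non-increasing rearrangement `μ⁺`. -/
def part {n : ℕ} (μ : Fin n → ℕ) (i : Fin n) : ℕ := antiPart μ i.rev

/-- Strict dominance order: `μ <_d ν` if `μ ≠ ν`, both have the same sum, and every partial sum
of `μ` is at most the corresponding partial sum of `ν`; in other words
`ν - μ = ∑ k_i (ε_i - ε_{i+1})` with non-negative integers `k_i`, not all zero. -/
def DomLT {n : ℕ} (μ ν : Fin n → ℕ) : Prop :=
  μ ≠ ν ∧ ∑ i, μ i = ∑ i, ν i ∧
    ∀ k : Fin n, ∑ i ∈ Finset.Iic k, μ i ≤ ∑ i ∈ Finset.Iic k, ν i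

/-- Strict Bruhat order on the symmetric group: the transitive closure of `u < u t` for
transpositions `t = (i j)` with `l(u t) > l(u)`; for `i < j` this means `u(i) < u(j)`. -/
def BruhatLT {n : ℕ} : Equiv.Perm (Fin n) → Equiv.Perm (Fin n) → Prop :=
  Relation.TransGen fun u v => ∃ i j : Fin n, i < j ∧ u i < u j ∧ v = u * Equiv.swap i j

/-- The partial order `μ < ν` on compositions. -/
def CompLT {n : ℕ} (μ ν : Fin n → ℕ) : Prop :=
  DomLT (part μ) (part ν) ∨ (part μ = part ν ∧ BruhatLT (wPerm μ) (wPerm ν))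

/-! ### `r`-partitions and standard tableaux -/

/-- `r`-partitions `(λ^0, …, λ^{r-1})` of `n`; the superscripts are read modulo `r`. -/
structure RPartition (r n : ℕ) [NeZero r] where
  comp : ZMod r → YoungDiagram
  card_eq : ∑ j, (comp j).card = n

/-- The boxes of an `r`-partition: a component, a row and a column. -/
def Box {r n : ℕ} [NeZero r] (lam : RPartition r n) : Type :=
  {b : ZMod r × (ℕ × ℕ) // b.2 ∈ lam.comp b.1}

/-- The content (column minus row) of a cell. -/
def cellContent (c : ℕ × ℕ) : ℤ := (c.2 : ℤ) - (c.1 : ℤ)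

/-- The content `ct(b)` of a box. -/
def ct {r n : ℕ} [NeZero r] {lam : RPartition r n} (b : Box lam) : ℤ := cellContent b.1.2

/-- The component `β(b)` in which a box lies. -/
def beta {r n : ℕ} [NeZero r] {lam : RPartition r n} (b : Box lam) : ZMod r := b.1.1

/-- A filling `T`, as a bijection from the entries to the boxes, is standard if in each component
the entries strictly increase along rows and down columns. -/
def IsStandard {r n : ℕ} [NeZero r] {lam : RPartition r n} (T : Fin n ≃ Box lam) : Prop :=
  ∀ b b' : Box lam, b.1.1 = b'.1.1 →
    ((b.1.2.1 = b'.1.2.1 ∧ b.1.2.2 < b'.1.2.2) ∨ (b.1.2.2 = b'.1.2.2 ∧ b.1.2.1 < b'.1.2.1)) →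
    T.symm b < T.symm b'

/-- Standard Young tableaux on an `r`-partition. -/
def SYT {r n : ℕ} [NeZero r] (lam : RPartition r n) : Type :=
  {T : Fin n ≃ Box lam // IsStandard T}

/-- The box `T(i)` in which `i` appears. -/
def SYT.box {r n : ℕ} [NeZero r] {lam : RPartition r n} (T : SYT lam) (i : Fin n) : Box lam :=
  T.1 i

/-! ### The group `G(r,1,n)` -/

/-- The group `G(r,1,n)` of `n` by `n` monomial matrices whose nonzero entries are `r`-th roots of
unity, as the semidirect product `(ℤ/r)^n ⋊ S_n`. The element `⟨a, s⟩` stands for the matrix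
`diag(ζ^{a_1}, …, ζ^{a_n})` times the permutation matrix of `s`, that is for the linear map
`y_j ↦ ζ^{a_{s(j)}} y_{s(j)}`. -/
abbrev W (r n : ℕ) : Type :=
  (Fin n → Multiplicative (ZMod r)) ⋊[mulAutArrow] (Equiv.Perm (Fin n))

/-- The diagonal matrix `ζ_i`. -/
def zetaElt (r : ℕ) {n : ℕ} (i : Fin n) : W r n :=
  SemidirectProduct.inl (Pi.mulSingle i (Multiplicative.ofAdd 1))

/-- A permutation as an element of `G(r,1,n)`. -/
def permElt (r : ℕ) {n : ℕ} (s : Equiv.Perm (Fin n)) : W r n := SemidirectProduct.inr s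

/-- The reflection `ζ_i^l s_{ij} ζ_i^{-l}`. -/
def reflElt (r : ℕ) {n : ℕ} (i j : Fin n) (l : ℕ) : W r n :=
  zetaElt r i ^ l * permElt r (Equiv.swap i j) * (zetaElt r i ^ l)⁻¹

/-- The Jucys-Murphy element `φ_i = ∑_{j < i} ∑_l t_{ζ_i^l s_{ij} ζ_i^{-l}}`, in any ring with
elements `t_w`. -/
def jm {r n : ℕ} {A : Type} [Ring A] (t : W r n → A) (i : Fin n) : A :=
  ∑ j ∈ Finset.univ.filter (· < i), ∑ l ∈ Finset.range r, t (reflElt r i j l)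

/-- The element `∑_l t_{ζ_i ζ_j^{-1}}^l`; for `j = i + 1` this is `π_i`. -/
def piElt {r n : ℕ} {A : Type} [Ring A] (t : W r n → A) (i j : Fin n) : A :=
  ∑ l ∈ Finset.range r, t (zetaElt r i * (zetaElt r j)⁻¹) ^ l

/-- `ζ^j` for `j` modulo `r`, where `ζ = e^{2πi/r}`, in an extension field of `ℂ`. -/
def zetaPow {r : ℕ} [NeZero r] (F : Type) [Field F] [Algebra ℂ F] (j : ZMod r) : F :=
  algebraMap ℂ F (ZMod.stdAddChar j)

/-! ### The irreducible modules `S^λ` -/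

section Specht

variable (F : Type) [Field F] [Algebra ℂ F] {r n : ℕ} [NeZero r] (lam : RPartition r n)

/-- The element `t_w` of the group algebra. -/
def gt (w : W r n) : MonoidAlgebra F (W r n) := MonoidAlgebra.of F (W r n) w

/-- The free module on symbols `v_T`, one for each standard tableau. -/
abbrev FreeSYT : Type := SYT lam →₀ MonoidAlgebra F (W r n)

variable {lam}

/-- The free generator belonging to `T`. -/
def freeV (T : SYT lam) : FreeSYT F lam := Finsupp.single T 1

open Classical in
/-- The value of `τ_i.v_T`, with `j = i + 1`: zero if `s_i.T` is not standard, `v_{s_i.T}` if `i`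
and `i + 1` lie in different components of `T`, and otherwise
`(1 - (ct(T(i+1)) - ct(T(i)))^{-2})^{1/2} v_{s_i.T}`. -/
def tauRhs (T : SYT lam) (i j : Fin n) : FreeSYT F lam :=
  if h : IsStandard ((Equiv.swap i j).trans T.1) then
    if beta (T.box i) ≠ beta (T.box j) then freeV F ⟨_, h⟩
    else algebraMap ℂ F
      ((Real.sqrt (1 - (1 / ((ct (T.box j) : ℝ) - (ct (T.box i) : ℝ))) ^ 2) : ℝ) : ℂ) •
        freeV F ⟨_, h⟩
  else 0

variable (lam)

/-- The relations among the `v_T`: Young's orthonormal form. The vector `v_T` has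
`φ_i`-eigenvalue `r ct(T(i))` and `t_{ζ_i}`-eigenvalue `ζ^{β(T(i))}`, and the operator
`τ_i = t_{s_i} + (φ_i - φ_{i+1})⁻¹ π_i` acts by the formula in `tauRhs`. -/
inductive SpechtRel : FreeSYT F lam → FreeSYT F lam → Prop
  | zeta (T : SYT lam) (i : Fin n) :
      SpechtRel (gt F (zetaElt r i) • freeV F T) (zetaPow F (beta (T.box i)) • freeV F T)
  | phi (T : SYT lam) (i : Fin n) :
      SpechtRel (jm (gt (r := r) F) i • freeV F T) (((r : F) * (ct (T.box i) : F)) • freeV F T)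
  | tau (T : SYT lam) (i j : Fin n) (hij : (i : ℕ) + 1 = j) :
      SpechtRel
        (gt F (permElt r (Equiv.swap i j)) • freeV F T +
          (1 / ((r : F) * (ct (T.box i) : F) - (r : F) * (ct (T.box j) : F))) •
            (piElt (gt (r := r) F) i j • freeV F T))
        (tauRhs F T i j)

/-- The submodule of relations of `S^λ`. -/
def spechtSub : Submodule (MonoidAlgebra F (W r n)) (FreeSYT F lam) :=
  Submodule.span (MonoidAlgebra F (W r n))
    {m : FreeSYT F lam | ∃ u v, SpechtRel F lam u v ∧ m = u - v}

/-- The irreducible module `S^λ` of `G(r,1,n)` over a field containing `ℂ`: the module over the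
group algebra with generators `v_T` and the relations of Young's orthonormal form. -/
def Specht : Type :=
  FreeSYT F lam ⧸ spechtSub F lam

instance : AddCommGroup (Specht F lam) :=
  inferInstanceAs (AddCommGroup (FreeSYT F lam ⧸ spechtSub F lam))

instance : Module (MonoidAlgebra F (W r n)) (Specht F lam) :=
  inferInstanceAs (Module (MonoidAlgebra F (W r n)) (FreeSYT F lam ⧸ spechtSub F lam))

instance : Module F (Specht F lam) :=
  inferInstanceAs (Module F (FreeSYT F lam ⧸ spechtSub F lam))

instance : IsScalarTower F (MonoidAlgebra F (W r n)) (Specht F lam) :=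
  inferInstanceAs (IsScalarTower F (MonoidAlgebra F (W r n)) (FreeSYT F lam ⧸ spechtSub F lam))

variable {lam}

/-- The vector `v_T` of `S^λ`. -/
def vec (T : SYT lam) : Specht F lam := (spechtSub F lam).mkQ (freeV F T)

end Specht

/-! ### The rational Cherednik algebra -/

/-- Names of the parameters `κ, c_0, d_1, …, d_{r-1}`. -/
inductive Param (r : ℕ) : Type
  | kappa : Param r
  | c0 : Param r
  | d (j : {j : ZMod r // j ≠ 0}) : Param r

/-- The parameters `d_j`, `j` modulo `r`, with `d_0 = - d_1 - ⋯ - d_{r-1}`. -/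
def dPar {F : Type} [Field F] {r : ℕ} [NeZero r] (p : Param r → F) (j : ZMod r) : F :=
  if h : j = 0 then -∑ k : {k : ZMod r // k ≠ 0}, p (Param.d k) else p (Param.d ⟨j, h⟩)

/-- Generators of the rational Cherednik algebra. -/
inductive Gen (r n : ℕ) : Type
  | x (i : Fin n) : Gen r n
  | y (i : Fin n) : Gen r n
  | t (w : W r n) : Gen r n

section Cherednik

variable {F : Type} [Field F] [Algebra ℂ F] {r n : ℕ} [NeZero r]

/-- A generator in the free algebra. -/
def fx (F : Type) [Field F] (r : ℕ) {n : ℕ} (i : Fin n) : FreeAlgebra F (Gen r n) :=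
  FreeAlgebra.ι F (Gen.x i)

/-- A generator in the free algebra. -/
def fy (F : Type) [Field F] (r : ℕ) {n : ℕ} (i : Fin n) : FreeAlgebra F (Gen r n) :=
  FreeAlgebra.ι F (Gen.y i)

/-- A generator in the free algebra. -/
def ft (F : Type) [Field F] {r n : ℕ} (w : W r n) : FreeAlgebra F (Gen r n) :=
  FreeAlgebra.ι F (Gen.t w)

/-- `e_{ij} = r⁻¹ ∑_l ζ^{-lj} t_{ζ_i^l}`, in the free algebra. -/
def fe (F : Type) [Field F] [Algebra ℂ F] {r n : ℕ} [NeZero r] (i : Fin n) (j : ZMod r) :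
    FreeAlgebra F (Gen r n) :=
  (1 / (r : F)) • ∑ l ∈ Finset.range r, zetaPow F (-((l : ZMod r) * j)) • ft F (zetaElt r i ^ l)

/-- The defining relations of the rational Cherednik algebra of `G(r,1,n)`. -/
inductive Rel (n : ℕ) (p : Param r → F) :
    FreeAlgebra F (Gen r n) → FreeAlgebra F (Gen r n) → Prop
  | xx (i j : Fin n) : Rel n p (fx F r i * fx F r j) (fx F r j * fx F r i)
  | yy (i j : Fin n) : Rel n p (fy F r i * fy F r j) (fy F r j * fy F r i)
  | t_one : Rel n p (ft F 1) 1
  | t_mul (w v : W r n) : Rel n p (ft F w * ft F v) (ft F (w * v))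
  | tx (w : W r n) (j : Fin n) :
      Rel n p (ft F w * fx F r j)
        (zetaPow F (-(w.left (w.right j)).toAdd) • (fx F r (w.right j) * ft F w))
  | ty (w : W r n) (j : Fin n) :
      Rel n p (ft F w * fy F r j)
        (zetaPow F (w.left (w.right j)).toAdd • (fy F r (w.right j) * ft F w))
  | yx_ne (i j : Fin n) (hij : i ≠ j) :
      Rel n p (fy F r i * fx F r j)
        (fx F r j * fy F r i +
          p Param.c0 • ∑ l ∈ Finset.range r, zetaPow F (-(l : ZMod r)) • ft F (reflElt r i j l))
  | yx_eq (i : Fin n) :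
      Rel n p (fy F r i * fx F r i)
        (fx F r i * fy F r i + algebraMap F _ (p Param.kappa)
          - ∑ j : ZMod r, (dPar p j - dPar p (j - 1)) • fe F i j
          - p Param.c0 • ∑ j ∈ Finset.univ.filter (· ≠ i), ∑ l ∈ Finset.range r,
              ft F (reflElt r i j l))

/-- The rational Cherednik algebra `ℍ` of `G(r,1,n)` with parameters `p`. -/
def H (n : ℕ) (p : Param r → F) : Type := RingQuot (Rel n p)

instance (p : Param r → F) : Ring (H n p) := inferInstanceAs (Ring (RingQuot (Rel n p)))

instance (p : Param r → F) : Algebra F (H n p) := inferInstanceAs (Algebra F (RingQuot (Rel n p)))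

/-- The generator `x_i` of `ℍ`. -/
def hx (p : Param r → F) (i : Fin n) : H n p := RingQuot.mkAlgHom F (Rel n p) (fx F r i)

/-- The generator `y_i` of `ℍ`. -/
def hy (p : Param r → F) (i : Fin n) : H n p := RingQuot.mkAlgHom F (Rel n p) (fy F r i)

/-- The generator `t_w` of `ℍ`. -/
def ht (p : Param r → F) (w : W r n) : H n p := RingQuot.mkAlgHom F (Rel n p) (ft F w)

/-- The monomial `x^μ` in `ℍ`. -/
def hmon (p : Param r → F) (μ : Fin n → ℕ) : H n p := (List.ofFn fun i => hx p i ^ μ i).prod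

/-- The Dunkl-Opdam elements `z_i = y_i x_i + c_0 φ_i`. -/
def hz (p : Param r → F) (i : Fin n) : H n p :=
  hy p i * hx p i + p Param.c0 • jm (ht p) i

/-- The subalgebra `𝔱` generated by `z_1, …, z_n` and `t_{ζ_1}, …, t_{ζ_n}`. -/
def tAlg (n : ℕ) (p : Param r → F) : Subalgebra F (H n p) :=
  Algebra.adjoin F
    ((Set.range fun i : Fin n => hz p i) ∪ Set.range fun i : Fin n => ht p (zetaElt r i))

/-- The `α`-weight space of an `ℍ`-module: the vectors `m` for which there is a positive `q` with
`(f - α(f))^q.m = 0` for all `f ∈ 𝔱`. -/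
def weightSpace (p : Param r → F) (M : Type) [AddCommGroup M] [Module F M] [Module (H n p) M]
    [IsScalarTower F (H n p) M] [SMulCommClass F (H n p) M] (α : tAlg n p →ₐ[F] F) :
    Submodule F M where
  carrier := {m | ∃ q : ℕ, 0 < q ∧
    ∀ f : tAlg n p, ((f : H n p) - algebraMap F (H n p) (α f)) ^ q • m = 0}
  zero_mem' := ⟨1, one_pos, fun f => smul_zero _⟩
  add_mem' := by
    rintro a b ⟨q, hq, ha⟩ ⟨s, hs, hb⟩
    refine ⟨q + s, by omega, fun f => ?_⟩
    rw [smul_add]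
    nth_rewrite 1 [add_comm q s]
    rw [pow_add, pow_add, mul_smul, mul_smul, ha, hb, smul_zero, smul_zero, add_zero]
  smul_mem' := by
    rintro c m ⟨q, hq, hm⟩
    exact ⟨q, hq, fun f => by rw [smul_comm, hm, smul_zero]⟩

/-! ### Standard modules -/

/-- The relations `h t_w ⊗ v = h ⊗ t_w.v` and `h y_i ⊗ v = 0` in `ℍ ⊗_F S^λ`. -/
def indSub (p : Param r → F) (lam : RPartition r n) :
    Submodule (H n p) (H n p ⊗[F] Specht F lam) :=
  Submodule.span (H n p)
    ({m : H n p ⊗[F] Specht F lam | ∃ (w : W r n) (v : Specht F lam),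
        m = ht p w ⊗ₜ v - 1 ⊗ₜ (gt F w • v)} ∪
      {m | ∃ (i : Fin n) (v : Specht F lam), m = hy p i ⊗ₜ v})

/-- The standard module `M(λ) = Ind S^λ`, induced from the subalgebra generated by the group
algebra and the `y_i`, where every `y_i` acts on `S^λ` by zero: the quotient of `ℍ ⊗_F S^λ` by
the relations `h t_w ⊗ v = h ⊗ t_w.v` and `h y_i ⊗ v = 0`. -/
def M (p : Param r → F) (lam : RPartition r n) : Type :=
  (H n p ⊗[F] Specht F lam) ⧸ indSub p lam

instance (p : Param r → F) (lam : RPartition r n) : AddCommGroup (M p lam) :=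
  inferInstanceAs (AddCommGroup ((H n p ⊗[F] Specht F lam) ⧸ indSub p lam))

instance (p : Param r → F) (lam : RPartition r n) : Module (H n p) (M p lam) :=
  inferInstanceAs (Module (H n p) ((H n p ⊗[F] Specht F lam) ⧸ indSub p lam))

instance (p : Param r → F) (lam : RPartition r n) : Module F (M p lam) :=
  inferInstanceAs (Module F ((H n p ⊗[F] Specht F lam) ⧸ indSub p lam))

instance (p : Param r → F) (lam : RPartition r n) : IsScalarTower F (H n p) (M p lam) :=
  inferInstanceAs (IsScalarTower F (H n p) ((H n p ⊗[F] Specht F lam) ⧸ indSub p lam))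

instance (p : Param r → F) (lam : RPartition r n) : SMulCommClass F (H n p) (M p lam) :=
  IsScalarTower.to_smulCommClass

/-- The vector `x^μ v_T^μ` of `M(λ)`, where `v_T^μ = t_{w_μ}⁻¹.v_T`. -/
def basisVec (p : Param r → F) {lam : RPartition r n} (a : (Fin n → ℕ) × SYT lam) : M p lam :=
  (indSub p lam).mkQ (hmon p a.1 ⊗ₜ (gt F (permElt r (wPerm a.1))⁻¹ • vec F a.2))

/-- `f` is a `𝔱`-eigenvector of the form `f = x^μ v_T^μ + lower terms`. -/
def IsJack (p : Param r → F) {lam : RPartition r n} (μ : Fin n → ℕ) (T : SYT lam)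
    (f : M p lam) : Prop :=
  f - basisVec p (μ, T) ∈ Submodule.span F
      {m | ∃ (ν : Fin n → ℕ) (S : SYT lam), CompLT ν μ ∧ m = basisVec p (ν, S)} ∧
    f ≠ 0 ∧ ∀ g ∈ tAlg n p, ∃ a : F, g • f = a • f

end Cherednik

/-! ### Generic parameters and specialization -/

/-- The field `ℂ(κ, c_0, d_1, …, d_{r-1})`. -/
abbrev GenField (r : ℕ) : Type := FractionRing (MvPolynomial (Param r) ℂ)

/-- The generic parameters. -/
def genPar (r : ℕ) : Param r → GenField r := fun i =>
  algebraMap (MvPolynomial (Param r) ℂ) (GenField r) (MvPolynomial.X i)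

/-- A rational function in the parameters is regular at the point `p`. -/
def RegularAt {r : ℕ} (p : Param r → ℂ) (a : GenField r) : Prop :=
  ∃ u v : MvPolynomial (Param r) ℂ, MvPolynomial.eval p v ≠ 0 ∧
    a = algebraMap _ (GenField r) u / algebraMap _ (GenField r) v

/-- The generic eigenvector `f_{μ,T}` is well-defined at the point `p`: its coefficients in
the basis `x^ν v_S^ν` are rational functions of the parameters without a pole at `p`. -/
def JackWellDefined {r n : ℕ} [NeZero r] (lam : RPartition r n) (p : Param r → ℂ)
    (μ : Fin n → ℕ) (T : SYT lam) : Prop :=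
  ∃ c : ((Fin n → ℕ) × SYT lam) →₀ GenField r, (∀ a, RegularAt p (c a)) ∧
    IsJack (genPar r) μ T (Finsupp.linearCombination (GenField r) (basisVec (genPar r)) c)

/-- The specialized parameters `κ = 1`, `c_0` and `d_1, …, d_{r-1}`. -/
def point {r : ℕ} (c0 : ℂ) (d : {j : ZMod r // j ≠ 0} → ℂ) : Param r → ℂ
  | Param.kappa => 1
  | Param.c0 => c0
  | Param.d j => d j

/-- The intertwiner `σ_i = t_{s_i} + c_0 (z_i - z_{i+1})⁻¹ π_i` (where `j = i + 1`) is well-defined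
on a weight space if `z_i - z_{i+1}` is invertible on it or `π_i` is zero on it. -/
def SigmaDefinedOn {F : Type} [Field F] [Algebra ℂ F] {r n : ℕ} [NeZero r] (p : Param r → F)
    (lam : RPartition r n) (i j : Fin n) (α : tAlg n p →ₐ[F] F) : Prop :=
  Set.BijOn (fun m : M p lam => (hz p i - hz p j) • m)
      (weightSpace p (M p lam) α) (weightSpace p (M p lam) α) ∨
    ∀ m ∈ weightSpace p (M p lam) α, piElt (ht p) i j • m = 0

/-- The pair `wt(μ,T)_i` (at `κ = 1`). -/
def wt {r n : ℕ} [NeZero r] {lam : RPartition r n} (c0 : ℂ) (d : {j : ZMod r // j ≠ 0} → ℂ)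
    (μ : Fin n → ℕ) (T : SYT lam) (i : Fin n) : ℂ × ℂ :=
  let b := T.box (wPerm μ i)
  ((μ i : ℂ) + 1 - (dPar (point c0 d) (beta b) - dPar (point c0 d) (beta b - (μ i : ZMod r) - 1))
      - c0 * (r : ℂ) * (ct b : ℂ),
    zetaPow ℂ (beta b - (μ i : ZMod r)))

/-! ### Exceptional hyperplanes -/

/-- The maximal content of a cell of a (nonempty) diagram. -/
def ctMax (ν : YoungDiagram) : ℤ := sSup (cellContent '' (ν.cells : Set (ℕ × ℕ)))

/-- The minimal content of a cell of a (nonempty) diagram. -/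
def ctMin (ν : YoungDiagram) : ℤ := sInf (cellContent '' (ν.cells : Set (ℕ × ℕ)))

/-- The diagram is a single row. -/
def IsRow (ν : YoungDiagram) : Prop := ν ≠ ⊥ ∧ ∀ c ∈ ν, c.1 = 0

/-- The diagram is a single column. -/
def IsColumn (ν : YoungDiagram) : Prop := ν ≠ ⊥ ∧ ∀ c ∈ ν, c.2 = 0

/-- The hyperplane `H_{k,l,m}` given by `k = d_l - d_{l-k} + m r c_0` in the space of
parameters `(c_0, d_1, …, d_{r-1})`. -/
def hyper {r : ℕ} [NeZero r] (k : ℤ) (l : ZMod r) (m : ℤ) :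
    Set (ℂ × ({j : ZMod r // j ≠ 0} → ℂ)) :=
  {q | (k : ℂ) = dPar (point q.1 q.2) l - dPar (point q.1 q.2) (l - (k : ZMod r))
    + (m : ℂ) * (r : ℂ) * q.1}

/-- The set `𝓔_λ` of exceptional hyperplanes. -/
def excHyper {r n : ℕ} [NeZero r] (lam : RPartition r n) :
    Set (Set (ℂ × ({j : ZMod r // j ≠ 0} → ℂ))) :=
  {E | ∃ (k : ℤ) (l : ZMod r) (m : ℤ), 0 < k ∧ ¬ (r : ℤ) ∣ k ∧
      lam.comp l ≠ ⊥ ∧ lam.comp (l - (k : ZMod r)) ≠ ⊥ ∧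
      ctMin (lam.comp l) - ctMax (lam.comp (l - (k : ZMod r))) ≤ m ∧
      m ≤ ctMax (lam.comp l) - ctMin (lam.comp (l - (k : ZMod r))) ∧ E = hyper k l m} ∪
  {E | ∃ (i : ZMod r) (k m : ℤ), 0 < k ∧ lam.comp i ≠ ⊥ ∧
      ((IsRow (lam.comp i) ∧ 0 < m ∧ m ≤ ctMax (lam.comp i)) ∨
        (IsColumn (lam.comp i) ∧ ctMin (lam.comp i) ≤ m ∧ m < 0) ∨
        (¬ IsRow (lam.comp i) ∧ ¬ IsColumn (lam.comp i) ∧ m ≠ 0 ∧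
          ctMin (lam.comp i) - ctMax (lam.comp i) ≤ m ∧
          m ≤ ctMax (lam.comp i) - ctMin (lam.comp i))) ∧
      E = {q | (k : ℂ) = q.1 * (m : ℂ)}}

end RCA

end

open RCA

open scoped TensorProduct
noncomputable section
namespace RCA

/-! The pivot is the injectivity of the map that sends `(μ, T)` to the joint weight of `𝔱` on `x^μ
v_T^μ`. In this basis of `M(λ)` the commuting operators of `𝔱` are triangular for the order on
compositions (`tAlg_triangular`), with diagonal entries given by `zWeight` and `tWeight`. Below each
index there are only finitely many others, so a finite product of factors `g - χ(g)` removes the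
foreign weights from a basis vector (`weightProj`) and leaves a generalized eigenvector with the
same leading term. Hence weight spaces are lines exactly when the weights are pairwise distinct.

Avoiding the hyperplanes makes the weights distinct (`injective_weight_of_avoid`). If `(μ, T)` and
`(ν, S)` have the same weight and `μ_i ≠ ν_i`, then the positive integer `|μ_i - ν_i|` satisfies the
equation of a hyperplane. The only equations of this kind missing from the list belong to a single
row or a single column, and then the sign of `c_0` makes `μ_i + g · rank` with `g > 0` an invariant
of the weight. Since `w_μ` sorts `μ`, ordering by this invariant is ordering by rank, so the ranks
agree, and so do `μ_i` and `ν_i`. Once `μ = ν`, the contents agree because `c_0 ≠ 0`, and contents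
determine a standard tableau.

Distinct weights give (a), (d) and (e): there is an eigenbasis; its members are given by a
projection formula whose denominator does not vanish at the point; and on a line `z_i - z_{i+1}` and
`π_i` are scalars.

Each of (a), (d), (e) gives (b). Under (a) the weights are distinct, and a coincidence of adjacent
weights with `μ_i ≠ μ_{i+1}` would be shared by `s_i.μ`, while for `μ_i = μ_{i+1}` consecutive
entries of `T` have different contents. Under (d) there is an eigenbasis, and comparing diagonal
coefficients in `t_{s_i} z_i = z_{i+1} t_{s_i} - c_0 π_i` gives `c_0 r = 0` at a coincidence. Under
(e) a generalized eigenvector at a coincidence contradicts both alternatives.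

Finally (b) gives (c): on a hyperplane, two boxes with the prescribed difference of contents and a
composition with entries `0` and `k` produce two equal adjacent weights (`exists_wt_eq_of_mem`).

All this rests on a basis of `M(λ)`, which is given by generators and relations. That `S^λ` does not
collapse follows by verifying Young's orthonormal form through the Coxeter presentation
(`linearIndependent_vec`); that `M(λ)` is `F[x] ⊗ S^λ` follows from Dunkl operators (`mEquiv`).
Generic and special parameters are compared by the relation `MRel`, which is stable under `ℍ` and
determines the special vector from the generic one. -/

/-! ### The Coxeter presentation of the symmetric group -/

section Presentation

variable {Q : Type*} [Monoid Q]

/-- The product `h_k h_{k+1} ⋯ h_{k+a-1}`. -/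
def ascProd (h : ℕ → Q) (k : ℕ) : ℕ → Q
  | 0 => 1
  | a + 1 => h k * ascProd h (k + 1) a

theorem commute_ascProd {h : ℕ → Q} {N : ℕ}
    (hc : ∀ i j, i + 1 < j → j < N → h i * h j = h j * h i) {i : ℕ} (a : ℕ) :
    ∀ k, i + 1 < k → k + a ≤ N → h i * ascProd h k a = ascProd h k a * h i := by
  induction a with
  | zero => intro k _ _; simp [ascProd]
  | succ a ih =>
    intro k hk hN
    rw [ascProd, ← mul_assoc, hc i k hk (by omega), mul_assoc, ih (k + 1) (by omega) (by omega),
      mul_assoc]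

/-- A generator inside the range of an ascending product commutes past the early factors, meets one
braid relation, and leaves with its index lowered by one. -/
theorem mul_ascProd {h : ℕ → Q} {N : ℕ}
    (hb : ∀ i, i + 1 < N → h i * h (i + 1) * h i = h (i + 1) * h i * h (i + 1))
    (hc : ∀ i j, i + 1 < j → j < N → h i * h j = h j * h i) (a : ℕ) :
    ∀ k i, k < i → i < k + a → k + a ≤ N → h i * ascProd h k a = ascProd h k a * h (i - 1) := by
  induction a with
  | zero => intro k i h1 h2; omega
  | succ a ih =>
    intro k i h1 h2 hN
    rcases Nat.lt_or_ge (k + 1) i with h3 | h3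
    · rw [ascProd, ← mul_assoc, ← hc k i h3 (by omega), mul_assoc,
        ih (k + 1) i h3 (by omega) (by omega), mul_assoc]
    · obtain rfl : i = k + 1 := by omega
      obtain ⟨a, rfl⟩ : ∃ a', a = a' + 1 := ⟨a - 1, by omega⟩
      rw [ascProd, ascProd, Nat.add_sub_cancel, ← mul_assoc, ← mul_assoc, ← hb k (by omega)]
      simp only [mul_assoc]
      rw [commute_ascProd hc a (k + 1 + 1) (by omega) (by omega)]

/-- A product of the first `m + 1` Coxeter generators can be sorted. -/
theorem exists_ascProd_mul {h : ℕ → Q} {N : ℕ} (hs : ∀ i, i < N → h i * h i = 1)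
    (hb : ∀ i, i + 1 < N → h i * h (i + 1) * h i = h (i + 1) * h i * h (i + 1))
    (hc : ∀ i j, i + 1 < j → j < N → h i * h j = h j * h i) {m : ℕ} (hm : m < N) {x : Q}
    (hx : x ∈ Submonoid.closure (h '' Set.Iio (m + 1))) :
    ∃ a, a ≤ m + 1 ∧ ∃ y ∈ Submonoid.closure (h '' Set.Iio m),
      x = ascProd h (m + 1 - a) a * y := by
  induction hx using Submonoid.closure_induction_left with
  | one => exact ⟨0, by omega, 1, one_mem _, by simp [ascProd]⟩
  | mul_left u hu v _ ih =>
    obtain ⟨i, hi, rfl⟩ := hu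
    simp only [Set.mem_Iio] at hi
    obtain ⟨a, ha, y, hy, rfl⟩ := ih
    have hgen : ∀ j, j < m → h j ∈ Submonoid.closure (h '' Set.Iio m) := fun j hj =>
      Submonoid.subset_closure ⟨j, hj, rfl⟩
    -- Left multiplication by `h i` has four outcomes for the ascending factor: `h i` commutes with
    -- it, extends it to the left, cancels its first letter, or passes through and becomes `h (i -
    -- 1)`.
    rcases lt_trichotomy i (m + 1 - a) with h1 | h1 | h1
    · rcases Nat.lt_or_ge (i + 1) (m + 1 - a) with h2 | h2
      · refine ⟨a, ha, h i * y, mul_mem (hgen i (by omega)) hy, ?_⟩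
        rw [← mul_assoc, commute_ascProd hc a _ h2 (by omega), mul_assoc]
      · refine ⟨a + 1, by omega, y, hy, ?_⟩
        obtain rfl : i = m + 1 - (a + 1) := by omega
        rw [ascProd, show m + 1 - (a + 1) + 1 = m + 1 - a by omega, mul_assoc]
    · obtain ⟨a, rfl⟩ : ∃ a', a = a' + 1 := ⟨a - 1, by omega⟩
      refine ⟨a, by omega, y, hy, ?_⟩
      rw [ascProd, ← h1, ← mul_assoc, ← mul_assoc, hs i (by omega), one_mul,
        show m + 1 - a = i + 1 by omega]
    · refine ⟨a, ha, h (i - 1) * y, mul_mem (hgen _ (by omega)) hy, ?_⟩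
      rw [← mul_assoc, mul_ascProd hb hc a _ _ h1 (by omega) (by omega), mul_assoc]

/-- The transposition `(i, i + 1)` of `Fin n`, or the identity if `i + 1` is too large. -/
def adjSwap (n i : ℕ) : Equiv.Perm (Fin n) :=
  if h : i + 1 < n then Equiv.swap ⟨i, by omega⟩ ⟨i + 1, h⟩ else 1

theorem adjSwap_of_lt {n i : ℕ} (h : i + 1 < n) :
    adjSwap n i = Equiv.swap ⟨i, by omega⟩ ⟨i + 1, h⟩ := dif_pos h

theorem adjSwap_mul_self (n i : ℕ) : adjSwap n i * adjSwap n i = 1 := by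
  unfold adjSwap; split_ifs <;> simp

theorem adjSwap_apply_of_ne {n i : ℕ} {x : Fin n} (h1 : (x : ℕ) ≠ i) (h2 : (x : ℕ) ≠ i + 1) :
    adjSwap n i x = x := by
  unfold adjSwap
  split_ifs with h
  · exact Equiv.swap_apply_of_ne_of_ne (by grind) (by grind)
  · rfl

theorem adjSwap_braid {n i : ℕ} (h : i + 2 < n) :
    adjSwap n i * adjSwap n (i + 1) * adjSwap n i =
      adjSwap n (i + 1) * adjSwap n i * adjSwap n (i + 1) := by
  rw [adjSwap_of_lt (show i + 1 < n by omega), adjSwap_of_lt (show i + 1 + 1 < n by omega)]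
  have key : ∀ x y z : Fin n, x ≠ y → y ≠ z → x ≠ z →
      Equiv.swap x y * Equiv.swap y z * Equiv.swap x y =
        Equiv.swap y z * Equiv.swap x y * Equiv.swap y z := by
    intro x y z h1 h2 h3
    rw [Equiv.swap_mul_swap_mul_swap h1 h3, Equiv.swap_comm x y, Equiv.swap_comm y z,
      Equiv.swap_mul_swap_mul_swap h2.symm h3.symm, Equiv.swap_comm]
  exact key _ _ _ (by simp) (by simp) (by simp; omega)

theorem adjSwap_comm {n i j : ℕ} (hij : i + 1 < j) (h : j + 1 < n) :
    adjSwap n i * adjSwap n j = adjSwap n j * adjSwap n i := by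
  rw [adjSwap_of_lt (show i + 1 < n by omega), adjSwap_of_lt h]
  refine Equiv.Perm.Disjoint.commute ?_
  rw [Equiv.Perm.disjoint_iff_disjoint_support, Equiv.Perm.support_swap (by simp),
    Equiv.Perm.support_swap (by simp)]
  simp
  omega

theorem closure_adjSwap (n : ℕ) :
    Submonoid.closure (adjSwap n '' Set.Iio (n - 1)) = ⊤ := by
  rcases n with _ | n
  · exact Subsingleton.elim _ _
  · rw [← Equiv.Perm.mclosure_swap_castSucc_succ]
    congr 1
    ext s
    constructor
    · rintro ⟨i, hi, rfl⟩
      simp only [Nat.add_sub_cancel, Set.mem_Iio] at hi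
      exact ⟨⟨i, hi⟩, by rw [adjSwap_of_lt (by omega)]; rfl⟩
    · rintro ⟨i, rfl⟩
      exact ⟨i, by simp, by rw [adjSwap_of_lt (by omega)]; rfl⟩

end Presentation

/-! ### Homomorphisms from the symmetric group defined by the Coxeter relations -/

section Lift

variable {G : Type*} [Monoid G] {n : ℕ} {g : ℕ → G}

/-- The graph generators of the homomorphism sending `(i, i + 1)` to `g_i`. -/
def graphGen (n : ℕ) (g : ℕ → G) (i : ℕ) : Equiv.Perm (Fin n) × G := (adjSwap n i, g i)

theorem closure_graphGen_apply {m : ℕ} {x : Equiv.Perm (Fin n) × G}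
    (hx : x ∈ Submonoid.closure (graphGen n g '' Set.Iio m)) (j : Fin n) (hj : m < j) :
    x.1 j = j := by
  induction hx using Submonoid.closure_induction_left with
  | one => rfl
  | mul_left u hu v _ ih =>
    obtain ⟨i, hi, rfl⟩ := hu
    simp only [Set.mem_Iio] at hi
    rw [Prod.fst_mul, Equiv.Perm.mul_apply, ih]
    exact adjSwap_apply_of_ne (by omega) (by omega)

theorem ascProd_graphGen_apply (a : ℕ) :
    ∀ k (hk : k + a < n), (ascProd (graphGen n g) k a).1 ⟨k + a, hk⟩ = ⟨k, by omega⟩ := by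
  induction a with
  | zero => intro k hk; rfl
  | succ a ih =>
    intro k hk
    have : (⟨k + (a + 1), hk⟩ : Fin n) = ⟨k + 1 + a, by omega⟩ := Fin.ext (by simp; omega)
    rw [ascProd, Prod.fst_mul, Equiv.Perm.mul_apply, this, ih (k + 1) (by omega), graphGen,
      adjSwap_of_lt (by omega), Equiv.swap_apply_right]

/-- In the normal form, the ascending factor carries the point `m + 1` to `m + 1 - a`, while the
remaining factor fixes `m + 1`. A trivial permutation therefore forces `a = 0`, which removes the
last generator and allows induction on `m`. -/
theorem eq_one_of_mem_closure_graphGen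
    (hs : ∀ i, i + 1 < n → g i * g i = 1)
    (hb : ∀ i, i + 2 < n → g i * g (i + 1) * g i = g (i + 1) * g i * g (i + 1))
    (hc : ∀ i j, i + 1 < j → j + 1 < n → g i * g j = g j * g i) {m : ℕ} (hm : m ≤ n - 1) {x : G}
    (hx : ((1 : Equiv.Perm (Fin n)), x) ∈ Submonoid.closure (graphGen n g '' Set.Iio m)) :
    x = 1 := by
  induction m with
  | zero => simpa using hx
  | succ m ih =>
    obtain ⟨a, ha, y, hy, hxy⟩ := exists_ascProd_mul (N := n - 1)
      (fun i hi => Prod.ext (adjSwap_mul_self n i) (hs i (by omega)))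
      (fun i hi => Prod.ext (adjSwap_braid (by omega)) (hb i (by omega)))
      (fun i j hij hj => Prod.ext (adjSwap_comm hij (by omega)) (hc i j hij (by omega)))
      (by omega) hx
    have h1 := congrArg (fun z => z.1 ⟨m + 1, by omega⟩) hxy
    simp only [Equiv.Perm.coe_one, id_eq, Prod.fst_mul, Equiv.Perm.mul_apply] at h1
    rw [closure_graphGen_apply hy _ (by simp)] at h1
    have h2 := ascProd_graphGen_apply (n := n) (g := g) a (m + 1 - a) (by omega)
    have h3 : (⟨m + 1 - a + a, by omega⟩ : Fin n) = ⟨m + 1, by omega⟩ := Fin.ext (by simp; omega)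
    rw [h3, ← h1] at h2
    have h4 : a = 0 := by simp at h2; omega
    subst h4
    rw [ascProd, one_mul] at hxy
    exact ih (by omega) (hxy ▸ hy)

/-- The Coxeter relations present the symmetric group. -/
theorem exists_permHom
    (hs : ∀ i, i + 1 < n → g i * g i = 1)
    (hb : ∀ i, i + 2 < n → g i * g (i + 1) * g i = g (i + 1) * g i * g (i + 1))
    (hc : ∀ i j, i + 1 < j → j + 1 < n → g i * g j = g j * g i) :
    ∃ f : Equiv.Perm (Fin n) →* G, ∀ i, i + 1 < n → f (adjSwap n i) = g i := by
  -- `Γ` will be the graph of the homomorphism: it projects onto the whole symmetric group, and its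
  -- fibre over the identity is trivial.
  set Γ := Submonoid.closure (graphGen n g '' Set.Iio (n - 1)) with hΓ
  have hex : ∀ s : Equiv.Perm (Fin n), ∃ x, (s, x) ∈ Γ := by
    intro s
    have hs' : s ∈ Submonoid.closure (adjSwap n '' Set.Iio (n - 1)) := by
      rw [closure_adjSwap]; trivial
    induction hs' using Submonoid.closure_induction with
    | mem s h => obtain ⟨i, hi, rfl⟩ := h; exact ⟨g i, Submonoid.subset_closure ⟨i, hi, rfl⟩⟩
    | one => exact ⟨1, one_mem _⟩
    | mul s t _ _ h1 h2 =>
      obtain ⟨x, hx⟩ := h1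
      obtain ⟨y, hy⟩ := h2
      exact ⟨x * y, mul_mem hx hy⟩
  have huniq : ∀ s x y, (s, x) ∈ Γ → (s, y) ∈ Γ → x = y := by
    intro s x y hx hy
    obtain ⟨z, hz⟩ := hex s⁻¹
    have key : ∀ u v, ((1 : Equiv.Perm (Fin n)) = u * v) → ∀ a b, (u, a) ∈ Γ → (v, b) ∈ Γ →
        a * b = 1 := fun u v h a b ha hb' =>
      eq_one_of_mem_closure_graphGen hs hb hc le_rfl (by rw [h]; exact mul_mem ha hb')
    have h1 := key s s⁻¹ (by simp) x z hx hz
    have h2 := key s⁻¹ s (by simp) z y hz hy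
    rw [← mul_one x, ← h2, ← mul_assoc, h1, one_mul]
  choose f hf using hex
  refine ⟨⟨⟨f, huniq _ _ _ (hf 1) (one_mem _)⟩, fun s t =>
    huniq _ _ _ (hf _) (mul_mem (hf s) (hf t))⟩, fun i hi => ?_⟩
  exact huniq _ _ _ (hf _) (Submonoid.subset_closure ⟨i, by simp; omega, rfl⟩)

end Lift


/-! ### Reflections in `G(r,1,n)` -/

section Group

variable {r n : ℕ}

/-- The diagonal matrix `ζ_i^l`. -/
def diagRefl (i : Fin n) (l : ZMod r) : W r n :=
  SemidirectProduct.inl fun k => Multiplicative.ofAdd (if k = i then l else 0)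

/-- The reflection `ζ_i^l s_{ij} ζ_i^{-l}`, with `l` modulo `r`. -/
def refl (i j : Fin n) (l : ZMod r) : W r n :=
  ⟨fun k => Multiplicative.ofAdd ((if k = i then l else 0) - (if k = j then l else 0)),
    Equiv.swap i j⟩

theorem zetaElt_pow (i : Fin n) (l : ℕ) : zetaElt r i ^ l = diagRefl i (l : ZMod r) := by
  rw [zetaElt, ← map_pow, diagRefl]
  congr 1
  ext k
  by_cases h : k = i
  · subst h; simp [← ofAdd_nsmul]
  · simp [h]

theorem zetaElt_eq (i : Fin n) : zetaElt r i = diagRefl i 1 := by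
  simpa using zetaElt_pow (r := r) i 1

theorem mulAutArrow_apply_apply (s : Equiv.Perm (Fin n)) (a : Fin n → Multiplicative (ZMod r))
    (k : Fin n) : (mulAutArrow s : MulAut (Fin n → Multiplicative (ZMod r))) a k = a (s⁻¹ k) := rfl

theorem W_ext {w v : W r n} (h1 : ∀ k, (w.left k).toAdd = (v.left k).toAdd)
    (h2 : w.right = v.right) : w = v :=
  SemidirectProduct.ext (funext fun k => Multiplicative.toAdd.injective (h1 k)) h2

theorem W_mul_left (w v : W r n) (k : Fin n) :
    ((w * v).left k).toAdd = (w.left k).toAdd + (v.left (w.right⁻¹ k)).toAdd := rfl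

@[simp] theorem diagRefl_left (i : Fin n) (l : ZMod r) (k : Fin n) :
    ((diagRefl i l).left k).toAdd = if k = i then l else 0 := rfl

@[simp] theorem diagRefl_right (i : Fin n) (l : ZMod r) : (diagRefl i l).right = 1 := rfl

@[simp] theorem refl_left (i j : Fin n) (l : ZMod r) (k : Fin n) :
    ((refl i j l).left k).toAdd = (if k = i then l else 0) - (if k = j then l else 0) := rfl

@[simp] theorem refl_right (i j : Fin n) (l : ZMod r) : (refl i j l).right = Equiv.swap i j := rfl

@[simp] theorem permElt_left (s : Equiv.Perm (Fin n)) (k : Fin n) :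
    ((permElt r s).left k).toAdd = 0 := rfl

@[simp] theorem permElt_right (s : Equiv.Perm (Fin n)) : (permElt r s).right = s := rfl

theorem diagRefl_add (i : Fin n) (l m : ZMod r) :
    diagRefl i (l + m) = diagRefl i l * diagRefl i m := by
  refine W_ext (fun k => ?_) (by simp)
  rw [W_mul_left]; simp; split_ifs <;> simp

theorem diagRefl_zero (i : Fin n) : diagRefl i (0 : ZMod r) = 1 :=
  W_ext (fun k => by simp) rfl

theorem diagRefl_inv (i : Fin n) (l : ZMod r) : (diagRefl i l)⁻¹ = diagRefl i (-l) := by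
  rw [inv_eq_iff_mul_eq_one, ← diagRefl_add, add_neg_cancel, diagRefl_zero]

theorem diagRefl_comm (i j : Fin n) (l m : ZMod r) :
    diagRefl i l * diagRefl j m = diagRefl j m * diagRefl i l := by
  refine W_ext (fun k => ?_) (by simp)
  rw [W_mul_left, W_mul_left]; simp [add_comm]

theorem reflElt_eq {i j : Fin n} (l : ℕ) :
    reflElt r i j l = refl i j (l : ZMod r) := by
  rw [reflElt, zetaElt_pow, diagRefl_inv]
  refine W_ext (fun k => ?_) (by simp)
  rw [W_mul_left, W_mul_left]
  simp only [diagRefl_left, permElt_left, SemidirectProduct.mul_right, diagRefl_right,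
    permElt_right, refl_left, one_mul, Equiv.swap_inv, add_zero]
  have : Equiv.swap i j k = i ↔ k = j := (Equiv.eq_symm_apply _).symm.trans (by simp)
  simp only [this]
  split_ifs <;> simp

theorem refl_comm (i j : Fin n) (l : ZMod r) : refl i j l = refl j i (-l) := by
  refine W_ext (fun k => ?_) (Equiv.swap_comm _ _)
  simp only [refl_left]
  split_ifs <;> simp

theorem mul_refl (w : W r n) (i j : Fin n) (l : ZMod r) :
    w * refl i j l = refl (w.right i) (w.right j)
      (l + (w.left (w.right i)).toAdd - (w.left (w.right j)).toAdd) * w := by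
  refine W_ext (fun k => ?_) ?_
  · rw [W_mul_left, W_mul_left]
    simp only [refl_left, refl_right, Equiv.swap_inv, Equiv.Perm.inv_eq_iff_eq]
    by_cases h1 : k = w.right i
    · subst h1
      by_cases h2 : w.right i = w.right j
      · simp [h2]
      · simp [h2]; ring
    · by_cases h2 : k = w.right j
      · subst h2
        simp [h1]; ring
      · simp [h1, h2, Equiv.swap_apply_of_ne_of_ne h1 h2]
  · simp only [SemidirectProduct.mul_right, refl_right]
    ext k
    simp [Equiv.swap_apply_apply]

theorem mul_diagRefl (w : W r n) (i : Fin n) (l : ZMod r) :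
    w * diagRefl i l = diagRefl (w.right i) l * w := by
  refine W_ext (fun k => ?_) (by simp)
  rw [W_mul_left, W_mul_left]
  simp only [diagRefl_left, diagRefl_right, Equiv.Perm.inv_eq_iff_eq]
  simp [add_comm]

theorem permElt_mul_diagRefl_mul (i j : Fin n) (l : ZMod r) :
    permElt r (Equiv.swap i j) * (diagRefl i l * diagRefl j (-l)) = refl i j (-l) := by
  refine W_ext (fun k => ?_) (by simp)
  rw [W_mul_left, W_mul_left]
  have h1 : Equiv.swap i j k = i ↔ k = j := (Equiv.eq_symm_apply _).symm.trans (by simp)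
  have h2 : Equiv.swap i j k = j ↔ k = i := (Equiv.eq_symm_apply _).symm.trans (by simp)
  simp [h1, h2]
  split_ifs <;> simp

/-- `G(r,1,n)` is generated by the `ζ_i` and the adjacent transpositions. -/
theorem W_induction [NeZero r] {p : W r n → Prop} (h1 : p 1)
    (hz : ∀ i w, p w → p (zetaElt r i * w))
    (hs : ∀ i, i + 1 < n → ∀ w, p w → p (permElt r (adjSwap n i) * w)) (w : W r n) : p w := by
  have hperm : ∀ s : Equiv.Perm (Fin n), p (permElt r s) := by
    intro s
    have hs' : s ∈ Submonoid.closure (adjSwap n '' Set.Iio (n - 1)) := by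
      rw [closure_adjSwap]; trivial
    induction hs' using Submonoid.closure_induction_left with
    | one => exact h1
    | mul_left u hu v _ ih =>
      obtain ⟨i, hi, rfl⟩ := hu
      simp only [Set.mem_Iio] at hi
      rw [permElt, map_mul]
      exact hs i (by omega) _ ih
  have hdiag : ∀ (i : Fin n) (l : ℕ) w, p w → p (zetaElt r i ^ l * w) := by
    intro i l w hw
    induction l with
    | zero => simpa using hw
    | succ l ih => rw [pow_succ', mul_assoc]; exact hz _ _ ih
  -- Induction on a finite set of positions containing all nontrivial diagonal entries: one power of
  -- `ζ_i` is split off for each position.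
  have hall : ∀ (s : Finset (Fin n)) (w : W r n), (∀ k ∉ s, w.left k = 1) → p w := by
    intro s
    induction s using Finset.induction_on with
    | empty =>
      intro w hw
      have : w = permElt r w.right :=
        W_ext (fun k => by rw [hw k (by simp)]; rfl) rfl
      rw [this]; exact hperm _
    | insert i s his ih =>
      intro w hw
      have : w = zetaElt r i ^ (w.left i).toAdd.val *
          (diagRefl i (-(w.left i).toAdd) * w) := by
        rw [zetaElt_pow, ← mul_assoc, ← diagRefl_add]; simp [diagRefl_zero]
      rw [this]
      refine hdiag _ _ _ (ih _ fun k hk => ?_)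
      apply Multiplicative.toAdd.injective
      rw [W_mul_left]
      by_cases h : k = i
      · subst h; simp
      · have := hw k (by simp [h, hk])
        simp [h, this]
  exact hall Finset.univ w (by simp)

/-- Conjugation in `G(r,1,n)` shifts or negates the exponents of reflections. With exponents modulo
`r` this is a bijection of the index set of the sum. -/
theorem sum_range_zmod {A : Type*} [AddCommMonoid A] [NeZero r] (f : ZMod r → A) :
    ∑ l ∈ Finset.range r, f (l : ZMod r) = ∑ l : ZMod r, f l := by
  refine Finset.sum_bij (fun l _ => (l : ZMod r)) (by simp) ?_ ?_ (by simp)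
  · intro a ha b hb hab
    have := congrArg ZMod.val hab
    rwa [ZMod.val_natCast_of_lt (by simpa using ha), ZMod.val_natCast_of_lt (by simpa using hb)]
      at this
  · intro b _
    exact ⟨b.val, by simpa using ZMod.val_lt b, by simp⟩

variable {A : Type} [Ring A] (t : W r n →* A)

theorem permElt_swap_mul_self (i j : Fin n) :
    t (permElt r (Equiv.swap i j)) * t (permElt r (Equiv.swap i j)) = 1 := by
  rw [← map_mul, permElt, ← map_mul, Equiv.swap_mul_self, map_one, map_one]

variable [NeZero r]

/-- The sum of the reflections interchanging `i` and `j`. -/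
def reflSum (i j : Fin n) : A := ∑ l : ZMod r, t (refl i j l)

theorem sum_range_reflElt (i j : Fin n) :
    ∑ l ∈ Finset.range r, t (reflElt r i j l) = reflSum t i j := by
  rw [reflSum, ← sum_range_zmod]
  exact Finset.sum_congr rfl fun l _ => by rw [reflElt_eq]

theorem jm_eq (i : Fin n) :
    jm t i = ∑ j ∈ Finset.univ.filter (· < i), reflSum t i j :=
  Finset.sum_congr rfl fun j _ => sum_range_reflElt t i j

theorem piElt_eq (i j : Fin n) :
    piElt t i j = ∑ l : ZMod r, t (diagRefl i l * diagRefl j (-l)) := by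
  rw [piElt, ← sum_range_zmod]
  refine Finset.sum_congr rfl fun l _ => ?_
  have : Commute (zetaElt r i) (zetaElt r j)⁻¹ := by
    rw [zetaElt_eq, zetaElt_eq, diagRefl_inv]; exact diagRefl_comm _ _ _ _
  rw [← map_pow, this.mul_pow, inv_pow, zetaElt_pow, zetaElt_pow, diagRefl_inv]

theorem reflSum_comm (i j : Fin n) : reflSum t i j = reflSum t j i := by
  rw [reflSum, ← Equiv.sum_comp (Equiv.neg (ZMod r))]
  exact Finset.sum_congr rfl fun l _ => by rw [refl_comm j i]; rfl

theorem mul_reflSum (w : W r n) (i j : Fin n) :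
    t w * reflSum t i j = reflSum t (w.right i) (w.right j) * t w := by
  rw [reflSum, reflSum, Finset.mul_sum, Finset.sum_mul]
  refine Fintype.sum_equiv (Equiv.addRight
    ((w.left (w.right i)).toAdd - (w.left (w.right j)).toAdd)) _ _ fun l => ?_
  rw [← map_mul, mul_refl, map_mul]
  simp [add_sub_assoc]

/-- This factorization is what brings `π_i` into the commutation of `t_{s_i}` with the Jucys-Murphy
elements, and from there into the relation between `t_{s_i}` and `z_i`. -/
theorem permElt_mul_piElt (i j : Fin n) :
    t (permElt r (Equiv.swap i j)) * piElt t i j = reflSum t i j := by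
  rw [piElt_eq, reflSum, Finset.mul_sum, ← Equiv.sum_comp (Equiv.neg (ZMod r))]
  refine Finset.sum_congr rfl fun l _ => ?_
  rw [← map_mul, permElt_mul_diagRefl_mul]; simp

theorem mul_jm_of_lt (w : W r n) (i : Fin n) (hi : w.right i = i)
    (h : ∀ j, w.right j < i ↔ j < i) : t w * jm t i = jm t i * t w := by
  rw [jm_eq, Finset.mul_sum, Finset.sum_mul]
  refine Finset.sum_equiv w.right (by simp [h]) fun j _ => ?_
  rw [mul_reflSum, hi]

/-- The recursion for the Jucys-Murphy elements. -/
theorem jm_succ {i j : Fin n} (hij : (i : ℕ) + 1 = j) :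
    jm t j = t (permElt r (Equiv.swap i j)) * jm t i * t (permElt r (Equiv.swap i j)) +
      reflSum t i j := by
  have h1 : Finset.univ.filter (· < j) = insert i (Finset.univ.filter (· < i)) := by
    ext k; simp only [Finset.mem_filter, Finset.mem_univ, true_and, Finset.mem_insert]; omega
  rw [jm_eq, jm_eq, h1, Finset.sum_insert (by simp), Finset.mul_sum, Finset.sum_mul, add_comm,
    reflSum_comm t i j]
  congr 1
  refine Finset.sum_congr rfl fun k hk => ?_
  simp only [Finset.mem_filter, Finset.mem_univ, true_and] at hk
  rw [mul_reflSum, mul_assoc, permElt_swap_mul_self, mul_one, permElt_right,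
    Equiv.swap_apply_left, Equiv.swap_apply_of_ne_of_ne hk.ne (by grind)]

end Group

/-! ### Powers of `ζ` and orthogonality of characters -/

section ZetaPow

variable {r : ℕ} [NeZero r] (F : Type) [Field F] [Algebra ℂ F]

theorem zetaPow_add (i j : ZMod r) : zetaPow F (i + j) = zetaPow F i * zetaPow F j := by
  simp [zetaPow, AddChar.map_add_eq_mul]

@[simp] theorem zetaPow_zero : zetaPow F (0 : ZMod r) = 1 := by simp [zetaPow]

theorem zetaPow_neg_mul (i : ZMod r) : zetaPow F (-i) * zetaPow F i = 1 := by
  rw [← zetaPow_add]; simp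

theorem zetaPow_mul_neg (i : ZMod r) : zetaPow F i * zetaPow F (-i) = 1 := by
  rw [← zetaPow_add]; simp

theorem zetaPow_nsmul (k : ℕ) (i : ZMod r) : zetaPow F ((k : ZMod r) * i) = zetaPow F i ^ k := by
  induction k with
  | zero => simp
  | succ k ih => rw [Nat.cast_succ, add_mul, one_mul, zetaPow_add, ih, pow_succ]

theorem zetaPow_injective : Function.Injective (zetaPow F : ZMod r → F) := fun _ _ h =>
  ZMod.injective_stdAddChar ((algebraMap ℂ F).injective h)

theorem sum_zetaPow_mul (k : ZMod r) :
    ∑ l : ZMod r, zetaPow F (l * k) = if k = 0 then (r : F) else 0 := by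
  have := AddChar.sum_mulShift k (ZMod.isPrimitive_stdAddChar r)
  simp only [zetaPow, ← map_sum, this, ZMod.card]
  split_ifs <;> simp

end ZetaPow


/-! ### Standard tableaux -/

section Tableaux

variable {r n : ℕ} [NeZero r] {lam : RPartition r n}

theorem Box.ext' {b c : Box lam} (h1 : b.1.1 = c.1.1) (h2 : b.1.2.1 = c.1.2.1)
    (h3 : b.1.2.2 = c.1.2.2) : b = c :=
  Subtype.ext (Prod.ext h1 (Prod.ext h2 h3))

/-- The box in the same component as `b` with coordinates at most those of `b`. -/
def Box.upLeft (b : Box lam) (i j : ℕ) (hi : i ≤ b.1.2.1) (hj : j ≤ b.1.2.2) : Box lam :=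
  ⟨(b.1.1, (i, j)), YoungDiagram.up_left_mem _ hi hj b.2⟩

theorem IsStandard.symm_le {T : Fin n ≃ Box lam} (hT : IsStandard T) {b c : Box lam}
    (h1 : b.1.1 = c.1.1) (h2 : b.1.2.1 ≤ c.1.2.1) (h3 : b.1.2.2 ≤ c.1.2.2) :
    T.symm b ≤ T.symm c := by
  set m : Box lam := c.upLeft b.1.2.1 c.1.2.2 h2 le_rfl with hm
  have hbm : T.symm b ≤ T.symm m := by
    rcases h3.eq_or_lt with h | h
    · rw [show b = m from Box.ext' h1 rfl h]
    · exact (hT b m h1 (Or.inl ⟨rfl, h⟩)).le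
  have hmc : T.symm m ≤ T.symm c := by
    rcases h2.eq_or_lt with h | h
    · rw [show m = c from Box.ext' rfl h rfl]
    · exact (hT m c rfl (Or.inr ⟨rfl, h⟩)).le
  exact hbm.trans hmc

theorem ct_eq_iff {b c : Box lam} :
    ct b = ct c ↔ b.1.2.2 + c.1.2.1 = c.1.2.2 + b.1.2.1 := by
  simp only [ct, cellContent]; omega

/-- Two entries on the same diagonal of the same component differ by at least three. -/
theorem IsStandard.add_three_le {T : Fin n ≃ Box lam} (hT : IsStandard T) {p q : Fin n}
    (hpq : p < q) (hβ : beta (T p) = beta (T q)) (hc : ct (T p) = ct (T q)) :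
    (p : ℕ) + 3 ≤ q := by
  rw [ct_eq_iff] at hc
  set b := T p with hb
  set c := T q with hcq
  have hp : T.symm b = p := by simp [hb]
  have hq : T.symm c = q := by simp [hcq]
  have hlt : b.1.2.1 < c.1.2.1 := by
    by_contra h
    have := hT.symm_le (b := c) (c := b) hβ.symm (by omega) (by omega)
    rw [hp, hq] at this
    exact absurd this (not_le.2 hpq)
  have hlt' : b.1.2.2 < c.1.2.2 := by omega
  -- `u` is to the right of `b`, `v` is below `b`, and `x` is the next box on the diagonal of `b`.
  -- The entries of `u` and `v` are distinct and lie strictly between those of `b` and `x`, which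
  -- accounts for the gap of three.
  set u := c.upLeft b.1.2.1 (b.1.2.2 + 1) (by omega) (by omega) with hu
  set v := c.upLeft (b.1.2.1 + 1) b.1.2.2 (by omega) (by omega) with hv
  set x := c.upLeft (b.1.2.1 + 1) (b.1.2.2 + 1) (by omega) (by omega) with hx
  have h1 : T.symm b < T.symm u := hT b u hβ (Or.inl ⟨rfl, Nat.lt_succ_self _⟩)
  have h2 : T.symm b < T.symm v := hT b v hβ (Or.inr ⟨rfl, Nat.lt_succ_self _⟩)
  have h3 : T.symm u < T.symm x := hT u x rfl (Or.inr ⟨rfl, Nat.lt_succ_self _⟩)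
  have h4 : T.symm v < T.symm x := hT v x rfl (Or.inl ⟨rfl, Nat.lt_succ_self _⟩)
  have h5 : T.symm x ≤ T.symm c := hT.symm_le rfl hlt hlt'
  have h6 : T.symm u ≠ T.symm v := by
    intro h
    have := congrArg (fun z : Box lam => z.1.2.1) (T.symm.injective h)
    simp [hu, hv, Box.upLeft] at this
  rw [hp] at h1 h2
  rw [hq] at h5
  omega

/-- A standard tableau is determined by the components and contents of its boxes. -/
theorem SYT.ext_of_content {T S : SYT lam} (hβ : ∀ i, beta (T.box i) = beta (S.box i))
    (hc : ∀ i, ct (T.box i) = ct (S.box i)) : T = S := by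
  refine Subtype.ext (Equiv.ext fun i => ?_)
  induction i using WellFoundedLT.induction with
  | ind k ih =>
    have hk := hc k
    rw [ct_eq_iff] at hk
    -- The two boxes of `k` lie on one diagonal of one component, hence are comparable. If they
    -- differed, the smaller box would already be filled in the other tableau by some `y < k`, where
    -- both tableaux agree.
    have key : ∀ T S : SYT lam, (∀ y < k, T.1 y = S.1 y) → beta (T.1 k) = beta (S.1 k) →
        (T.1 k).1.2.1 ≤ (S.1 k).1.2.1 → (T.1 k).1.2.2 ≤ (S.1 k).1.2.2 → T.1 k = S.1 k := by
      intro T S ih hβ h1 h2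
      have := S.2.symm_le hβ h1 h2
      rw [Equiv.symm_apply_apply] at this
      rcases this.eq_or_lt with h | h
      · rw [← h, Equiv.apply_symm_apply, h]
      · have h3 := ih _ h
        rw [Equiv.apply_symm_apply] at h3
        exact absurd (T.1.injective h3) h.ne
    simp only [SYT.box] at hk
    rcases le_total (T.1 k).1.2.1 (S.1 k).1.2.1 with h | h
    · exact key T S ih (hβ k) h (by omega)
    · exact (key S T (fun y hy => (ih y hy).symm) (hβ k).symm h (by omega)).symm

theorem card_box (lam : RPartition r n) : Nat.card (Box lam) = n := by
  have e : Box lam ≃ Σ j : ZMod r, {c : ℕ × ℕ // c ∈ lam.comp j} :=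
    { toFun := fun b => ⟨b.1.1, b.1.2, b.2⟩
      invFun := fun b => ⟨(b.1, b.2.1), b.2.2⟩
      left_inv := fun _ => rfl
      right_inv := fun _ => rfl }
  have e' : ∀ j, {c : ℕ × ℕ // c ∈ lam.comp j} ≃ {c // c ∈ (lam.comp j).cells} := fun j =>
    Equiv.subtypeEquivRight fun c => by simp
  rw [Nat.card_congr (e.trans (Equiv.sigmaCongrRight e')), Nat.card_sigma]
  simp only [Nat.card_eq_fintype_card, Fintype.card_coe]
  exact lam.card_eq

instance : Finite (Box lam) := by
  have e : Box lam ≃ Σ j : ZMod r, {c : ℕ × ℕ // c ∈ lam.comp j} :=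
    { toFun := fun b => ⟨b.1.1, b.1.2, b.2⟩
      invFun := fun b => ⟨(b.1, b.2.1), b.2.2⟩
      left_inv := fun _ => rfl
      right_inv := fun _ => rfl }
  have e' : ∀ j, {c : ℕ × ℕ // c ∈ lam.comp j} ≃ {c // c ∈ (lam.comp j).cells} := fun j =>
    Equiv.subtypeEquivRight fun c => by simp
  exact Finite.of_equiv _ (e.trans (Equiv.sigmaCongrRight e')).symm

instance : Finite (SYT lam) := inferInstanceAs (Finite {T : Fin n ≃ Box lam // IsStandard T})

/-- If exchanging `i` and `i + 1` destroys standardness, these entries are adjacent. -/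
theorem IsStandard.adjacent_of_not {T : Fin n ≃ Box lam} (hT : IsStandard T) {i j : Fin n}
    (hij : (i : ℕ) + 1 = j) (h : ¬ IsStandard ((Equiv.swap i j).trans T)) :
    beta (T i) = beta (T j) ∧ (ct (T j) - ct (T i) = 1 ∨ ct (T j) - ct (T i) = -1) := by
  simp only [IsStandard, not_forall] at h
  obtain ⟨b, c, hbc, hpos, hlt⟩ := h
  simp only [Equiv.symm_trans_apply, Equiv.symm_swap] at hlt
  have h1 := hT b c hbc hpos
  have hne : i ≠ j := by rintro rfl; omega
  -- Exchanging two consecutive values reverses the order of a pair of entries only if the pair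
  -- consists of exactly these two values.
  have hb : T.symm b = i ∧ T.symm c = j := by
    by_cases hbi : T.symm b = i
    · by_cases hcj : T.symm c = j
      · exact ⟨hbi, hcj⟩
      · exfalso
        rw [hbi, Equiv.swap_apply_left, Equiv.swap_apply_of_ne_of_ne (by rw [← hbi]; exact h1.ne')
          hcj] at hlt
        rw [hbi] at h1
        have : T.symm c ≠ j := hcj
        omega
    · exfalso
      by_cases hbj : T.symm b = j
      · rw [hbj, Equiv.swap_apply_right,
          Equiv.swap_apply_of_ne_of_ne (by omega) (by rw [← hbj]; exact h1.ne')] at hlt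
        omega
      · rw [Equiv.swap_apply_of_ne_of_ne hbi hbj] at hlt
        by_cases hci : T.symm c = i
        · rw [hci, Equiv.swap_apply_left] at hlt; omega
        · by_cases hcj : T.symm c = j
          · rw [hcj, Equiv.swap_apply_right] at hlt
            have : T.symm b ≠ i := hbi
            omega
          · rw [Equiv.swap_apply_of_ne_of_ne hci hcj] at hlt
            exact hlt h1
  obtain ⟨rfl, rfl⟩ := hb
  simp only [Equiv.apply_symm_apply]
  refine ⟨hbc, ?_⟩
  -- A box strictly between the two in the same row or column would need an entry strictly between
  -- `i` and `i + 1`.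
  rcases hpos with ⟨hr, hc⟩ | ⟨hc, hr⟩
  · left
    have : c.1.2.2 = b.1.2.2 + 1 := by
      by_contra hne'
      set m := c.upLeft c.1.2.1 (b.1.2.2 + 1) le_rfl (by omega)
      have h2 := hT b m hbc (Or.inl ⟨hr, Nat.lt_succ_self _⟩)
      have h3 := hT m c rfl (Or.inl ⟨rfl, show b.1.2.2 + 1 < c.1.2.2 by omega⟩)
      omega
    simp only [ct, cellContent]; omega
  · right
    have : c.1.2.1 = b.1.2.1 + 1 := by
      by_contra hne'
      set m := c.upLeft (b.1.2.1 + 1) c.1.2.2 (by omega) le_rfl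
      have h2 := hT b m hbc (Or.inr ⟨hc, Nat.lt_succ_self _⟩)
      have h3 := hT m c rfl (Or.inr ⟨rfl, show b.1.2.1 + 1 < c.1.2.1 by omega⟩)
      omega
    simp only [ct, cellContent]; omega

theorem IsStandard.ct_zero {T : Fin n ≃ Box lam} (hT : IsStandard T) {i : Fin n}
    (hi : (i : ℕ) = 0) : ct (T i) = 0 := by
  set m := (T i).upLeft 0 0 (Nat.zero_le _) (Nat.zero_le _) with hm
  have h := hT.symm_le (b := m) (c := T i) rfl (Nat.zero_le _) (Nat.zero_le _)
  rw [Equiv.symm_apply_apply] at h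
  have h2 : T.symm m = i := by omega
  rw [Equiv.symm_apply_eq] at h2
  rw [← h2]
  simp [hm, Box.upLeft, ct, cellContent]

/-! ### Coefficients of Young's orthonormal form -/

/-- The diagonal coefficient of `t_{s_i}` on `v_T`, as a function of the boxes of `i`, `i + 1`. -/
def youngDiag (x y : Box lam) : ℂ :=
  if beta x = beta y then 1 / ((ct y : ℂ) - (ct x : ℂ)) else 0

/-- The coefficient of `v_{s_i.T}` in `t_{s_i}.v_T`. -/
def youngOff (x y : Box lam) : ℂ :=
  if beta x = beta y then
    ((Real.sqrt (1 - (1 / ((ct y : ℝ) - (ct x : ℝ))) ^ 2) : ℝ) : ℂ)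
  else 1

theorem youngDiag_swap (x y : Box lam) : youngDiag y x = -youngDiag x y := by
  unfold youngDiag
  by_cases h : beta x = beta y
  · rw [if_pos h, if_pos h.symm, ← neg_sub (ct y : ℂ), div_neg]
  · rw [if_neg h, if_neg (Ne.symm h), neg_zero]

theorem youngOff_swap (x y : Box lam) : youngOff y x = youngOff x y := by
  unfold youngOff
  by_cases h : beta x = beta y
  · rw [if_pos h, if_pos h.symm, ← neg_sub (ct y : ℝ), div_neg, neg_sq]
  · rw [if_neg h, if_neg (Ne.symm h)]

/-- The real square root has a nonnegative argument because distinct integer contents differ by at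
least one. For equal contents the convention `1 / 0 = 0` makes the identity `1 = 1 - 0`. -/
theorem youngOff_mul_self (x y : Box lam) :
    youngOff x y * youngOff x y = 1 - youngDiag x y * youngDiag x y := by
  unfold youngOff youngDiag
  split_ifs with h
  · have h0 : (0 : ℝ) ≤ 1 - (1 / ((ct y : ℝ) - (ct x : ℝ))) ^ 2 := by
      rcases eq_or_ne (ct y) (ct x) with h1 | h1
      · simp [h1]
      · have h2 : (1 : ℝ) ≤ |(ct y : ℝ) - (ct x : ℝ)| := by
          rw [← Int.cast_sub, ← Int.cast_abs]
          exact_mod_cast Int.one_le_abs (sub_ne_zero.2 h1)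
        rw [sub_nonneg, sq_le_one_iff_abs_le_one, abs_div, abs_one]
        exact div_le_one_of_le₀ h2 (abs_nonneg _)
    rw [← Complex.ofReal_mul, Real.mul_self_sqrt h0]
    push_cast
    ring
  · simp

theorem youngOff_eq_zero {x y : Box lam} (h : beta x = beta y)
    (hc : ct y - ct x = 1 ∨ ct y - ct x = -1) : youngOff x y = 0 := by
  rw [youngOff, if_pos h, ← Int.cast_sub]
  rcases hc with hc | hc <;> simp [hc]

/-- Partial fractions for reciprocals of content differences. This is the identity behind the braid
relation of Young's form. -/
theorem youngDiag_mul {x y z : Box lam} (hxy : beta x = beta y → ct x ≠ ct y)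
    (hyz : beta y = beta z → ct y ≠ ct z) (hxz : beta x = beta z → ct x ≠ ct z) :
    youngDiag x y * youngDiag y z =
      youngDiag x y * youngDiag x z + youngDiag y z * youngDiag x z := by
  unfold youngDiag
  by_cases h1 : beta x = beta y
  · by_cases h2 : beta y = beta z
    · have h3 := h1.trans h2
      have e1 : ((ct y : ℂ) - (ct x : ℂ)) ≠ 0 := by
        rw [sub_ne_zero]; exact_mod_cast (hxy h1).symm
      have e2 : ((ct z : ℂ) - (ct y : ℂ)) ≠ 0 := by
        rw [sub_ne_zero]; exact_mod_cast (hyz h2).symm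
      have e3 : ((ct z : ℂ) - (ct x : ℂ)) ≠ 0 := by
        rw [sub_ne_zero]; exact_mod_cast (hxz h3).symm
      rw [if_pos h1, if_pos h2, if_pos h3]
      field_simp
      ring
    · have h3 : beta x ≠ beta z := fun h => h2 (h1.symm.trans h)
      simp [h1, h2]
  · by_cases h2 : beta y = beta z
    · have h3 : beta x ≠ beta z := fun h => h1 (h.trans h2.symm)
      simp [h1, h3]
    · simp [h1, h2]

end Tableaux


/-! ### Young's orthonormal form as a representation -/

section Young

variable (F : Type) [Field F] {r n : ℕ} [NeZero r] {lam : RPartition r n}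

/-- The space with basis the standard tableaux, inside the space of fillings. -/
def sytIncl : (SYT lam →₀ F) →ₗ[F] ((Fin n ≃ Box lam) →₀ F) :=
  Finsupp.lmapDomain F F Subtype.val

theorem sytIncl_injective : Function.Injective (sytIncl F (lam := lam)) :=
  Finsupp.mapDomain_injective Subtype.val_injective

theorem sytIncl_single (T : SYT lam) (c : F) :
    sytIncl F (Finsupp.single T c) = Finsupp.single T.1 c :=
  Finsupp.mapDomain_single

theorem finsupp_end_ext {f g : Module.End F (SYT lam →₀ F)}
    (h : ∀ T, f (Finsupp.single T 1) = g (Finsupp.single T 1)) : f = g :=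
  Finsupp.lhom_ext' fun T => LinearMap.ext_ring (h T)

variable [Algebra ℂ F]

/-- The action of `(i j)` on fillings by the formulas of Young's orthonormal form. -/
def youngOp (i j : Fin n) : ((Fin n ≃ Box lam) →₀ F) →ₗ[F] ((Fin n ≃ Box lam) →₀ F) :=
  Finsupp.linearCombination F fun f =>
    algebraMap ℂ F (youngDiag (f i) (f j)) • Finsupp.single f (1 : F) +
      algebraMap ℂ F (youngOff (f i) (f j)) • Finsupp.single ((Equiv.swap i j).trans f) (1 : F)

theorem youngOp_single (i j : Fin n) (f : Fin n ≃ Box lam) :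
    youngOp F i j (Finsupp.single f 1) =
      algebraMap ℂ F (youngDiag (f i) (f j)) • Finsupp.single f (1 : F) +
      algebraMap ℂ F (youngOff (f i) (f j)) • Finsupp.single ((Equiv.swap i j).trans f) (1 : F) := by
  rw [youngOp, Finsupp.linearCombination_single, one_smul]

theorem swap_trans_swap_trans (i j : Fin n) (f : Fin n ≃ Box lam) :
    (Equiv.swap i j).trans ((Equiv.swap i j).trans f) = f := by
  ext; simp

theorem algebraMap_youngOff_sq (x y : Box lam) :
    algebraMap ℂ F (youngOff x y) * algebraMap ℂ F (youngOff x y) =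
      1 - algebraMap ℂ F (youngDiag x y) * algebraMap ℂ F (youngDiag x y) := by
  rw [← map_mul, youngOff_mul_self, map_sub, map_one, map_mul]

theorem youngOp_youngOp_single (i j : Fin n) (f : Fin n ≃ Box lam) :
    youngOp F i j (youngOp F i j (Finsupp.single f 1)) = Finsupp.single f 1 := by
  simp only [youngOp_single, map_add, map_smul, swap_trans_swap_trans, Equiv.trans_apply,
    Equiv.swap_apply_left, Equiv.swap_apply_right]
  rw [youngDiag_swap (f i), youngOff_swap (f i)]
  have h := algebraMap_youngOff_sq F (f i) (f j)
  rw [map_neg]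
  linear_combination (norm := module) h • Finsupp.single f (1 : F)

theorem youngOp_comm_single {i j k l : Fin n} (hik : i ≠ k) (hil : i ≠ l) (hjk : j ≠ k)
    (hjl : j ≠ l) (f : Fin n ≃ Box lam) :
    youngOp F i j (youngOp F k l (Finsupp.single f 1)) =
      youngOp F k l (youngOp F i j (Finsupp.single f 1)) := by
  have h : (Equiv.swap i j).trans ((Equiv.swap k l).trans f) =
      (Equiv.swap k l).trans ((Equiv.swap i j).trans f) := by
    ext x : 1
    simp only [Equiv.trans_apply, Equiv.swap_apply_def]
    grind
  simp only [youngOp_single, map_add, map_smul, Equiv.trans_apply, h,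
    Equiv.swap_apply_of_ne_of_ne hik hil, Equiv.swap_apply_of_ne_of_ne hjk hjl,
    Equiv.swap_apply_of_ne_of_ne hik.symm hjk.symm, Equiv.swap_apply_of_ne_of_ne hil.symm hjl.symm]
  module

theorem youngOp_braid_single {i j k : Fin n} (hij : i ≠ j) (hik : i ≠ k) (hjk : j ≠ k)
    (f : Fin n ≃ Box lam) (h1 : beta (f i) = beta (f j) → ct (f i) ≠ ct (f j))
    (h2 : beta (f j) = beta (f k) → ct (f j) ≠ ct (f k))
    (h3 : beta (f i) = beta (f k) → ct (f i) ≠ ct (f k)) :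
    youngOp F i j (youngOp F j k (youngOp F i j (Finsupp.single f 1))) =
      youngOp F j k (youngOp F i j (youngOp F j k (Finsupp.single f 1))) := by
  have h : (Equiv.swap i j).trans ((Equiv.swap j k).trans ((Equiv.swap i j).trans f)) =
      (Equiv.swap j k).trans ((Equiv.swap i j).trans ((Equiv.swap j k).trans f)) := by
    ext x : 1
    simp only [Equiv.trans_apply, Equiv.swap_apply_def]
    grind
  simp only [youngOp_single, map_add, map_smul, Equiv.trans_apply, h, swap_trans_swap_trans,
    Equiv.swap_apply_left, Equiv.swap_apply_right, Equiv.swap_apply_of_ne_of_ne hij hik,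
    Equiv.swap_apply_of_ne_of_ne hik.symm hjk.symm]
  have hm := congrArg (algebraMap ℂ F) (youngDiag_mul h1 h2 h3)
  simp only [map_add, map_mul] at hm
  have hs1 := algebraMap_youngOff_sq F (f i) (f j)
  have hs2 := algebraMap_youngOff_sq F (f j) (f k)
  rw [youngDiag_swap (f i) (f j), youngOff_swap (f i) (f j), youngDiag_swap (f j) (f k),
    youngOff_swap (f j) (f k)]
  simp only [map_neg]
  generalize algebraMap ℂ F (youngDiag (f i) (f j)) = a at *
  generalize algebraMap ℂ F (youngDiag (f j) (f k)) = b at *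
  generalize algebraMap ℂ F (youngDiag (f i) (f k)) = c at *
  generalize algebraMap ℂ F (youngOff (f i) (f j)) = p at *
  generalize algebraMap ℂ F (youngOff (f j) (f k)) = q at *
  generalize algebraMap ℂ F (youngOff (f i) (f k)) = s at *
  -- Only the coefficients at `f` and at the two fillings obtained by one swap need relations,
  -- namely the quadratic relation for `youngOff` and the partial fraction identity. The remaining
  -- coefficients coincide identically.
  linear_combination (norm := module)
    (c * hs1 - c * hs2 + (a - b) * hm) • Finsupp.single f (1 : F) +
    (p * hm) • Finsupp.single ((Equiv.swap i j).trans f) (1 : F) -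
    (q * hm) • Finsupp.single ((Equiv.swap j k).trans f) (1 : F)

open Classical in
/-- The term `v_{s_i.T}`, read as zero if `s_i.T` is not standard. -/
def swapTerm {X : Type} [Zero X] (v : SYT lam → X) (T : SYT lam) (i j : Fin n) : X :=
  if h : IsStandard ((Equiv.swap i j).trans T.1) then v ⟨_, h⟩ else 0

/-- The action of `(i, i + 1)` on the space with basis the standard tableaux. -/
def youngAdj (i j : Fin n) : (SYT lam →₀ F) →ₗ[F] (SYT lam →₀ F) :=
  Finsupp.linearCombination F fun T =>
    algebraMap ℂ F (youngDiag (T.box i) (T.box j)) • Finsupp.single T (1 : F) +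
      algebraMap ℂ F (youngOff (T.box i) (T.box j)) • swapTerm (fun S => Finsupp.single S 1) T i j

theorem youngAdj_single (i j : Fin n) (T : SYT lam) :
    youngAdj F i j (Finsupp.single T 1) =
    algebraMap ℂ F (youngDiag (T.box i) (T.box j)) • Finsupp.single T (1 : F) +
      algebraMap ℂ F (youngOff (T.box i) (T.box j)) •
        swapTerm (fun S => Finsupp.single S 1) T i j := by
  rw [youngAdj, Finsupp.linearCombination_single, one_smul]

/-- On arbitrary fillings the formulas need no case distinction, so the Coxeter relations are
checked there. The standard tableaux span a stable subspace, since the off-diagonal coefficient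
vanishes precisely when needed: a nonstandard swap means adjacent boxes, whose contents differ by
one. -/
theorem sytIncl_youngAdj {i j : Fin n} (hij : (i : ℕ) + 1 = j) (v : SYT lam →₀ F) :
    sytIncl F (youngAdj F i j v) = youngOp F i j (sytIncl F v) := by
  suffices h : sytIncl F ∘ₗ youngAdj F i j = youngOp F i j ∘ₗ sytIncl F (lam := lam) from
    LinearMap.congr_fun h v
  refine Finsupp.lhom_ext' fun T => LinearMap.ext_ring ?_
  simp only [LinearMap.comp_apply, Finsupp.lsingle_apply]
  rw [youngAdj_single, sytIncl_single, youngOp_single, map_add, map_smul, map_smul,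
    sytIncl_single]
  congr 1
  by_cases h : IsStandard ((Equiv.swap i j).trans T.1)
  · rw [swapTerm, dif_pos h]
    exact congrArg (_ • ·) (sytIncl_single F _ 1)
  · obtain ⟨hβ, hc⟩ := T.2.adjacent_of_not hij h
    rw [SYT.box, SYT.box, youngOff_eq_zero hβ hc, map_zero, zero_smul, zero_smul]

theorem youngAdj_mul_self {i j : Fin n} (hij : (i : ℕ) + 1 = j) :
    (youngAdj F i j * youngAdj F i j : Module.End F (SYT lam →₀ F)) = 1 := by
  refine finsupp_end_ext F fun T => sytIncl_injective F ?_
  rw [Module.End.mul_apply, sytIncl_youngAdj F hij, sytIncl_youngAdj F hij, sytIncl_single,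
    youngOp_youngOp_single, Module.End.one_apply, sytIncl_single]

/-- Guarantees nonzero denominators for entries at distance one or two. It also excludes
coincidences of adjacent weights when two adjacent parts of `μ` are equal. -/
theorem SYT.ct_ne (T : SYT lam) {p q : Fin n} (hpq : p < q) (hq : (q : ℕ) < p + 3)
    (h : beta (T.1 p) = beta (T.1 q)) : ct (T.1 p) ≠ ct (T.1 q) := fun hc => by
  have := T.2.add_three_le hpq h hc
  omega

theorem exists_youngPerm : ∃ f : Equiv.Perm (Fin n) →* Module.End F (SYT lam →₀ F),
    ∀ i j : Fin n, (i : ℕ) + 1 = j → f (Equiv.swap i j) = youngAdj F i j := by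
  let g : ℕ → Module.End F (SYT lam →₀ F) := fun i =>
    if h : i + 1 < n then youngAdj F ⟨i, by omega⟩ ⟨i + 1, h⟩ else 1
  have hg : ∀ i (h : i + 1 < n), g i = youngAdj F ⟨i, by omega⟩ ⟨i + 1, h⟩ := fun i h => dif_pos h
  suffices h : ∃ f : Equiv.Perm (Fin n) →* Module.End F (SYT lam →₀ F),
      ∀ i, i + 1 < n → f (adjSwap n i) = g i by
    obtain ⟨f, hf⟩ := h
    refine ⟨f, fun i j hij => ?_⟩
    have := hf i (by omega)
    rw [adjSwap_of_lt (by omega), hg i (by omega)] at this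
    have hj : (⟨(i : ℕ) + 1, by omega⟩ : Fin n) = j := Fin.ext hij
    rw [hj] at this
    exact this
  apply exists_permHom
  · intro i hi
    rw [hg i hi, youngAdj_mul_self F rfl]
  · intro i hi
    rw [hg i (by omega), hg (i + 1) (by omega)]
    refine finsupp_end_ext F fun T => sytIncl_injective F ?_
    simp only [Module.End.mul_apply]
    rw [sytIncl_youngAdj F rfl, sytIncl_youngAdj F rfl, sytIncl_youngAdj F rfl,
      sytIncl_youngAdj F rfl, sytIncl_youngAdj F rfl, sytIncl_youngAdj F rfl, sytIncl_single]
    exact youngOp_braid_single F (by simp) (by simp; omega) (by simp) _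
      (T.ct_ne (by simp) (by simp)) (T.ct_ne (by simp) (by simp))
      (T.ct_ne (by simp [Fin.lt_def]) (by simp))
  · intro i j hij hj
    rw [hg i (by omega), hg j (by omega)]
    refine finsupp_end_ext F fun T => sytIncl_injective F ?_
    simp only [Module.End.mul_apply]
    rw [sytIncl_youngAdj F rfl, sytIncl_youngAdj F rfl, sytIncl_youngAdj F rfl,
      sytIncl_youngAdj F rfl, sytIncl_single]
    exact youngOp_comm_single F (by simp; omega) (by simp; omega) (by simp; omega)
      (by simp; omega) _

/-- The action of diagonal matrices on the space with basis the standard tableaux. -/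
def youngTorus (a : Fin n → Multiplicative (ZMod r)) : Module.End F (SYT lam →₀ F) :=
  Finsupp.linearCombination F fun T =>
    (∏ i, zetaPow F ((a i).toAdd * beta (T.box i))) • Finsupp.single T (1 : F)

theorem youngTorus_single (a : Fin n → Multiplicative (ZMod r)) (T : SYT lam) :
    youngTorus F a (Finsupp.single T 1) =
      (∏ i, zetaPow F ((a i).toAdd * beta (T.box i))) • Finsupp.single T (1 : F) := by
  rw [youngTorus, Finsupp.linearCombination_single, one_smul]

theorem youngTorus_mul (a b : Fin n → Multiplicative (ZMod r)) :
    (youngTorus F (a * b) : Module.End F (SYT lam →₀ F)) = youngTorus F a * youngTorus F b := by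
  refine finsupp_end_ext F fun T => ?_
  rw [Module.End.mul_apply, youngTorus_single, youngTorus_single, map_smul, youngTorus_single,
    smul_smul, ← Finset.prod_mul_distrib]
  congr 1
  refine Finset.prod_congr rfl fun i _ => ?_
  rw [← zetaPow_add]
  congr 1
  simp; ring

theorem youngTorus_one : (youngTorus F 1 : Module.End F (SYT lam →₀ F)) = 1 :=
  finsupp_end_ext F fun T => by rw [youngTorus_single]; simp

theorem youngAdj_mul_youngTorus {i j : Fin n} (hij : (i : ℕ) + 1 = j)
    (a : Fin n → Multiplicative (ZMod r)) :
    (youngAdj F i j * youngTorus F a : Module.End F (SYT lam →₀ F)) =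
      youngTorus F ((mulAutArrow (Equiv.swap i j) : MulAut (Fin n → Multiplicative (ZMod r))) a) * youngAdj F i j := by
  refine finsupp_end_ext F fun T => ?_
  have hprod : ∏ k, zetaPow F ((a k).toAdd * beta (T.box k)) =
      ∏ k, zetaPow F (((mulAutArrow (Equiv.swap i j) : MulAut (Fin n → Multiplicative (ZMod r))) a k).toAdd *
        beta (T.box (Equiv.swap i j k))) := by
    rw [← Equiv.prod_comp (Equiv.swap i j)]
    refine Finset.prod_congr rfl fun k _ => ?_
    rw [mulAutArrow_apply_apply, Equiv.swap_inv]
  simp only [Module.End.mul_apply]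
  rw [youngTorus_single, map_smul, youngAdj_single, map_add, map_smul, map_smul,
    youngTorus_single, smul_add, smul_comm _ (algebraMap ℂ F (youngDiag _ _)),
    smul_comm _ (algebraMap ℂ F (youngOff _ _))]
  congr 1
  · by_cases h : beta (T.box i) = beta (T.box j)
    · rw [hprod]
      congr 2
      refine Finset.prod_congr rfl fun k _ => ?_
      congr 2
      rcases eq_or_ne k i with rfl | h1
      · rw [Equiv.swap_apply_left, h]
      · rcases eq_or_ne k j with rfl | h2
        · rw [Equiv.swap_apply_right, h]
        · rw [Equiv.swap_apply_of_ne_of_ne h1 h2]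
    · rw [youngDiag, if_neg h, map_zero, zero_smul, zero_smul]
  · congr 1
    unfold swapTerm
    split_ifs with h
    · refine Eq.trans ?_ (youngTorus_single F _ _).symm
      rw [hprod]
      rfl
    · rw [smul_zero, map_zero]

/-- The representation of `G(r,1,n)` given by Young's orthonormal form. -/
theorem exists_youngRep : ∃ ρ : W r n →* Module.End F (SYT lam →₀ F),
    (∀ i j : Fin n, (i : ℕ) + 1 = j → ρ (permElt r (Equiv.swap i j)) = youngAdj F i j) ∧
    ∀ i l T, ρ (diagRefl i l) (Finsupp.single T 1) =
      zetaPow F (l * beta (T.box i)) • Finsupp.single T 1 := by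
  obtain ⟨f, hf⟩ := exists_youngPerm F (lam := lam)
  -- Compatibility of the torus and permutation actions is needed only for adjacent transpositions
  -- and then propagates to all permutations; it is the relation that defines a semidirect product.
  have hcomm : ∀ (s : Equiv.Perm (Fin n)) a, f s * youngTorus F a =
      youngTorus F ((mulAutArrow s : MulAut (Fin n → Multiplicative (ZMod r))) a) * f s := by
    intro s
    have hs' : s ∈ Submonoid.closure (adjSwap n '' Set.Iio (n - 1)) := by
      rw [closure_adjSwap]; trivial
    induction hs' using Submonoid.closure_induction_left with
    | one => intro a; simp
    | mul_left u hu v _ ih =>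
      intro a
      obtain ⟨i, hi, rfl⟩ := hu
      simp only [Set.mem_Iio] at hi
      rw [map_mul, mul_assoc, ih, ← mul_assoc, adjSwap_of_lt (by omega), hf _ _ rfl,
        youngAdj_mul_youngTorus F rfl, mul_assoc, map_mul]
      rfl
  refine ⟨⟨⟨fun w => youngTorus F w.left * f w.right, ?_⟩, fun w v => ?_⟩, ?_, ?_⟩
  · simp [youngTorus_one]
  · simp only [SemidirectProduct.mul_left, SemidirectProduct.mul_right, map_mul, youngTorus_mul]
    rw [mul_assoc, mul_assoc]
    congr 1
    rw [← mul_assoc, ← mul_assoc, hcomm]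
  · intro i j hij
    change youngTorus F 1 * f (Equiv.swap i j) = _
    rw [youngTorus_one, one_mul, hf i j hij]
  · intro i l T
    change (youngTorus F (diagRefl i l).left * f 1 : Module.End F _) _ = _
    rw [map_one, mul_one, youngTorus_single]
    congr 1
    rw [Finset.prod_eq_single i]
    · simp
    · intro k _ hk; simp [hk]
    · simp

end Young


/-! ### The basis of `S^λ` -/

theorem natCast_ne_zero_of_neZero (F : Type) [Field F] [Algebra ℂ F] (r : ℕ) [NeZero r] :
    (r : F) ≠ 0 := by
  rw [← map_natCast (algebraMap ℂ F) r, map_ne_zero]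
  exact Nat.cast_ne_zero.2 (NeZero.ne r)

section SpechtBasis

variable (F : Type) [Field F] [Algebra ℂ F] {r n : ℕ} [NeZero r] (lam : RPartition r n)

/-- The action of `G(r,1,n)` on `S^λ`. -/
def spechtRep : W r n →* Module.End F (Specht F lam) :=
  ((Algebra.lsmul F F (Specht F lam) : MonoidAlgebra F (W r n) →ₐ[F] _) :
    MonoidAlgebra F (W r n) →* Module.End F (Specht F lam)).comp (MonoidAlgebra.of F (W r n))

variable {lam}

theorem mkQ_eq_of_spechtRel {u v : FreeSYT F lam} (h : SpechtRel F lam u v) :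
    (spechtSub F lam).mkQ u = (spechtSub F lam).mkQ v :=
  (Submodule.Quotient.eq _).2 (Submodule.subset_span ⟨u, v, h, rfl⟩)

theorem spechtRep_diagRefl_one_vec (i : Fin n) (T : SYT lam) :
    spechtRep F lam (diagRefl i 1) (vec F T) = zetaPow F (beta (T.box i)) • vec F T := by
  rw [← zetaElt_eq]
  exact mkQ_eq_of_spechtRel F (SpechtRel.zeta T i)

theorem spechtRep_diagRefl_vec (i : Fin n) (l : ZMod r) (T : SYT lam) :
    spechtRep F lam (diagRefl i l) (vec F T) = zetaPow F (l * beta (T.box i)) • vec F T := by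
  suffices h : ∀ k : ℕ, spechtRep F lam (diagRefl i 1 ^ k) (vec F T) =
      zetaPow F (beta (T.box i)) ^ k • vec F T by
    have := h l.val
    rw [← zetaElt_eq, zetaElt_pow, ← zetaPow_nsmul] at this
    simpa using this
  intro k
  induction k with
  | zero => simp
  | succ k ih =>
    rw [pow_succ', map_mul, Module.End.mul_apply, ih, map_smul, spechtRep_diagRefl_one_vec,
      smul_smul, pow_succ]

theorem jm_gt_smul_vec (i : Fin n) (T : SYT lam) :
    jm (gt (r := r) F) i • vec F T = ((r : F) * (ct (T.box i) : F)) • vec F T :=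
  mkQ_eq_of_spechtRel F (SpechtRel.phi T i)

theorem jm_spechtRep (i : Fin n) (v : Specht F lam) :
    jm (spechtRep F lam) i v = jm (gt (r := r) F) i • v := by
  simp only [jm, LinearMap.sum_apply, Finset.sum_smul]
  rfl

theorem jm_spechtRep_vec (i : Fin n) (T : SYT lam) :
    jm (spechtRep F lam) i (vec F T) = ((r : F) * (ct (T.box i) : F)) • vec F T := by
  rw [jm_spechtRep, jm_gt_smul_vec]

theorem piElt_of_diagRefl_eigen {V : Type} [AddCommGroup V] [Module F V]
    (ρ : W r n →* Module.End F V) {i j : Fin n} {b c : ZMod r} {v : V}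
    (hi : ∀ l, ρ (diagRefl i l) v = zetaPow F (l * b) • v)
    (hj : ∀ l, ρ (diagRefl j l) v = zetaPow F (l * c) • v) :
    piElt ρ i j v = (if b = c then (r : F) else 0) • v := by
  have h : ∀ l : ZMod r, ρ (diagRefl i l * diagRefl j (-l)) v = zetaPow F (l * (b - c)) • v := by
    intro l
    rw [map_mul, Module.End.mul_apply, hj, map_smul, hi, smul_smul, ← zetaPow_add]
    congr 2; ring
  rw [piElt_eq, LinearMap.sum_apply, Finset.sum_congr rfl fun l _ => h l, ← Finset.sum_smul,
    sum_zetaPow_mul]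
  simp only [sub_eq_zero]

theorem piElt_spechtRep_vec (i j : Fin n) (T : SYT lam) :
    piElt (spechtRep F lam) i j (vec F T) =
      (if beta (T.box i) = beta (T.box j) then (r : F) else 0) • vec F T :=
  piElt_of_diagRefl_eigen F _ (fun l => spechtRep_diagRefl_vec F i l T)
    fun l => spechtRep_diagRefl_vec F j l T

theorem piElt_spechtRep (i j : Fin n) (v : Specht F lam) :
    piElt (spechtRep F lam) i j v = piElt (gt (r := r) F) i j • v := by
  simp only [piElt, LinearMap.sum_apply, Finset.sum_smul]
  refine Finset.sum_congr rfl fun l _ => ?_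
  rw [← map_pow]
  change gt F ((zetaElt r i * (zetaElt r j)⁻¹) ^ l) • v = _
  rw [gt, map_pow]
  rfl

theorem div_mul_natCast (x y : F) :
    1 / ((r : F) * x - (r : F) * y) * (r : F) = -(1 / (y - x)) := by
  have := natCast_ne_zero_of_neZero F r
  rw [← mul_sub, ← neg_sub y x, one_div, mul_inv, inv_neg, one_div, mul_comm, ← mul_assoc,
    mul_inv_cancel₀ this, one_mul]

theorem mkQ_tauRhs (T : SYT lam) (i j : Fin n) :
    (spechtSub F lam).mkQ (tauRhs F T i j) =
      algebraMap ℂ F (youngOff (T.box i) (T.box j)) • swapTerm (vec F) T i j := by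
  unfold tauRhs swapTerm youngOff
  by_cases h : IsStandard ((Equiv.swap i j).trans T.1)
  · rw [dif_pos h, dif_pos h]
    by_cases hβ : beta (T.box i) = beta (T.box j)
    · rw [if_neg (by simpa using hβ), if_pos hβ]; rfl
    · rw [if_pos hβ, if_neg hβ, map_one, one_smul]; rfl
  · rw [dif_neg h, dif_neg h, smul_zero, map_zero]; rfl

theorem spechtRep_swap_vec {i j : Fin n} (hij : (i : ℕ) + 1 = j) (T : SYT lam) :
    spechtRep F lam (permElt r (Equiv.swap i j)) (vec F T) =
      algebraMap ℂ F (youngDiag (T.box i) (T.box j)) • vec F T +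
      algebraMap ℂ F (youngOff (T.box i) (T.box j)) • swapTerm (vec F) T i j := by
  have h : spechtRep F lam (permElt r (Equiv.swap i j)) (vec F T) +
      (1 / ((r : F) * (ct (T.box i) : F) - (r : F) * (ct (T.box j) : F))) •
        (piElt (gt (r := r) F) i j • vec F T) = _ :=
    (mkQ_eq_of_spechtRel F (SpechtRel.tau T i j hij)).trans (mkQ_tauRhs F T i j)
  rw [← piElt_spechtRep] at h
  rw [← h, piElt_spechtRep_vec, smul_smul, mul_ite, mul_zero, div_mul_natCast, youngDiag]
  split_ifs with hβ
  · simp only [map_div₀, map_sub, map_intCast, map_one]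
    module
  · simp

/-- The structure constants of `S^λ` are complex numbers that do not depend on the field. -/
theorem exists_spechtCoeff (w : W r n) (T : SYT lam) : ∃ c : SYT lam →₀ ℂ,
    ∀ (F : Type) [Field F] [Algebra ℂ F], spechtRep F lam w (vec F T) =
      c.sum fun S a => algebraMap ℂ F a • vec F S := by
  have hz : ∀ (F : Type) [Field F] [Algebra ℂ F] (S : SYT lam),
      algebraMap ℂ F 0 • vec F S = 0 := fun F _ _ S => by simp
  have ha : ∀ (F : Type) [Field F] [Algebra ℂ F] (S : SYT lam) (a b : ℂ),
      algebraMap ℂ F (a + b) • vec F S = algebraMap ℂ F a • vec F S + algebraMap ℂ F b • vec F S :=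
    fun F _ _ S a b => by rw [map_add, add_smul]
  have hcomp : ∀ g w : W r n,
      (∀ T : SYT lam, ∃ c : SYT lam →₀ ℂ, ∀ (F : Type) [Field F] [Algebra ℂ F],
        spechtRep F lam g (vec F T) = c.sum fun S a => algebraMap ℂ F a • vec F S) →
      (∀ T : SYT lam, ∃ c : SYT lam →₀ ℂ, ∀ (F : Type) [Field F] [Algebra ℂ F],
        spechtRep F lam w (vec F T) = c.sum fun S a => algebraMap ℂ F a • vec F S) →
      ∀ T : SYT lam, ∃ c : SYT lam →₀ ℂ, ∀ (F : Type) [Field F] [Algebra ℂ F],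
        spechtRep F lam (g * w) (vec F T) = c.sum fun S a => algebraMap ℂ F a • vec F S := by
    intro g w hg hw T
    choose cg hcg using hg
    obtain ⟨c, hc⟩ := hw T
    refine ⟨c.sum fun S a => a • cg S, fun F _ _ => ?_⟩
    rw [map_mul, Module.End.mul_apply, hc, map_finsuppSum,
      Finsupp.sum_sum_index (fun S => hz F S) (fun S a b => ha F S a b)]
    refine Finsupp.sum_congr fun S _ => ?_
    rw [map_smul, hcg, Finsupp.smul_sum, Finsupp.sum_smul_index (fun S => hz F S)]
    simp only [map_mul, mul_smul]
  revert T
  induction w using W_induction with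
  | h1 =>
    refine fun T => ⟨Finsupp.single T 1, fun F _ _ => ?_⟩
    rw [Finsupp.sum_single_index (hz F T)]; simp
  | hz i w ih =>
    refine hcomp _ _ (fun T => ⟨Finsupp.single T (zetaPow ℂ (beta (T.box i))), fun F _ _ => ?_⟩) ih
    rw [zetaElt_eq, spechtRep_diagRefl_one_vec, Finsupp.sum_single_index (hz F T)]
    rfl
  | hs i hi w ih =>
    rw [adjSwap_of_lt hi]
    set i' : Fin n := ⟨i, by omega⟩
    set j' : Fin n := ⟨i + 1, hi⟩
    refine hcomp _ _ (fun T => ⟨Finsupp.single T (youngDiag (T.box i') (T.box j')) +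
      youngOff (T.box i') (T.box j') • swapTerm (fun S => Finsupp.single S 1) T i' j',
      fun F _ _ => ?_⟩) ih
    rw [spechtRep_swap_vec F rfl, Finsupp.sum_add_index' (fun S => hz F S) (fun S a b => ha F S a b),
      Finsupp.sum_single_index (hz F T)]
    congr 1
    unfold swapTerm
    have hS : ∀ (S : SYT lam) (a : ℂ), ((a • Finsupp.single S (1 : ℂ)).sum fun S a =>
        algebraMap ℂ F a • vec F S) = algebraMap ℂ F a • vec F S := fun S a => by
      rw [Finsupp.smul_single, Finsupp.sum_single_index (hz F _), smul_eq_mul, mul_one]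
    split_ifs
    · exact (hS _ _).symm
    · rw [smul_zero, smul_zero, Finsupp.sum_zero_index]

theorem span_vec : Submodule.span F (Set.range (vec F (lam := lam))) = ⊤ := by
  set N := Submodule.span F (Set.range (vec F (lam := lam)))
  have hN : ∀ (w : W r n) (v : Specht F lam), v ∈ N → spechtRep F lam w v ∈ N := by
    intro w v hv
    induction hv using Submodule.span_induction with
    | mem v hv =>
      obtain ⟨T, rfl⟩ := hv
      obtain ⟨c, hc⟩ := exists_spechtCoeff w T
      rw [hc]
      exact Submodule.sum_mem _ fun S _ =>
        Submodule.smul_mem _ _ (Submodule.subset_span ⟨S, rfl⟩)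
    | zero => rw [map_zero]; exact zero_mem _
    | add u v _ _ hu hv => rw [map_add]; exact add_mem hu hv
    | smul c v _ hv => rw [map_smul]; exact Submodule.smul_mem _ _ hv
  rw [eq_top_iff]
  rintro v -
  obtain ⟨m, rfl⟩ := (spechtSub F lam).mkQ_surjective v
  induction m using Finsupp.induction_linear with
  | zero => rw [map_zero]; exact zero_mem _
  | add f g hf hg => rw [map_add]; exact add_mem hf hg
  | single T a =>
    have h : (spechtSub F lam).mkQ (Finsupp.single T a) = a • vec F T := by
      change _ = (spechtSub F lam).mkQ (a • freeV F T)
      rw [freeV, Finsupp.smul_single, smul_eq_mul, mul_one]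
    rw [h]
    clear h
    induction a using MonoidAlgebra.induction_on with
    | of w => exact hN w _ (Submodule.subset_span ⟨T, rfl⟩)
    | add a b ha hb => rw [add_smul]; exact add_mem ha hb
    | smul c a ha => rw [smul_assoc]; exact Submodule.smul_mem _ _ ha

/-- The Jucys-Murphy elements act diagonally in Young's orthonormal form. -/
theorem jm_youngRep {V : Type} [AddCommGroup V] [Module F V] {ρ : W r n →* Module.End F V}
    {e : SYT lam → V}
    (hs : ∀ i j : Fin n, (i : ℕ) + 1 = j → ∀ T, ρ (permElt r (Equiv.swap i j)) (e T) =
      algebraMap ℂ F (youngDiag (T.box i) (T.box j)) • e T +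
      algebraMap ℂ F (youngOff (T.box i) (T.box j)) • swapTerm e T i j)
    (hz : ∀ i l T, ρ (diagRefl i l) (e T) = zetaPow F (l * beta (T.box i)) • e T)
    (i : Fin n) (T : SYT lam) :
    jm ρ i (e T) = ((r : F) * (ct (T.box i) : F)) • e T := by
  obtain ⟨k, hk⟩ : ∃ k : ℕ, (i : ℕ) = k := ⟨_, rfl⟩
  induction k generalizing i T with
  | zero =>
    have : ct (T.box i) = 0 := T.2.ct_zero hk
    rw [this, jm_eq, Finset.filter_false_of_mem (fun j _ => by simp [Fin.lt_def, hk])]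
    simp
  | succ k ih =>
    set j : Fin n := ⟨k, by omega⟩ with hj
    have hji : (j : ℕ) + 1 = i := by rw [hj, hk]
    have hne : j ≠ i := by rintro h; rw [h] at hji; omega
    -- In the tableau `s_j.T` the entry `j` occupies the box of `i` in `T`, so the induction
    -- hypothesis gives that term the content of `i`.
    have hswap : (algebraMap ℂ F (youngOff (T.box j) (T.box i))) •
        jm ρ j (swapTerm e T j i) =
        ((r : F) * (ct (T.box i) : F)) • (algebraMap ℂ F (youngOff (T.box j) (T.box i))) •
          swapTerm e T j i := by
      rw [smul_comm]
      congr 1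
      unfold swapTerm
      split_ifs with h
      · rw [ih j ⟨_, h⟩ rfl]
        have h1 : (SYT.box ⟨_, h⟩ j : Box lam) = T.box i := by simp [SYT.box]
        rw [h1]
      · simp
    set e' := e T with he'
    set u := swapTerm e T j i
    set A := algebraMap ℂ F (youngDiag (T.box j) (T.box i)) with hA
    set B := algebraMap ℂ F (youngOff (T.box j) (T.box i))
    have hse : ρ (permElt r (Equiv.swap j i)) e' = A • e' + B • u := by
      rw [he', hs j i hji]
    have hss : ρ (permElt r (Equiv.swap j i)) (ρ (permElt r (Equiv.swap j i)) e') = e' := by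
      rw [← Module.End.mul_apply, permElt_swap_mul_self]; rfl
    have hBu : B • u = ρ (permElt r (Equiv.swap j i)) e' - A • e' := by rw [hse]; abel
    -- The recursion reads `φ_i = s φ_j s + s π`, where `s` exchanges `j` and `i`. In the same
    -- component the diagonal coefficient `A` times the content difference is one, so the extra
    -- contribution of `φ_j` cancels `s π`; otherwise `A = 0` and `π` vanishes on the vector.
    rw [jm_succ ρ hji, ← permElt_mul_piElt, LinearMap.add_apply, Module.End.mul_apply,
      Module.End.mul_apply, Module.End.mul_apply,
      piElt_of_diagRefl_eigen F ρ (fun l => hz j l T) (fun l => hz i l T)]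
    have hφ : jm ρ j (ρ (permElt r (Equiv.swap j i)) e') =
        (A * ((r : F) * (ct (T.box j) : F))) • e' +
          ((r : F) * (ct (T.box i) : F)) • (ρ (permElt r (Equiv.swap j i)) e' - A • e') := by
      rw [hse, map_add, map_smul, map_smul, hswap, ih j T rfl]; module
    rw [hφ, map_add, map_smul, map_smul, map_sub, hss, map_smul, map_smul]
    set w := ρ (permElt r (Equiv.swap j i)) e'
    by_cases hβ : beta (T.box j) = beta (T.box i)
    · rw [if_pos hβ]
      have hne' : ((ct (T.box i) : F) - (ct (T.box j) : F)) ≠ 0 := by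
        have := T.ct_ne (p := j) (q := i) (by rw [Fin.lt_def]; omega) (by omega) hβ
        rw [sub_ne_zero, ← map_intCast (algebraMap ℂ F), ← map_intCast (algebraMap ℂ F)]
        exact fun h => this (by exact_mod_cast ((algebraMap ℂ F).injective h).symm)
      have hA' : A * ((ct (T.box i) : F) - (ct (T.box j) : F)) = 1 := by
        rw [hA, youngDiag, if_pos hβ]
        simp only [map_div₀, map_sub, map_intCast, map_one]
        field_simp
      linear_combination (norm := module) (-(r : F) * hA') • w
    · rw [if_neg hβ]
      have hA' : A = 0 := by rw [hA, youngDiag, if_neg hβ, map_zero]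
      rw [hA']
      module

/-- Young's orthonormal form satisfies all defining relations of `S^λ`, so there is a map from the
presented module to the space with basis the standard tableaux sending `v_T` to the basis vector of
`T`. The relations therefore cause no collapse. -/
theorem linearIndependent_vec : LinearIndependent F (vec F (lam := lam)) := by
  obtain ⟨ρ, hs, hz⟩ := exists_youngRep F (lam := lam)
  let _ : Module (MonoidAlgebra F (W r n)) (SYT lam →₀ F) :=
    Module.compHom _ (MonoidAlgebra.lift F _ (W r n) ρ).toRingHom
  have hact : ∀ (a : MonoidAlgebra F (W r n)) (v : SYT lam →₀ F),
      a • v = MonoidAlgebra.lift F _ (W r n) ρ a v := fun _ _ => rfl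
  have hgt : ∀ (w : W r n) (v : SYT lam →₀ F), gt F w • v = ρ w v := fun w v => by
    rw [hact, gt, MonoidAlgebra.of_apply, MonoidAlgebra.lift_single, one_smul]
  have hF : ∀ (c : F) (v : SYT lam →₀ F),
      (algebraMap F (MonoidAlgebra F (W r n)) c) • v = c • v := fun c v => by
    rw [hact, AlgHom.commutes]; rfl
  have hjm : ∀ i (v : SYT lam →₀ F), jm (gt (r := r) F) i • v = jm ρ i v := fun i v => by
    simp only [jm, Finset.sum_smul, LinearMap.sum_apply, hgt]
  have hpi : ∀ i j (v : SYT lam →₀ F), piElt (gt (r := r) F) i j • v = piElt ρ i j v :=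
    fun i j v => by
      simp only [piElt, Finset.sum_smul, LinearMap.sum_apply]
      refine Finset.sum_congr rfl fun l _ => ?_
      rw [← map_pow, ← hgt, gt, gt, map_pow]
  let Ψ : FreeSYT F lam →ₗ[MonoidAlgebra F (W r n)] (SYT lam →₀ F) :=
    Finsupp.linearCombination _ fun T => Finsupp.single T 1
  have hΨ : ∀ T, Ψ (freeV F T) = Finsupp.single T 1 := fun T => by
    rw [freeV, Finsupp.linearCombination_single, one_smul]
  have hΨF : ∀ (c : F) m, Ψ (c • m) = c • Ψ m := fun c m => by
    rw [← algebraMap_smul (MonoidAlgebra F (W r n)) c m, map_smul, hF]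
  have hker : spechtSub F lam ≤ LinearMap.ker Ψ := by
    refine Submodule.span_le.2 ?_
    rintro _ ⟨u, v, huv, rfl⟩
    rw [SetLike.mem_coe, LinearMap.mem_ker, map_sub, sub_eq_zero]
    cases huv with
    | zeta T i =>
      rw [map_smul, hΨF, hΨ, hgt, zetaElt_eq, hz, one_mul]
    | phi T i =>
      rw [map_smul, hΨF, hΨ, hjm]
      exact jm_youngRep F (fun i j hij T => by rw [hs i j hij, youngAdj_single]) hz i T
    | tau T i j hij =>
      rw [map_add, map_smul, hΨF, map_smul, hΨ, hgt, hpi, hs i j hij, youngAdj_single,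
        piElt_of_diagRefl_eigen F ρ (fun l => hz i l T) (fun l => hz j l T), smul_smul, mul_ite,
        mul_zero, div_mul_natCast]
      have h1 : Ψ (tauRhs F T i j) = algebraMap ℂ F (youngOff (T.box i) (T.box j)) •
          swapTerm (fun S => Finsupp.single S (1 : F)) T i j := by
        unfold tauRhs swapTerm youngOff
        by_cases h : IsStandard ((Equiv.swap i j).trans T.1)
        · rw [dif_pos h, dif_pos h]
          by_cases hβ : beta (T.box i) = beta (T.box j)
          · rw [if_neg (by simpa using hβ), if_pos hβ, hΨF]
            exact congrArg (_ • ·) (hΨ _)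
          · rw [if_pos hβ, if_neg hβ, map_one, one_smul]
            exact hΨ _
        · rw [dif_neg h, dif_neg h, smul_zero, map_zero]
      rw [h1, youngDiag]
      split_ifs with hβ
      · simp only [map_div₀, map_sub, map_intCast, map_one]
        module
      · simp
  let Φ : Specht F lam →ₗ[F] (SYT lam →₀ F) :=
    { toFun := (spechtSub F lam).liftQ Ψ hker
      map_add' := fun u v => map_add ((spechtSub F lam).liftQ Ψ hker) u v
      map_smul' := fun c v => by
        obtain ⟨m, rfl⟩ := (spechtSub F lam).mkQ_surjective v
        exact hΨF c m }
  refine LinearIndependent.of_comp Φ ?_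
  have : Φ ∘ vec F = fun T => Finsupp.single T 1 := funext fun T => hΨ T
  rw [this]
  exact (Finsupp.basisSingleOne (R := F) (ι := SYT lam)).linearIndependent

variable (lam) in
/-- The basis `(v_T)` of `S^λ`. -/
def spechtBasis : Module.Basis (SYT lam) F (Specht F lam) :=
  Module.Basis.mk (linearIndependent_vec F) (span_vec F).ge

theorem spechtBasis_apply (T : SYT lam) : spechtBasis F lam T = vec F T :=
  Module.Basis.mk_apply _ _ _

end SpechtBasis


/-! ### The commutators of the `y_i` and the `x_k` -/

section CommElt

variable {F : Type} [Field F] [Algebra ℂ F] {r n : ℕ} [NeZero r] (p : Param r → F)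
  {A : Type} [Ring A] [Algebra F A] (t : W r n →* A)

/-- The discrete Fourier transform of the parameters `d_j`. -/
def dFourier (l : ZMod r) : F := (1 / (r : F)) * ∑ j : ZMod r, dPar p j * zetaPow F (-(l * j))

/-- The commutator of `y_i` and `x_k` in the rational Cherednik algebra. -/
def commElt (i k : Fin n) : A :=
  if i = k then algebraMap F A (p Param.kappa)
      - ∑ l : ZMod r, (dFourier p l * (1 - zetaPow F (-l))) • t (diagRefl i l)
      - p Param.c0 • ∑ j ∈ Finset.univ.filter (· ≠ i), reflSum t i j
    else p Param.c0 • ∑ l : ZMod r, zetaPow F (-l) • t (refl i k l)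

theorem commElt_self (i : Fin n) : commElt p t i i = algebraMap F A (p Param.kappa)
      - ∑ l : ZMod r, (dFourier p l * (1 - zetaPow F (-l))) • t (diagRefl i l)
      - p Param.c0 • ∑ j ∈ Finset.univ.filter (· ≠ i), reflSum t i j := if_pos rfl

theorem commElt_of_ne {i k : Fin n} (h : i ≠ k) :
    commElt p t i k = p Param.c0 • ∑ l : ZMod r, zetaPow F (-l) • t (refl i k l) := if_neg h

theorem mul_commElt (w : W r n) (i k : Fin n) :
    t w * commElt p t i k =
      zetaPow F ((w.left (w.right i)).toAdd - (w.left (w.right k)).toAdd) •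
        (commElt p t (w.right i) (w.right k) * t w) := by
  rcases eq_or_ne i k with rfl | h
  · rw [commElt_self, commElt_self, sub_self, zetaPow_zero, one_smul]
    simp only [mul_sub, sub_mul, mul_smul_comm, smul_mul_assoc, Finset.mul_sum, Finset.sum_mul]
    congr 1
    · congr 1
      · exact (Algebra.commutes _ _).symm
      · refine Finset.sum_congr rfl fun l _ => ?_
        rw [← map_mul, ← map_mul, mul_diagRefl]
    · congr 1
      refine Finset.sum_equiv w.right (by simp) fun j _ => ?_
      rw [mul_reflSum]
  · rw [commElt_of_ne p t h, commElt_of_ne p t (w.right.injective.ne h)]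
    simp only [mul_smul_comm, smul_mul_assoc, Finset.mul_sum, Finset.sum_mul]
    rw [smul_comm]
    congr 1
    rw [Finset.smul_sum]
    refine Fintype.sum_equiv (Equiv.addRight
      ((w.left (w.right i)).toAdd - (w.left (w.right k)).toAdd)) _ _ fun l => ?_
    rw [← map_mul, mul_refl, map_mul, smul_smul, ← zetaPow_add]
    simp only [Equiv.coe_addRight, add_sub_assoc]
    congr 2; abel

/-- This is the Jacobi identity `[y_i, [y_j, x_k]] = [y_j, [y_i, x_k]]`, which must hold if the `y`
are to commute. It uses only how the group moves the `y`, so it applies to the Dunkl operators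
before their commutativity is known. -/
theorem comm_commElt {y : Fin n → A}
    (hy : ∀ w i, t w * y i = zetaPow F (w.left (w.right i)).toAdd • (y (w.right i) * t w))
    (i j k : Fin n) :
    y i * commElt p t j k - commElt p t j k * y i =
      y j * commElt p t i k - commElt p t i k * y j := by
  have hfix : ∀ w i, w.right i = i → (w.left i).toAdd = 0 → t w * y i = y i * t w := by
    intro w i h1 h2
    rw [hy, h1, h2, zetaPow_zero, one_smul]
  have hdisj : ∀ i j k : Fin n, i ≠ j → i ≠ k → ∀ l, t (refl j k l) * y i = y i * t (refl j k l) :=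
    fun i j k h1 h2 l => hfix _ _ (Equiv.swap_apply_of_ne_of_ne h1 h2) (by simp [h1, h2])
  have hcase : ∀ i j : Fin n, i ≠ j → y i * commElt p t j j - commElt p t j j * y i =
      y j * commElt p t i j - commElt p t i j * y j := by
    intro i j hij
    have h1 : y i * commElt p t j j - commElt p t j j * y i =
        -(p Param.c0 • (y i * reflSum t j i - reflSum t j i * y i)) := by
      have hS : (∑ m ∈ Finset.univ.filter (· ≠ j), reflSum t j m) = reflSum t j i +
          ∑ m ∈ (Finset.univ.filter (· ≠ j)).erase i, reflSum t j m :=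
        (Finset.add_sum_erase _ _ (by simp [hij])).symm
      have hE : y i * (∑ m ∈ (Finset.univ.filter (· ≠ j)).erase i, reflSum t j m) =
          (∑ m ∈ (Finset.univ.filter (· ≠ j)).erase i, reflSum t j m) * y i := by
        rw [Finset.mul_sum, Finset.sum_mul]
        refine Finset.sum_congr rfl fun m hm => ?_
        rw [reflSum, Finset.mul_sum, Finset.sum_mul]
        refine Finset.sum_congr rfl fun l _ => (hdisj _ _ _ hij ?_ l).symm
        exact (Finset.ne_of_mem_erase hm).symm
      have hD : y i * (∑ l : ZMod r, (dFourier p l * (1 - zetaPow F (-l))) • t (diagRefl j l)) =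
          (∑ l : ZMod r, (dFourier p l * (1 - zetaPow F (-l))) • t (diagRefl j l)) * y i := by
        rw [Finset.mul_sum, Finset.sum_mul]
        refine Finset.sum_congr rfl fun l _ => ?_
        rw [mul_smul_comm, smul_mul_assoc, hfix _ _ rfl (by simp [hij])]
      rw [commElt_self, hS]
      generalize (∑ l : ZMod r, (dFourier p l * (1 - zetaPow F (-l))) • t (diagRefl j l)) = D
        at hD ⊢
      simp only [mul_sub, sub_mul, mul_smul_comm, smul_mul_assoc, smul_add, mul_add, add_mul, hE,
        hD, ← Algebra.commutes (p Param.kappa) (y i), smul_sub]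
      abel
    have h2 : reflSum t j i * y i = y j * ∑ l : ZMod r, zetaPow F (-l) • t (refl i j l) := by
      rw [reflSum, Finset.mul_sum, Finset.sum_mul, ← Equiv.sum_comp (Equiv.neg (ZMod r))]
      refine Finset.sum_congr rfl fun l _ => ?_
      rw [hy, mul_smul_comm, refl_comm i j]
      simp [hij.symm]
    have h3 : (∑ l : ZMod r, zetaPow F (-l) • t (refl i j l)) * y j = y i * reflSum t j i := by
      rw [reflSum_comm, reflSum, Finset.mul_sum, Finset.sum_mul]
      refine Finset.sum_congr rfl fun l _ => ?_
      rw [smul_mul_assoc, hy, smul_smul]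
      simp [hij, zetaPow_neg_mul]
    rw [h1, commElt_of_ne p t hij, mul_smul_comm, smul_mul_assoc, h2, h3, ← smul_sub, ← smul_neg,
      neg_sub]
  rcases eq_or_ne i j with rfl | hij
  · rfl
  · rcases eq_or_ne k j with rfl | hkj
    · exact hcase i k hij
    · rcases eq_or_ne k i with rfl | hki
      · exact (hcase j k hij.symm).symm
      · rw [commElt_of_ne p t hkj.symm, commElt_of_ne p t hki.symm]
        simp only [mul_smul_comm, smul_mul_assoc, Finset.mul_sum, Finset.sum_mul,
          hdisj i j k hij hki.symm, hdisj j i k hij.symm hkj.symm, sub_self]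

end CommElt

/-! ### Divided differences -/

/-- Modulo `a` the endomorphism `g` agrees with the identity on the variables, hence everywhere. The
quotient is linear in `f` because the polynomial ring is a domain. -/
theorem exists_dividedDifference (F : Type) [Field F] {σ : Type} (g : MvPolynomial σ F →ₐ[F] MvPolynomial σ F)
    {a : MvPolynomial σ F} (ha : a ≠ 0)
    (h : ∀ k, a ∣ MvPolynomial.X k - g (MvPolynomial.X k)) :
    ∃ D : MvPolynomial σ F →ₗ[F] MvPolynomial σ F, ∀ f, a * D f = f - g f := by
  have hdvd : ∀ f, a ∣ f - g f := by
    have : Ideal.Quotient.mkₐ F (Ideal.span {a}) = (Ideal.Quotient.mkₐ F (Ideal.span {a})).comp g :=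
      MvPolynomial.algHom_ext fun k => by
        rw [AlgHom.comp_apply, Ideal.Quotient.mkₐ_eq_mk, Ideal.Quotient.eq,
          Ideal.mem_span_singleton]
        exact h k
    intro f
    have hf := AlgHom.congr_fun this f
    rwa [AlgHom.comp_apply, Ideal.Quotient.mkₐ_eq_mk, Ideal.Quotient.eq,
      Ideal.mem_span_singleton] at hf
  choose D hD using hdvd
  refine ⟨⟨⟨D, fun f g' => mul_left_cancel₀ ha ?_⟩, fun c f => mul_left_cancel₀ ha ?_⟩,
    fun f => (hD f).symm⟩
  · rw [mul_add, ← hD, ← hD, ← hD, map_add]; ring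
  · simp only [RingHom.id_apply]
    rw [mul_smul_comm, ← hD, ← hD, map_smul, smul_sub]

/-! ### The action on polynomials and its divided differences -/

section Poly

variable (F : Type) [Field F] [Algebra ℂ F] {r n : ℕ} [NeZero r]

/-- The action of `G(r,1,n)` on polynomials. -/
def polyAct (w : W r n) : MvPolynomial (Fin n) F →ₐ[F] MvPolynomial (Fin n) F :=
  MvPolynomial.aeval fun j =>
    MvPolynomial.C (zetaPow F (-(w.left (w.right j)).toAdd)) * MvPolynomial.X (w.right j)

theorem polyAct_X (w : W r n) (j : Fin n) : polyAct F w (MvPolynomial.X j) =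
    MvPolynomial.C (zetaPow F (-(w.left (w.right j)).toAdd)) * MvPolynomial.X (w.right j) :=
  MvPolynomial.aeval_X _ _

theorem polyAct_one : polyAct F (1 : W r n) = AlgHom.id F _ :=
  MvPolynomial.algHom_ext fun j => by rw [polyAct_X]; simp

theorem polyAct_mul (w v : W r n) : polyAct F (w * v) = (polyAct F w).comp (polyAct F v) :=
  MvPolynomial.algHom_ext fun j => by
    rw [AlgHom.comp_apply, polyAct_X, polyAct_X, map_mul, polyAct_X, ← MvPolynomial.algebraMap_eq,
      AlgHom.commutes, ← mul_assoc, MvPolynomial.algebraMap_eq, ← map_mul, ← zetaPow_add, W_mul_left]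
    simp

/-- The linear form vanishing on the hyperplane of a reflection `ζ_i^l s_{ij} ζ_i^{-l}`. -/
def reflRoot (i j : Fin n) (l : ZMod r) : MvPolynomial (Fin n) F :=
  MvPolynomial.X i - MvPolynomial.C (zetaPow F l) * MvPolynomial.X j

theorem reflRoot_ne_zero {i j : Fin n} (h : i ≠ j) (l : ZMod r) : reflRoot F i j l ≠ 0 := by
  intro h0
  have := congrArg (MvPolynomial.eval fun k => if k = i then (1 : F) else 0) h0
  simp [reflRoot, h.symm] at this

/-- The quotient of `x_k - s.x_k` by the root of `s`. -/
def rootCoeff (i j : Fin n) (l : ZMod r) (k : Fin n) : F :=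
  if k = i then 1 else if k = j then -zetaPow F (-l) else 0

theorem reflRoot_mul_rootCoeff {i j : Fin n} (h : i ≠ j) (l : ZMod r) (k : Fin n) :
    MvPolynomial.X k - polyAct F (refl i j l) (MvPolynomial.X k) =
      reflRoot F i j l * MvPolynomial.C (rootCoeff F i j l k) := by
  rw [polyAct_X, reflRoot, rootCoeff, refl_right, refl_left]
  rcases eq_or_ne k i with rfl | hi
  · simp [h.symm]
  · rcases eq_or_ne k j with rfl | hj
    · have := zetaPow_mul_neg F l
      simp only [Equiv.swap_apply_right, if_true, if_neg h, if_neg hi, sub_zero, map_neg]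
      have h2 : (MvPolynomial.C (zetaPow F l) * MvPolynomial.C (zetaPow F (-l)) :
          MvPolynomial (Fin n) F) = 1 := by rw [← map_mul, this, map_one]
      linear_combination (-(MvPolynomial.X k : MvPolynomial (Fin n) F)) * h2
    · simp [hi, hj, Equiv.swap_apply_of_ne_of_ne hi hj]

theorem exists_reflDiff {i j : Fin n} (h : i ≠ j) (l : ZMod r) :
    ∃ D : MvPolynomial (Fin n) F →ₗ[F] MvPolynomial (Fin n) F,
      ∀ f, reflRoot F i j l * D f = f - polyAct F (refl i j l) f :=
  exists_dividedDifference F _ (reflRoot_ne_zero F h l) fun k =>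
    ⟨_, reflRoot_mul_rootCoeff F h l k⟩

/-- The divided difference operator `f ↦ (f - s.f) / α_s` of `s = ζ_i^l s_{ij} ζ_i^{-l}`. -/
def reflDiff (i j : Fin n) (l : ZMod r) : MvPolynomial (Fin n) F →ₗ[F] MvPolynomial (Fin n) F :=
  if h : i ≠ j then (exists_reflDiff F h l).choose else 0

theorem reflRoot_mul_reflDiff {i j : Fin n} (h : i ≠ j) (l : ZMod r)
    (f : MvPolynomial (Fin n) F) :
    reflRoot F i j l * reflDiff F i j l f = f - polyAct F (refl i j l) f := by
  rw [reflDiff, dif_pos h]; exact (exists_reflDiff F h l).choose_spec f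

/-- The twisted Leibniz rule. Its correction term is what turns a sum of divided differences into
the commutator with multiplication by `x_k`. -/
theorem reflDiff_X_mul {i j : Fin n} (h : i ≠ j) (l : ZMod r) (k : Fin n)
    (f : MvPolynomial (Fin n) F) :
    reflDiff F i j l (MvPolynomial.X k * f) =
      MvPolynomial.X k * reflDiff F i j l f +
        rootCoeff F i j l k • polyAct F (refl i j l) f := by
  refine mul_left_cancel₀ (reflRoot_ne_zero F h l) ?_
  have h1 := reflRoot_mul_rootCoeff F h l k
  have h2 := reflRoot_mul_reflDiff F h l f
  rw [reflRoot_mul_reflDiff F h, MvPolynomial.smul_eq_C_mul, map_mul]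
  linear_combination (-(MvPolynomial.X k : MvPolynomial (Fin n) F)) * h2 +
    (polyAct F (refl i j l) f) * h1

theorem X_sub_polyAct_diagRefl (i : Fin n) (l : ZMod r) (k : Fin n) :
    MvPolynomial.X k - polyAct F (diagRefl i l) (MvPolynomial.X k) =
      MvPolynomial.X i * MvPolynomial.C (if i = k then 1 - zetaPow F (-l) else 0) := by
  rw [polyAct_X]
  rcases eq_or_ne i k with rfl | h
  · simp; ring
  · simp [h, h.symm]

theorem exists_diagDiff (i : Fin n) (l : ZMod r) :
    ∃ D : MvPolynomial (Fin n) F →ₗ[F] MvPolynomial (Fin n) F,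
      ∀ f, MvPolynomial.X i * D f = f - polyAct F (diagRefl i l) f :=
  exists_dividedDifference F _ (MvPolynomial.X_ne_zero i) fun k =>
    ⟨_, X_sub_polyAct_diagRefl F i l k⟩

/-- The divided difference operator `f ↦ (f - s.f) / x_i` of `s = ζ_i^l`. -/
def diagDiff (i : Fin n) (l : ZMod r) : MvPolynomial (Fin n) F →ₗ[F] MvPolynomial (Fin n) F :=
  (exists_diagDiff F i l).choose

theorem X_mul_diagDiff (i : Fin n) (l : ZMod r) (f : MvPolynomial (Fin n) F) :
    MvPolynomial.X i * diagDiff F i l f = f - polyAct F (diagRefl i l) f :=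
  (exists_diagDiff F i l).choose_spec f

theorem diagDiff_X_mul (i : Fin n) (l : ZMod r) (k : Fin n) (f : MvPolynomial (Fin n) F) :
    diagDiff F i l (MvPolynomial.X k * f) = MvPolynomial.X k * diagDiff F i l f +
        (if i = k then 1 - zetaPow F (-l) else 0) • polyAct F (diagRefl i l) f := by
  refine mul_left_cancel₀ (MvPolynomial.X_ne_zero i) ?_
  have h1 := X_sub_polyAct_diagRefl F i l k
  have h2 := X_mul_diagDiff F i l f
  rw [X_mul_diagDiff F, MvPolynomial.smul_eq_C_mul, map_mul]
  linear_combination (-(MvPolynomial.X k : MvPolynomial (Fin n) F)) * h2 +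
    (polyAct F (diagRefl i l) f) * h1

theorem reflDiff_one {i j : Fin n} (h : i ≠ j) (l : ZMod r) : reflDiff F i j l 1 = 0 := by
  have := reflRoot_mul_reflDiff F h l 1
  rw [map_one (polyAct F _), sub_self] at this
  exact (mul_eq_zero.1 this).resolve_left (reflRoot_ne_zero F h l)

theorem diagDiff_one (i : Fin n) (l : ZMod r) : diagDiff F i l 1 = 0 := by
  have := X_mul_diagDiff F i l 1
  rw [map_one (polyAct F _), sub_self] at this
  exact (mul_eq_zero.1 this).resolve_left (MvPolynomial.X_ne_zero i)

end Poly


/-! ### The polynomial representation -/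

section PolyMod

/-- The space `F[x_1, …, x_n] ⊗ V`. -/
def PolyMod (F : Type) [Field F] (n : ℕ) (V : Type) [AddCommGroup V] [Module F V] : Type :=
  MvPolynomial (Fin n) F ⊗[F] V

variable {F : Type} [Field F] {n : ℕ} {V : Type} [AddCommGroup V] [Module F V]

instance : AddCommGroup (PolyMod F n V) :=
  inferInstanceAs (AddCommGroup (MvPolynomial (Fin n) F ⊗[F] V))

instance : Module F (PolyMod F n V) :=
  inferInstanceAs (Module F (MvPolynomial (Fin n) F ⊗[F] V))

/-- The tensor `f ⊗ v`, as a bilinear map. -/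
def tm : MvPolynomial (Fin n) F →ₗ[F] V →ₗ[F] PolyMod F n V := TensorProduct.mk F _ _

/-- The operator `g ⊗ h`. -/
def opMap (g : MvPolynomial (Fin n) F →ₗ[F] MvPolynomial (Fin n) F) (h : V →ₗ[F] V) :
    Module.End F (PolyMod F n V) := TensorProduct.map g h

theorem opMap_tm (g : MvPolynomial (Fin n) F →ₗ[F] MvPolynomial (Fin n) F) (h : V →ₗ[F] V)
    (f : MvPolynomial (Fin n) F) (v : V) : opMap g h (tm f v) = tm (g f) (h v) := rfl

theorem polyMod_end_ext {A B : Module.End F (PolyMod F n V)}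
    (h : ∀ f v, A (tm f v) = B (tm f v)) : A = B :=
  TensorProduct.ext' h

/-- Multiplication by `x_k`. -/
def opX (k : Fin n) : Module.End F (PolyMod F n V) :=
  opMap (LinearMap.mulLeft F (MvPolynomial.X k)) LinearMap.id

theorem opX_tm (k : Fin n) (f : MvPolynomial (Fin n) F) (v : V) :
    opX k (tm f v) = tm (MvPolynomial.X k * f) v := rfl

theorem opX_mul_opX (i j : Fin n) :
    (opX i * opX j : Module.End F (PolyMod F n V)) = opX j * opX i := by
  refine polyMod_end_ext fun f v => ?_
  simp only [Module.End.mul_apply, opX_tm, mul_left_comm]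

/-- An operator that commutes with all `x_k` up to a twist is determined by its values on
constants. -/
theorem eq_zero_of_mul_opX {A : Module.End F (PolyMod F n V)} (hA : ∀ v, A (tm 1 v) = 0)
    (h : ∀ k, ∃ B : Module.End F (PolyMod F n V), A * opX k = B * A) : A = 0 := by
  refine polyMod_end_ext fun f v => ?_
  rw [LinearMap.zero_apply]
  induction f using MvPolynomial.induction_on with
  | C a =>
    have : (MvPolynomial.C a : MvPolynomial (Fin n) F) = a • 1 := by
      rw [MvPolynomial.smul_eq_C_mul, mul_one]
    rw [this, map_smul, LinearMap.smul_apply, map_smul, hA, smul_zero]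
  | add f g hf hg => rw [map_add, LinearMap.add_apply, map_add, hf, hg, add_zero]
  | mul_X f k hf =>
    obtain ⟨B, hB⟩ := h k
    rw [mul_comm, ← opX_tm, ← Module.End.mul_apply, hB, Module.End.mul_apply, hf, map_zero]

variable [Algebra ℂ F] {r : ℕ} [NeZero r] (ρ : W r n →* Module.End F V)

/-- The diagonal action of `G(r,1,n)`. -/
def opT : W r n →* Module.End F (PolyMod F n V) where
  toFun w := opMap (polyAct F w).toLinearMap (ρ w)
  map_one' := polyMod_end_ext fun f v => by
    rw [opMap_tm, polyAct_one, map_one]; rfl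
  map_mul' w v := polyMod_end_ext fun f u => by
    rw [opMap_tm, polyAct_mul, map_mul]; rfl

theorem opT_tm (w : W r n) (f : MvPolynomial (Fin n) F) (v : V) :
    opT ρ w (tm f v) = tm (polyAct F w f) (ρ w v) := rfl

variable (p : Param r → F)

/-- The Dunkl operator by which `y_i` acts. -/
def opY (i : Fin n) : Module.End F (PolyMod F n V) :=
  p Param.kappa • opMap (MvPolynomial.pderiv i).toLinearMap LinearMap.id
    - ∑ l : ZMod r, dFourier p l • opMap (diagDiff F i l) (ρ (diagRefl i l))
    - p Param.c0 • ∑ j ∈ Finset.univ.filter (· ≠ i), ∑ l : ZMod r,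
        opMap (reflDiff F i j l) (ρ (refl i j l))

theorem opY_tm (i : Fin n) (f : MvPolynomial (Fin n) F) (v : V) :
    opY ρ p i (tm f v) = p Param.kappa • tm (MvPolynomial.pderiv i f) v
    - ∑ l : ZMod r, dFourier p l • tm (diagDiff F i l f) (ρ (diagRefl i l) v)
    - p Param.c0 • ∑ j ∈ Finset.univ.filter (· ≠ i), ∑ l : ZMod r,
        tm (reflDiff F i j l f) (ρ (refl i j l) v) := by
  simp only [opY, LinearMap.sub_apply, LinearMap.smul_apply, LinearMap.sum_apply, opMap_tm]
  rfl

theorem opY_tm_one (i : Fin n) (v : V) : opY ρ p i (tm 1 v) = 0 := by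
  have h : ∑ j ∈ Finset.univ.filter (· ≠ i), ∑ l : ZMod r,
      tm (reflDiff F i j l 1) (ρ (refl i j l) v) = 0 :=
    Finset.sum_eq_zero fun j hj => Finset.sum_eq_zero fun l _ => by
      rw [reflDiff_one F (Finset.mem_filter.1 hj).2.symm, map_zero, LinearMap.zero_apply]
  rw [opY_tm, h]
  simp [diagDiff_one]

theorem commElt_apply (i k : Fin n) (m : PolyMod F n V) :
    commElt p (opT ρ) i k m = if i = k then p Param.kappa • m
      - ∑ l : ZMod r, (dFourier p l * (1 - zetaPow F (-l))) • opT ρ (diagRefl i l) m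
      - p Param.c0 • ∑ j ∈ Finset.univ.filter (· ≠ i), ∑ l : ZMod r, opT ρ (refl i j l) m
    else p Param.c0 • ∑ l : ZMod r, zetaPow F (-l) • opT ρ (refl i k l) m := by
  unfold commElt
  split_ifs
  · simp only [LinearMap.sub_apply, LinearMap.smul_apply, LinearMap.sum_apply, reflSum]
    rfl
  · simp only [LinearMap.smul_apply, LinearMap.sum_apply]

/-- The ordinary Leibniz rule produces `κ`, and the twisted Leibniz rules of the divided differences
produce the group elements. With these weights of the divided differences the result is the
commutator prescribed in `ℍ`. -/
theorem opY_mul_opX (i k : Fin n) :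
    opY ρ p i * opX k = opX k * opY ρ p i + commElt p (opT ρ) i k := by
  refine polyMod_end_ext fun f v => ?_
  rw [LinearMap.add_apply, Module.End.mul_apply, Module.End.mul_apply, opX_tm, opY_tm, opY_tm,
    commElt_apply]
  simp only [map_sub, map_smul, map_sum, opX_tm, opT_tm, diagDiff_X_mul, map_add,
    LinearMap.add_apply, LinearMap.smul_apply, smul_add, Finset.sum_add_distrib]
  have hd : ∀ j ∈ Finset.univ.filter (· ≠ i), ∑ l : ZMod r,
      tm (reflDiff F i j l (MvPolynomial.X k * f)) (ρ (refl i j l) v) =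
      ∑ l : ZMod r, tm (MvPolynomial.X k * reflDiff F i j l f) (ρ (refl i j l) v) +
      ∑ l : ZMod r, rootCoeff F i j l k • tm (polyAct F (refl i j l) f) (ρ (refl i j l) v) := by
    intro j hj
    rw [← Finset.sum_add_distrib]
    refine Finset.sum_congr rfl fun l _ => ?_
    rw [reflDiff_X_mul F (Finset.mem_filter.1 hj).2.symm, map_add, map_smul, LinearMap.add_apply,
      LinearMap.smul_apply]
  have hp : p Param.kappa • tm (MvPolynomial.pderiv i (MvPolynomial.X k * f)) v =
      p Param.kappa • tm (MvPolynomial.X k * MvPolynomial.pderiv i f) v +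
        (if i = k then p Param.kappa • tm f v else 0) := by
    rw [Derivation.leibniz, MvPolynomial.pderiv_X, smul_eq_mul, smul_eq_mul, map_add,
      LinearMap.add_apply, smul_add]
    congr 1
    rcases eq_or_ne i k with rfl | h
    · simp
    · simp [h]
  rw [Finset.sum_congr rfl hd, Finset.sum_add_distrib, hp]
  rcases eq_or_ne i k with rfl | h
  · simp only [if_true, smul_smul, rootCoeff, one_smul, smul_add]
    abel
  · have h1 : (∑ j ∈ Finset.univ.filter (· ≠ i), ∑ l : ZMod r,
        rootCoeff F i j l k • tm (polyAct F (refl i j l) f) (ρ (refl i j l) v)) =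
        -∑ l : ZMod r, zetaPow F (-l) • tm (polyAct F (refl i k l) f) (ρ (refl i k l) v) := by
      rw [Finset.sum_eq_single k, ← Finset.sum_neg_distrib]
      · simp [rootCoeff, h.symm]
      · intro j _ hj
        simp [rootCoeff, h.symm, hj.symm]
      · intro hk; simp [h.symm] at hk
    rw [h1]
    simp only [if_neg h, zero_smul, smul_zero, Finset.sum_const_zero, add_zero, smul_add, smul_neg]
    abel

theorem opT_mul_opX (w : W r n) (j : Fin n) :
    opT ρ w * opX j = zetaPow F (-(w.left (w.right j)).toAdd) • (opX (w.right j) * opT ρ w) := by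
  refine polyMod_end_ext fun f v => ?_
  rw [LinearMap.smul_apply, Module.End.mul_apply, Module.End.mul_apply, opX_tm, opT_tm, opT_tm,
    opX_tm, map_mul, polyAct_X, mul_assoc, ← MvPolynomial.smul_eq_C_mul, map_smul,
    LinearMap.smul_apply]

/-- The difference of the two sides kills constants, and by equivariance of `commElt` it commutes
with the `x_k` up to the twist by `w`. Such an operator is zero. -/
theorem opT_mul_opY (w : W r n) (i : Fin n) :
    opT ρ w * opY ρ p i = zetaPow F (w.left (w.right i)).toAdd • (opY ρ p (w.right i) * opT ρ w) := by
  rw [← sub_eq_zero]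
  refine eq_zero_of_mul_opX (fun v => ?_) fun k =>
    ⟨zetaPow F (-(w.left (w.right k)).toAdd) • opX (w.right k), ?_⟩
  · rw [LinearMap.sub_apply, LinearMap.smul_apply, Module.End.mul_apply, Module.End.mul_apply,
      opY_tm_one, opT_tm, map_one (polyAct F w), opY_tm_one, map_zero, smul_zero, sub_zero]
  · have hG := mul_commElt p (opT ρ) w i k
    have h1 : opT ρ w * opY ρ p i * opX k =
        zetaPow F (-(w.left (w.right k)).toAdd) • (opX (w.right k) * (opT ρ w * opY ρ p i)) +
          opT ρ w * commElt p (opT ρ) i k := by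
      rw [mul_assoc, opY_mul_opX, mul_add, ← mul_assoc, opT_mul_opX, smul_mul_assoc, mul_assoc]
    have h2 : opY ρ p (w.right i) * opT ρ w * opX k =
        zetaPow F (-(w.left (w.right k)).toAdd) •
          (opX (w.right k) * (opY ρ p (w.right i) * opT ρ w) +
            commElt p (opT ρ) (w.right i) (w.right k) * opT ρ w) := by
      rw [mul_assoc, opT_mul_opX, mul_smul_comm, ← mul_assoc, opY_mul_opX, add_mul, mul_assoc]
    rw [sub_mul, h1, smul_mul_assoc, h2, hG, sub_eq_add_neg (w.left _).toAdd, zetaPow_add,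
      smul_mul_assoc, mul_sub, mul_smul_comm]
    module

/-- The commutator of two Dunkl operators kills constants, and it commutes with every `x_k` by the
Jacobi identity `comm_commElt`. Hence it vanishes, without any computation with products of divided
differences. -/
theorem opY_mul_opY (i j : Fin n) : opY ρ p i * opY ρ p j = opY ρ p j * opY ρ p i := by
  rw [← sub_eq_zero]
  refine eq_zero_of_mul_opX (fun v => ?_) fun k => ⟨opX k, ?_⟩
  · rw [LinearMap.sub_apply, Module.End.mul_apply, Module.End.mul_apply, opY_tm_one, opY_tm_one,
      map_zero, map_zero, sub_zero]
  · have h : ∀ i j, opY ρ p i * opY ρ p j * opX k = opX k * (opY ρ p i * opY ρ p j) +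
        commElt p (opT ρ) i k * opY ρ p j + opY ρ p i * commElt p (opT ρ) j k := by
      intro i j
      rw [mul_assoc, opY_mul_opX, mul_add, ← mul_assoc, opY_mul_opX, add_mul, mul_assoc]
    have hG := comm_commElt p (opT ρ) (opT_mul_opY ρ p) i j k
    rw [sub_mul, h, h, mul_sub]
    linear_combination (norm := abel) hG

end PolyMod

/-! ### The action of the rational Cherednik algebra -/

section Action

variable {F : Type} [Field F] [Algebra ℂ F] {r n : ℕ} [NeZero r] (p : Param r → F)

/-- The elements `t_w` of `ℍ` as a homomorphism. -/
def htHom : W r n →* H n p where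
  toFun := ht p
  map_one' := (RingQuot.mkAlgHom_rel F (Rel.t_one)).trans (map_one _)
  map_mul' w v := by
    rw [ht, ← RingQuot.mkAlgHom_rel F (Rel.t_mul w v)]
    exact map_mul _ _ _

theorem htHom_apply (w : W r n) : htHom p w = ht p w := rfl

/-- Fourier inversion rewrites the idempotents `e_{ij}` through the elements `ζ_i^l`. The shift from
`d_j` to `d_{j-1}` becomes the factor `1 - ζ^{-l}`, which is also the divided difference of `x_i`.
-/
theorem sum_fe (i : Fin n) {A : Type} [Ring A] [Algebra F A] (t : W r n →* A) :
    ∑ j : ZMod r, (dPar p j - dPar p (j - 1)) • ((1 / (r : F)) • ∑ l ∈ Finset.range r,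
      zetaPow F (-((l : ZMod r) * j)) • t (zetaElt r i ^ l)) =
    ∑ l : ZMod r, (dFourier p l * (1 - zetaPow F (-l))) • t (diagRefl i l) := by
  have h1 : ∀ j : ZMod r, ∑ l ∈ Finset.range r,
      zetaPow F (-((l : ZMod r) * j)) • t (zetaElt r i ^ l) =
      ∑ l : ZMod r, zetaPow F (-(l * j)) • t (diagRefl i l) := fun j => by
    simp only [zetaElt_pow]
    exact sum_range_zmod fun l => zetaPow F (-(l * j)) • t (diagRefl i l)
  simp only [h1, Finset.smul_sum, smul_smul]
  rw [Finset.sum_comm]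
  refine Finset.sum_congr rfl fun l _ => ?_
  rw [← Finset.sum_smul]
  congr 1
  have h2 : ∑ j : ZMod r, dPar p (j - 1) * zetaPow F (-(l * j)) =
      zetaPow F (-l) * ∑ j : ZMod r, dPar p j * zetaPow F (-(l * j)) := by
    rw [Finset.mul_sum, ← Equiv.sum_comp (Equiv.addRight (1 : ZMod r))]
    refine Finset.sum_congr rfl fun j _ => ?_
    simp only [Equiv.coe_addRight, add_sub_cancel_right]
    rw [mul_add, mul_one, neg_add, zetaPow_add]; ring
  have h3 : ∀ j : ZMod r, (dPar p j - dPar p (j - 1)) * (1 / (r : F)) * zetaPow F (-(l * j)) =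
      1 / (r : F) * (dPar p j * zetaPow F (-(l * j))) -
        1 / (r : F) * (dPar p (j - 1) * zetaPow F (-(l * j))) := fun j => by ring
  simp only [← mul_assoc]
  rw [Finset.sum_congr rfl fun j _ => h3 j, Finset.sum_sub_distrib, ← Finset.mul_sum,
    ← Finset.mul_sum, h2, dFourier]
  ring

theorem hx_mul_hx (i j : Fin n) : hx p i * hx p j = hx p j * hx p i := by
  have h := RingQuot.mkAlgHom_rel F (Rel.xx (p := p) i j)
  simp only [map_mul] at h
  exact h

theorem hy_mul_hy (i j : Fin n) : hy p i * hy p j = hy p j * hy p i := by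
  have h := RingQuot.mkAlgHom_rel F (Rel.yy (p := p) i j)
  simp only [map_mul] at h
  exact h

theorem ht_mul_hx (w : W r n) (j : Fin n) : htHom p w * hx p j =
    zetaPow F (-(w.left (w.right j)).toAdd) • (hx p (w.right j) * htHom p w) := by
  have h := RingQuot.mkAlgHom_rel F (Rel.tx (p := p) w j)
  simp only [map_mul, map_smul] at h
  exact h

theorem ht_mul_hy (w : W r n) (j : Fin n) : htHom p w * hy p j =
    zetaPow F (w.left (w.right j)).toAdd • (hy p (w.right j) * htHom p w) := by
  have h := RingQuot.mkAlgHom_rel F (Rel.ty (p := p) w j)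
  simp only [map_mul, map_smul] at h
  exact h

theorem hy_mul_hx (i k : Fin n) :
    hy p i * hx p k = hx p k * hy p i + commElt p (htHom p) i k := by
  rcases eq_or_ne i k with rfl | h
  · have h1 := RingQuot.mkAlgHom_rel F (Rel.yx_eq (p := p) i)
    simp only [map_mul, map_sub, map_add, map_sum, map_smul, AlgHom.commutes, fe] at h1
    have h2 : ∀ l, RingQuot.mkAlgHom F (Rel n p) (ft F (zetaElt r i ^ l)) =
        htHom p (zetaElt r i ^ l) := fun l => rfl
    have h3 : ∀ j l, RingQuot.mkAlgHom F (Rel n p) (ft F (reflElt r i j l)) =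
        htHom p (reflElt r i j l) := fun j l => rfl
    simp only [h2, h3] at h1
    rw [commElt_self, ← sum_fe]
    simp only [← sum_range_reflElt]
    refine h1.trans ?_
    simp only [hx, hy]
    abel
  · have h1 := RingQuot.mkAlgHom_rel F (Rel.yx_ne (p := p) i k h)
    simp only [map_mul, map_add, map_sum, map_smul] at h1
    rw [commElt_of_ne _ _ h, ← sum_range_zmod (r := r)]
    refine h1.trans ?_
    congr 2
    refine Finset.sum_congr rfl fun l _ => ?_
    rw [← reflElt_eq]; rfl

variable {V : Type} [AddCommGroup V] [Module F V] (ρ : W r n →* Module.End F V)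

/-- The images of the generators of `ℍ` in the polynomial representation. -/
def genAct : Gen r n → Module.End F (PolyMod F n V)
  | Gen.x i => opX i
  | Gen.y i => opY ρ p i
  | Gen.t w => opT ρ w

theorem lift_genAct_rel ⦃a b : FreeAlgebra F (Gen r n)⦄ (h : Rel n p a b) :
    FreeAlgebra.lift F (genAct p ρ) a = FreeAlgebra.lift F (genAct p ρ) b := by
  have hX : ∀ i, FreeAlgebra.lift F (genAct p ρ) (fx F r i) = opX i := fun i =>
    FreeAlgebra.lift_ι_apply _ _
  have hY : ∀ i, FreeAlgebra.lift F (genAct p ρ) (fy F r i) = opY ρ p i := fun i =>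
    FreeAlgebra.lift_ι_apply _ _
  have hT : ∀ w, FreeAlgebra.lift F (genAct p ρ) (ft F w) = opT ρ w := fun i =>
    FreeAlgebra.lift_ι_apply _ _
  cases h with
  | xx i j => simp only [map_mul, hX]; exact opX_mul_opX i j
  | yy i j => simp only [map_mul, hY]; exact opY_mul_opY ρ p i j
  | t_one => rw [hT, map_one, map_one]
  | t_mul w v => rw [map_mul, hT, hT, hT, ← map_mul]
  | tx w j => rw [map_mul, map_smul, map_mul, hT, hX, hX]; exact opT_mul_opX ρ w j
  | ty w j => rw [map_mul, map_smul, map_mul, hT, hY, hY]; exact opT_mul_opY ρ p w j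
  | yx_ne i j hij =>
    simp only [map_mul, map_add, map_smul, map_sum, hT, hX, hY]
    rw [opY_mul_opX, commElt_of_ne _ _ hij, ← sum_range_zmod (r := r)]
    simp only [reflElt_eq]
  | yx_eq i =>
    simp only [map_mul, map_add, map_sub, map_smul, map_sum, hT, hX, hY, AlgHom.commutes, fe]
    rw [opY_mul_opX, commElt_self, sum_fe]
    simp only [sum_range_reflElt]
    abel

/-- The polynomial representation of `ℍ`. -/
def polyRep : H n p →ₐ[F] Module.End F (PolyMod F n V) :=
  RingQuot.liftAlgHom F ⟨FreeAlgebra.lift F (genAct p ρ), lift_genAct_rel p ρ⟩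

theorem polyRep_hx (i : Fin n) : polyRep p ρ (hx p i) = opX i :=
  (RingQuot.liftAlgHom_mkAlgHom_apply _ _ _ _).trans (FreeAlgebra.lift_ι_apply _ _)

theorem polyRep_hy (i : Fin n) : polyRep p ρ (hy p i) = opY ρ p i :=
  (RingQuot.liftAlgHom_mkAlgHom_apply _ _ _ _).trans (FreeAlgebra.lift_ι_apply _ _)

theorem polyRep_ht (w : W r n) : polyRep p ρ (ht p w) = opT ρ w :=
  (RingQuot.liftAlgHom_mkAlgHom_apply _ _ _ _).trans (FreeAlgebra.lift_ι_apply _ _)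

end Action


/-! ### The standard module as the polynomial representation -/

section Mon

variable {F : Type} [Field F] {n : ℕ}

/-- The monomial `x^μ`. -/
def mon (F : Type) [Field F] {n : ℕ} (μ : Fin n → ℕ) : MvPolynomial (Fin n) F :=
  ∏ i, MvPolynomial.X i ^ μ i

theorem mon_eq (μ : Fin n → ℕ) :
    mon F μ = MvPolynomial.monomial (Finsupp.equivFunOnFinite.symm μ) 1 := by
  rw [mon, MvPolynomial.monomial_eq, map_one, one_mul, Finsupp.prod_fintype _ _ (by simp)]
  rfl

variable (F n) in
/-- The basis of monomials, indexed by compositions. -/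
def monBasis : Module.Basis (Fin n → ℕ) F (MvPolynomial (Fin n) F) :=
  (MvPolynomial.basisMonomials (Fin n) F).reindex Finsupp.equivFunOnFinite

theorem monBasis_apply (μ : Fin n → ℕ) : monBasis F n μ = mon F μ := by
  rw [monBasis, Module.Basis.reindex_apply, MvPolynomial.coe_basisMonomials, mon_eq]

variable {V : Type} [AddCommGroup V] [Module F V]

/-- `F[x] ⊗ V` as the space of finitely supported families of coefficients in `V`. -/
def polyModEquiv : PolyMod F n V ≃ₗ[F] ((Fin n → ℕ) →₀ V) :=
  TensorProduct.equivFinsuppOfBasisLeft (N := V) (monBasis F n)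

theorem polyModEquiv_tm_mon (μ : Fin n → ℕ) (v : V) :
    polyModEquiv (tm (mon F μ) v) = Finsupp.single μ v := by
  refine (TensorProduct.equivFinsuppOfBasisLeft_apply_tmul (monBasis F n) (mon F μ) v).trans ?_
  rw [← monBasis_apply, Module.Basis.repr_self, Finsupp.mapRange_single, one_smul]

/-- The basis of `F[x] ⊗ V` built from the monomials and a basis of `V` for each monomial. -/
def polyModBasis {ι : Type} (b : (Fin n → ℕ) → Module.Basis ι F V) :
    Module.Basis ((Fin n → ℕ) × ι) F (PolyMod F n V) :=
  ((Finsupp.basis b).map polyModEquiv.symm).reindex (Equiv.sigmaEquivProd _ _)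

theorem polyModBasis_apply {ι : Type} (b : (Fin n → ℕ) → Module.Basis ι F V)
    (a : (Fin n → ℕ) × ι) : polyModBasis b a = tm (mon F a.1) (b a.1 a.2) := by
  obtain ⟨μ, i⟩ := a
  rw [polyModBasis, Module.Basis.reindex_apply, Module.Basis.map_apply, Finsupp.coe_basis,
    LinearEquiv.symm_apply_eq, polyModEquiv_tm_mon]
  rfl

theorem polyMod_induction {q : PolyMod F n V → Prop}
    (h0 : q 0) (h1 : ∀ v, q (tm 1 v)) (hX : ∀ k z, q z → q (opX k z))
    (ha : ∀ z z', q z → q z' → q (z + z')) (z : PolyMod F n V) : q z := by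
  refine TensorProduct.induction_on (motive := q) z h0 (fun f v => ?_) ha
  change q (tm f v)
  induction f using MvPolynomial.induction_on generalizing v with
  | C a =>
    have : (MvPolynomial.C a : MvPolynomial (Fin n) F) = a • 1 := by
      rw [MvPolynomial.smul_eq_C_mul, mul_one]
    rw [this, map_smul, LinearMap.smul_apply, ← map_smul]
    exact h1 _
  | add f g hf hg => rw [map_add, LinearMap.add_apply]; exact ha _ _ (hf v) (hg v)
  | mul_X f k hf => rw [mul_comm, ← opX_tm]; exact hX _ _ (hf v)

theorem polyMod_hom_ext {N : Type} [AddCommGroup N] [Module F N] {f g : PolyMod F n V →ₗ[F] N}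
    (h : ∀ a v, f (tm a v) = g (tm a v)) : f = g :=
  TensorProduct.ext' h

end Mon

/-! ### Identification of `M(λ)` with `F[x] ⊗ S^λ` -/

section Standard

variable {F : Type} [Field F] [Algebra ℂ F] {r n : ℕ} [NeZero r] (p : Param r → F)
  (lam : RPartition r n)

/-- The vector `h ⊗ v` of `M(λ)`. -/
def mTensor (h : H n p) (v : Specht F lam) : M p lam := (indSub p lam).mkQ (h ⊗ₜ v)

theorem smul_mTensor (h k : H n p) (v : Specht F lam) :
    h • mTensor p lam k v = mTensor p lam (h * k) v := rfl

theorem mTensor_add_left (h k : H n p) (v : Specht F lam) :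
    mTensor p lam (h + k) v = mTensor p lam h v + mTensor p lam k v := by
  rw [mTensor, TensorProduct.add_tmul, map_add]; rfl

theorem mTensor_add_right (h : H n p) (u v : Specht F lam) :
    mTensor p lam h (u + v) = mTensor p lam h u + mTensor p lam h v := by
  rw [mTensor, TensorProduct.tmul_add, map_add]; rfl

theorem mTensor_smul_left (c : F) (h : H n p) (v : Specht F lam) :
    mTensor p lam (c • h) v = c • mTensor p lam h v := rfl

theorem mTensor_smul_right (c : F) (h : H n p) (v : Specht F lam) :
    mTensor p lam h (c • v) = c • mTensor p lam h v := by
  rw [mTensor, TensorProduct.tmul_smul]; rfl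

theorem ht_smul_mTensor_one (w : W r n) (v : Specht F lam) :
    ht p w • mTensor p lam 1 v = mTensor p lam 1 (spechtRep F lam w v) := by
  rw [smul_mTensor, mul_one]
  exact (Submodule.Quotient.eq _).2 (Submodule.subset_span (Or.inl ⟨w, v, rfl⟩))

theorem hy_smul_mTensor_one (i : Fin n) (v : Specht F lam) :
    hy p i • mTensor p lam 1 v = 0 := by
  rw [smul_mTensor, mul_one]
  exact (Submodule.Quotient.mk_eq_zero _).2 (Submodule.subset_span (Or.inr ⟨i, v, rfl⟩))

/-- The universal property of induction: in the polynomial representation the constants form a copy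
of `S^λ` killed by every Dunkl operator, so the defining relations of `M(λ)` map to zero. -/
theorem exists_mMap : ∃ f : M p lam →ₗ[F] PolyMod F n (Specht F lam),
    (∀ h v, f (mTensor p lam h v) = polyRep p (spechtRep F lam) h (tm 1 v)) ∧
    ∀ h m, f (h • m) = polyRep p (spechtRep F lam) h (f m) := by
  let φ : H n p ⊗[F] Specht F lam →ₗ[F] PolyMod F n (Specht F lam) :=
    TensorProduct.lift (LinearMap.mk₂ F (fun h v => polyRep p (spechtRep F lam) h (tm 1 v))
      (fun h k v => by rw [map_add, LinearMap.add_apply])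
      (fun c h v => by rw [map_smul, LinearMap.smul_apply])
      (fun h u v => by rw [map_add, map_add])
      (fun c h v => by rw [map_smul, map_smul]))
  have hφ : ∀ h v, φ (h ⊗ₜ v) = polyRep p (spechtRep F lam) h (tm 1 v) := fun h v =>
    TensorProduct.lift.tmul _ _
  have hsmul : ∀ (h : H n p) z, φ (h • z) = polyRep p (spechtRep F lam) h (φ z) := by
    intro h z
    induction z using TensorProduct.induction_on with
    | zero => rw [smul_zero, map_zero, map_zero]
    | tmul k v =>
      rw [TensorProduct.smul_tmul', smul_eq_mul, hφ, hφ, map_mul, Module.End.mul_apply]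
    | add a b ha hb => rw [smul_add, map_add, map_add, map_add, ha, hb]
  let _ : Module (H n p) (PolyMod F n (Specht F lam)) :=
    Module.compHom _ (polyRep p (spechtRep F lam)).toRingHom
  let Ψ : H n p ⊗[F] Specht F lam →ₗ[H n p] PolyMod F n (Specht F lam) :=
    { toFun := φ, map_add' := map_add φ, map_smul' := hsmul }
  have hker : indSub p lam ≤ LinearMap.ker Ψ := by
    refine Submodule.span_le.2 ?_
    rintro _ (⟨w, v, rfl⟩ | ⟨i, v, rfl⟩)
    · change φ _ = 0
      rw [map_sub, hφ, hφ, polyRep_ht, opT_tm, map_one (polyAct F w), map_one (polyRep p _),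
        Module.End.one_apply, sub_eq_zero]
      rfl
    · change φ _ = 0
      rw [hφ, polyRep_hy, opY_tm_one]
  refine ⟨{ toFun := (indSub p lam).liftQ Ψ hker
            map_add' := fun u v => map_add ((indSub p lam).liftQ Ψ hker) u v
            map_smul' := fun c v => ?_ }, fun h v => hφ h v, fun h m => ?_⟩
  · obtain ⟨m, rfl⟩ := (indSub p lam).mkQ_surjective v
    exact map_smul φ c m
  · obtain ⟨m, rfl⟩ := (indSub p lam).mkQ_surjective m
    exact hsmul h m

/-- The map from `M(λ)` to the polynomial representation. -/
def mMap : M p lam →ₗ[F] PolyMod F n (Specht F lam) := (exists_mMap p lam).choose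

theorem mMap_mTensor (h : H n p) (v : Specht F lam) :
    mMap p lam (mTensor p lam h v) = polyRep p (spechtRep F lam) h (tm 1 v) :=
  (exists_mMap p lam).choose_spec.1 h v

theorem mMap_smul (h : H n p) (m : M p lam) :
    mMap p lam (h • m) = polyRep p (spechtRep F lam) h (mMap p lam m) :=
  (exists_mMap p lam).choose_spec.2 h m

open scoped IsMulCommutative in
theorem exists_polyHom : ∃ f : MvPolynomial (Fin n) F →ₐ[F] H n p,
    ∀ i, f (MvPolynomial.X i) = hx p i := by
  have hcomm : ∀ a ∈ Set.range (hx (n := n) p), ∀ b ∈ Set.range (hx (n := n) p), a * b = b * a := by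
    rintro _ ⟨i, rfl⟩ _ ⟨j, rfl⟩; exact hx_mul_hx p i j
  have _ := Algebra.isMulCommutative_adjoin F hcomm
  refine ⟨(Algebra.adjoin F (Set.range (hx (n := n) p))).val.comp
    (MvPolynomial.aeval fun i => ⟨hx p i, Algebra.subset_adjoin ⟨i, rfl⟩⟩), fun i => ?_⟩
  rw [AlgHom.comp_apply, MvPolynomial.aeval_X]
  rfl

/-- The inclusion of the polynomial ring in `ℍ`. -/
def polyHom : MvPolynomial (Fin n) F →ₐ[F] H n p := (exists_polyHom p).choose

theorem polyHom_X (i : Fin n) : polyHom p (MvPolynomial.X i) = hx p i :=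
  (exists_polyHom p).choose_spec i

theorem polyHom_mon (μ : Fin n → ℕ) : polyHom p (mon F μ) = hmon p μ := by
  rw [mon, ← List.prod_ofFn, map_list_prod, List.map_ofFn, hmon]
  congr 2
  funext i
  simp [polyHom_X]

theorem polyRep_polyHom {V : Type} [AddCommGroup V] [Module F V] (ρ : W r n →* Module.End F V)
    (f g : MvPolynomial (Fin n) F) (v : V) :
    polyRep p ρ (polyHom p f) (tm g v) = tm (f * g) v := by
  induction f using MvPolynomial.induction_on generalizing g with
  | C a =>
    rw [← MvPolynomial.algebraMap_eq, AlgHom.commutes, AlgHom.commutes,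
      Module.algebraMap_end_apply, ← Algebra.smul_def, map_smul, LinearMap.smul_apply]
  | add f h hf hh =>
    rw [map_add, map_add, LinearMap.add_apply, hf, hh, add_mul, map_add, LinearMap.add_apply]
  | mul_X f k hf =>
    rw [map_mul, map_mul, polyHom_X, polyRep_hx, Module.End.mul_apply, opX_tm, hf, mul_assoc]

/-- The map `f ⊗ v ↦ f ⊗ v` from the polynomial representation to `M(λ)`. -/
def mMapInv : PolyMod F n (Specht F lam) →ₗ[F] M p lam :=
  TensorProduct.lift (LinearMap.mk₂ F (fun f v => mTensor p lam (polyHom p f) v)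
      (fun f g v => by rw [map_add, mTensor_add_left])
      (fun c f v => by rw [map_smul, mTensor_smul_left])
      (fun f u v => mTensor_add_right p lam _ u v)
      (fun c f v => mTensor_smul_right p lam c _ v))

theorem mMapInv_tm (f : MvPolynomial (Fin n) F) (v : Specht F lam) :
    mMapInv p lam (tm f v) = mTensor p lam (polyHom p f) v :=
  TensorProduct.lift.tmul _ _

theorem mMap_mMapInv (z : PolyMod F n (Specht F lam)) : mMap p lam (mMapInv p lam z) = z := by
  suffices h : mMap p lam ∘ₗ mMapInv p lam = (1 : Module.End F _) from LinearMap.congr_fun h z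
  refine polyMod_end_ext fun f v => ?_
  rw [LinearMap.comp_apply, mMapInv_tm, mMap_mTensor, polyRep_polyHom, mul_one]
  rfl

theorem commElt_smul_eq (i k : Fin n) (m : M p lam) :
    commElt p (htHom p) i k • m = if i = k then p Param.kappa • m
      - ∑ l : ZMod r, (dFourier p l * (1 - zetaPow F (-l))) • ht p (diagRefl i l) • m
      - p Param.c0 • ∑ j ∈ Finset.univ.filter (· ≠ i), ∑ l : ZMod r, ht p (refl i j l) • m
    else p Param.c0 • ∑ l : ZMod r, zetaPow F (-l) • ht p (refl i k l) • m := by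
  unfold commElt
  split_ifs
  · simp only [sub_smul, smul_assoc, Finset.sum_smul, reflSum, algebraMap_smul]
    rfl
  · simp only [smul_assoc, Finset.sum_smul]
    rfl

theorem mMapInv_opX (k : Fin n) (z : PolyMod F n (Specht F lam)) :
    mMapInv p lam (opX k z) = hx p k • mMapInv p lam z := by
  suffices h : mMapInv p lam ∘ₗ opX k = Algebra.lsmul F F (M p lam) (hx p k) ∘ₗ mMapInv p lam from
    LinearMap.congr_fun h z
  refine polyMod_hom_ext fun f v => ?_
  change mMapInv p lam (tm (MvPolynomial.X k * f) v) = hx p k • mMapInv p lam (tm f v)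
  rw [mMapInv_tm, mMapInv_tm, smul_mTensor, map_mul, polyHom_X]

theorem ht_smul_mMapInv (w : W r n) (z : PolyMod F n (Specht F lam)) :
    ht p w • mMapInv p lam z ∈ LinearMap.range (mMapInv p lam) := by
  induction z using polyMod_induction with
  | h0 => rw [map_zero, smul_zero]; exact zero_mem _
  | h1 v =>
    rw [mMapInv_tm, map_one, ht_smul_mTensor_one]
    exact ⟨tm 1 _, by rw [mMapInv_tm, map_one]⟩
  | hX k z hz =>
    obtain ⟨u, hu⟩ := hz
    rw [mMapInv_opX, smul_smul, ← htHom_apply, ht_mul_hx, smul_assoc, mul_smul, htHom_apply, ← hu,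
      ← mMapInv_opX]
    exact Submodule.smul_mem _ _ ⟨_, rfl⟩
  | ha a b ha hb => rw [map_add, smul_add]; exact add_mem ha hb

theorem commElt_smul_mem {N : Submodule F (M p lam)} (hT : ∀ w : W r n, ∀ m ∈ N, ht p w • m ∈ N)
    (i k : Fin n) {m : M p lam} (hm : m ∈ N) : commElt p (htHom p) i k • m ∈ N := by
  rw [commElt_smul_eq]
  split_ifs
  · exact sub_mem (sub_mem (N.smul_mem _ hm) (sum_mem fun l _ => N.smul_mem _ (hT _ _ hm)))
      (N.smul_mem _ (sum_mem fun j _ => sum_mem fun l _ => hT _ _ hm))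
  · exact N.smul_mem _ (sum_mem fun l _ => N.smul_mem _ (hT _ _ hm))

theorem hy_smul_hx_smul (i k : Fin n) (m : M p lam) :
    hy p i • hx p k • m = hx p k • hy p i • m + commElt p (htHom p) i k • m := by
  rw [smul_smul, hy_mul_hx, add_smul, mul_smul]

theorem hy_smul_mMapInv (i : Fin n) (z : PolyMod F n (Specht F lam)) :
    hy p i • mMapInv p lam z ∈ LinearMap.range (mMapInv p lam) := by
  induction z using polyMod_induction with
  | h0 => rw [map_zero, smul_zero]; exact zero_mem _
  | h1 v => rw [mMapInv_tm, map_one, hy_smul_mTensor_one]; exact zero_mem _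
  | hX k z hz =>
    obtain ⟨u, hu⟩ := hz
    rw [mMapInv_opX, hy_smul_hx_smul, ← hu, ← mMapInv_opX]
    refine add_mem ⟨_, rfl⟩ (commElt_smul_mem p lam ?_ i k ⟨_, rfl⟩)
    rintro w _ ⟨x, rfl⟩
    exact ht_smul_mMapInv p lam w x
  | ha a b ha hb => rw [map_add, smul_add]; exact add_mem ha hb

/-- Induction over `ℍ`. -/
theorem H_induction {q : H n p → Prop} (hc : ∀ c, q (algebraMap F _ c)) (hX : ∀ i, q (hx p i))
    (hY : ∀ i, q (hy p i)) (hT : ∀ w, q (ht p w)) (hadd : ∀ a b, q a → q b → q (a + b))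
    (hmul : ∀ a b, q a → q b → q (a * b)) (h : H n p) : q h := by
  obtain ⟨a, rfl⟩ := RingQuot.mkAlgHom_surjective F (Rel n p) h
  induction a using FreeAlgebra.induction with
  | grade0 c => rw [AlgHom.commutes]; exact hc c
  | grade1 g =>
    cases g with
    | x i => exact hX i
    | y i => exact hY i
    | t w => exact hT w
  | add a b ha hb => rw [map_add]; exact hadd _ _ ha hb
  | mul a b ha hb => rw [map_mul]; exact hmul _ _ ha hb

/-- The spanning half of a Poincaré-Birkhoff-Witt theorem. The image contains the generating vectors
`1 ⊗ v`, and it is stable under `ℍ` because `t_w` and `y_i` can be moved past each `x_k` at the cost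
of group elements. -/
theorem mMapInv_surjective : Function.Surjective (mMapInv p lam) := by
  have key : ∀ (h : H n p) (z : PolyMod F n (Specht F lam)),
      h • mMapInv p lam z ∈ LinearMap.range (mMapInv p lam) := by
    intro h
    induction h using H_induction with
    | hc c => intro z; rw [algebraMap_smul, ← map_smul]; exact ⟨_, rfl⟩
    | hX i => intro z; rw [← mMapInv_opX]; exact ⟨_, rfl⟩
    | hY i => exact hy_smul_mMapInv p lam i
    | hT w => exact ht_smul_mMapInv p lam w
    | hadd a b ha hb => intro z; rw [add_smul]; exact add_mem (ha z) (hb z)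
    | hmul a b ha hb =>
      intro z
      obtain ⟨u, hu⟩ := hb z
      rw [mul_smul, ← hu]; exact ha u
  rw [← LinearMap.range_eq_top, eq_top_iff]
  rintro m -
  obtain ⟨z, rfl⟩ := (indSub p lam).mkQ_surjective m
  induction z using TensorProduct.induction_on with
  | zero => rw [map_zero]; exact zero_mem _
  | add a b ha hb => rw [map_add]; exact add_mem ha hb
  | tmul h v =>
    have := key h (tm 1 v)
    rw [mMapInv_tm, map_one, smul_mTensor, mul_one] at this
    exact this

/-- The standard module is isomorphic to the polynomial representation. -/
def mEquiv : M p lam ≃ₗ[F] PolyMod F n (Specht F lam) :=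
  (LinearEquiv.ofBijective (mMapInv p lam)
    ⟨Function.LeftInverse.injective (mMap_mMapInv p lam), mMapInv_surjective p lam⟩).symm

theorem mEquiv_apply (m : M p lam) : mEquiv p lam m = mMap p lam m := by
  obtain ⟨z, rfl⟩ := mMapInv_surjective p lam m
  rw [mMap_mMapInv]
  exact LinearEquiv.symm_apply_apply (LinearEquiv.ofBijective (mMapInv p lam) _) z

theorem mEquiv_smul (h : H n p) (m : M p lam) :
    mEquiv p lam (h • m) = polyRep p (spechtRep F lam) h (mEquiv p lam m) := by
  rw [mEquiv_apply, mEquiv_apply, mMap_smul]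

variable {lam}

theorem mEquiv_basisVec (a : (Fin n → ℕ) × SYT lam) : mEquiv p lam (basisVec p a) =
    tm (mon F a.1) (spechtRep F lam (permElt r (wPerm a.1))⁻¹ (vec F a.2)) := by
  have h : basisVec p a = mTensor p lam (hmon p a.1)
    (spechtRep F lam (permElt r (wPerm a.1))⁻¹ (vec F a.2)) := rfl
  rw [h, mEquiv_apply, mMap_mTensor, ← polyHom_mon, polyRep_polyHom, mul_one]

/-- The action of a group element as an automorphism. -/
def repEquiv {V : Type} [AddCommGroup V] [Module F V] (ρ : W r n →* Module.End F V)
    (w : W r n) : V ≃ₗ[F] V :=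
  LinearEquiv.ofLinearMap (ρ w) (ρ w⁻¹)
    (by rw [← Module.End.mul_eq_comp, ← map_mul, mul_inv_cancel, map_one]; rfl)
    (by rw [← Module.End.mul_eq_comp, ← map_mul, inv_mul_cancel, map_one]; rfl)

variable (lam) in
/-- The basis `x^μ v_T^μ` of `M(λ)`. -/
def jackBasis : Module.Basis ((Fin n → ℕ) × SYT lam) F (M p lam) :=
  (polyModBasis fun μ => (spechtBasis F lam).map
    (repEquiv (spechtRep F lam) (permElt r (wPerm μ))⁻¹)).map (mEquiv p lam).symm

theorem jackBasis_apply (a : (Fin n → ℕ) × SYT lam) : jackBasis p lam a = basisVec p a := by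
  rw [jackBasis, Module.Basis.map_apply, LinearEquiv.symm_apply_eq, mEquiv_basisVec,
    polyModBasis_apply, Module.Basis.map_apply, spechtBasis_apply]
  rfl

end Standard


/-! ### The order on compositions -/

section CompOrder

variable {n : ℕ}

theorem wPerm_lt_wPerm (μ : Fin n → ℕ) {i k : Fin n} :
    wPerm μ i < wPerm μ k ↔ (i < k ∧ μ i < μ k) ∨ (k < i ∧ μ i ≤ μ k) := by
  refine ⟨fun h => ?_, fun h => wFun_lt_wFun μ h⟩
  by_contra hc
  rcases eq_or_ne i k with rfl | hik
  · exact lt_irrefl _ h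
  · have : wPerm μ k < wPerm μ i := wFun_lt_wFun μ (by grind)
    exact lt_asymm h this

/-- The hypothesis says that `s` is increasing for the linear order that compares values first and
breaks ties by reversed position. Only one bijection onto `Fin n` is increasing, since the identity
is its only strictly monotone permutation. -/
theorem eq_wPerm {μ : Fin n → ℕ} {s : Equiv.Perm (Fin n)}
    (h : ∀ i k, (i < k ∧ μ i < μ k) ∨ (k < i ∧ μ i ≤ μ k) → s i < s k) : s = wPerm μ := by
  have hm : StrictMono (s * (wPerm μ)⁻¹) := fun i k hik =>
    h _ _ ((wPerm_lt_wPerm μ).1 (by simpa using hik))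
  have h1 : s * (wPerm μ)⁻¹ = 1 := by
    ext i
    have := (Subsingleton.elim (hm.orderIsoOfSurjective _ (Equiv.surjective _))
      (OrderIso.refl (Fin n)))
    exact congrArg Fin.val (DFunLike.congr_fun this i)
  exact mul_inv_eq_one.1 h1

theorem monotone_antiPart (μ : Fin n → ℕ) : Monotone (antiPart μ) := by
  intro i k hik
  rcases hik.eq_or_lt with rfl | hik
  · exact le_rfl
  · have := (wPerm_lt_wPerm μ (i := (wPerm μ)⁻¹ i) (k := (wPerm μ)⁻¹ k)).1 (by simpa using hik)
    unfold antiPart; omega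

theorem antitone_part (μ : Fin n → ℕ) : Antitone (part μ) := fun _ _ h =>
  monotone_antiPart μ (Fin.rev_le_rev.2 h)

theorem antiPart_comp (μ : Fin n → ℕ) (s : Equiv.Perm (Fin n)) : antiPart (μ ∘ s) = antiPart μ := by
  have h1 := monotone_antiPart (μ ∘ s)
  have h2 := monotone_antiPart μ
  exact Tuple.unique_monotone (f := μ) (σ := s * (wPerm (μ ∘ s))⁻¹) (τ := (wPerm μ)⁻¹) h1 h2

theorem part_comp (μ : Fin n → ℕ) (s : Equiv.Perm (Fin n)) : part (μ ∘ s) = part μ :=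
  funext fun i => by rw [part, part, antiPart_comp]

/-- The permutation that sorts `μ` into non-increasing order. -/
def partPerm (μ : Fin n → ℕ) : Equiv.Perm (Fin n) := Fin.revPerm.trans (wPerm μ)⁻¹

theorem part_eq (μ : Fin n → ℕ) (i : Fin n) : part μ i = μ (partPerm μ i) := rfl

theorem sum_part {A : Type*} [AddCommMonoid A] (μ : Fin n → ℕ) (f : ℕ → A) :
    ∑ i, f (part μ i) = ∑ i, f (μ i) :=
  Equiv.sum_comp (partPerm μ) fun i => f (μ i)

theorem sum_le_sum_Iic {f : Fin n → ℕ} (hf : Antitone f) {k : Fin n} {A : Finset (Fin n)}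
    (hA : A.card = (Finset.Iic k).card) : ∑ i ∈ A, f i ≤ ∑ i ∈ Finset.Iic k, f i := by
  have hc : (A \ Finset.Iic k).card = (Finset.Iic k \ A).card := by
    have h1 := Finset.card_sdiff_add_card_inter A (Finset.Iic k)
    have h2 := Finset.card_sdiff_add_card_inter (Finset.Iic k) A
    rw [Finset.inter_comm] at h2
    omega
  rw [← Finset.sum_sdiff (Finset.inter_subset_left (s₁ := A) (s₂ := Finset.Iic k)),
    ← Finset.sum_sdiff (Finset.inter_subset_right (s₁ := A) (s₂ := Finset.Iic k)),
    Finset.sdiff_inter_self_left, Finset.sdiff_inter_self_right]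
  gcongr 1
  calc ∑ i ∈ A \ Finset.Iic k, f i ≤ (A \ Finset.Iic k).card • f k :=
        Finset.sum_le_card_nsmul _ _ _ fun i hi => hf (by
          simp only [Finset.mem_sdiff, Finset.mem_Iic, not_le] at hi; exact hi.2.le)
    _ = (Finset.Iic k \ A).card • f k := by rw [hc]
    _ ≤ _ := Finset.card_nsmul_le_sum _ _ _ fun i hi => hf (by
          simp only [Finset.mem_sdiff, Finset.mem_Iic] at hi; exact hi.1)

/-- Partial sums of the sorted composition are maximal among sums over subsets of the same size.
Together with `exists_sum_eq_sum_part` this reduces dominance to a comparison of subset sums of the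
unsorted compositions. -/
theorem sum_le_sum_part (μ : Fin n → ℕ) {k : Fin n} {A : Finset (Fin n)}
    (hA : A.card = (Finset.Iic k).card) : ∑ i ∈ A, μ i ≤ ∑ i ∈ Finset.Iic k, part μ i := by
  have := sum_le_sum_Iic (antitone_part μ) (A := A.map (partPerm μ).symm.toEmbedding) (k := k)
    (by simpa using hA)
  simpa [part_eq] using this

theorem exists_sum_eq_sum_part (μ : Fin n → ℕ) (k : Fin n) :
    ∃ A : Finset (Fin n), A.card = (Finset.Iic k).card ∧
      ∑ i ∈ Finset.Iic k, part μ i = ∑ i ∈ A, μ i :=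
  ⟨(Finset.Iic k).map (partPerm μ).toEmbedding, Finset.card_map _, by simp [part_eq]⟩

theorem eq_of_sum_Iic_eq {f g : Fin n → ℕ}
    (h : ∀ k, ∑ i ∈ Finset.Iic k, f i = ∑ i ∈ Finset.Iic k, g i) : f = g := by
  funext k
  induction k using WellFoundedLT.induction with
  | ind k ih =>
    have h1 := h k
    have h2 : Finset.Iic k = insert k (Finset.Iio k) := by
      ext i; simp [le_iff_eq_or_lt]
    rw [h2, Finset.sum_insert (by simp), Finset.sum_insert (by simp),
      Finset.sum_congr rfl fun i hi => ih i (Finset.mem_Iio.1 hi)] at h1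
    exact Nat.add_right_cancel h1

theorem DomLT.trans {a b c : Fin n → ℕ} (h1 : DomLT a b) (h2 : DomLT b c) : DomLT a c := by
  refine ⟨?_, h1.2.1.trans h2.2.1, fun k => (h1.2.2 k).trans (h2.2.2 k)⟩
  rintro rfl
  exact h1.1 (eq_of_sum_Iic_eq fun k => le_antisymm (h1.2.2 k) (h2.2.2 k))

/-- The statistic `∑ i u(i)` decreases along the Bruhat order. -/
theorem BruhatLT.sum_lt {u v : Equiv.Perm (Fin n)} (h : BruhatLT u v) :
    ∑ i : Fin n, (i : ℤ) * (v i : ℤ) < ∑ i : Fin n, (i : ℤ) * (u i : ℤ) := by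
  have key : ∀ u v : Equiv.Perm (Fin n), (∃ i j, i < j ∧ u i < u j ∧ v = u * Equiv.swap i j) →
      ∑ i : Fin n, (i : ℤ) * (v i : ℤ) < ∑ i : Fin n, (i : ℤ) * (u i : ℤ) := by
    rintro u _ ⟨i, j, hij, hu, rfl⟩
    have hs : ∀ f : Fin n → ℤ, ∑ k, f k = f i + (f j + ∑ k ∈ (Finset.univ.erase i).erase j, f k) := by
      intro f
      rw [Finset.add_sum_erase _ _ (by simp [hij.ne']), Finset.add_sum_erase _ _ (by simp)]
    rw [hs, hs fun k => (k : ℤ) * (u k : ℤ)]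
    have h3 : ∑ k ∈ (Finset.univ.erase i).erase j, (k : ℤ) * (((u * Equiv.swap i j) k : Fin n) : ℤ)
        = ∑ k ∈ (Finset.univ.erase i).erase j, (k : ℤ) * (u k : ℤ) := by
      refine Finset.sum_congr rfl fun k hk => ?_
      simp only [Finset.mem_erase] at hk
      rw [Equiv.Perm.mul_apply, Equiv.swap_apply_of_ne_of_ne hk.2.1 hk.1]
    rw [h3]
    simp only [Equiv.Perm.mul_apply, Equiv.swap_apply_left, Equiv.swap_apply_right]
    have h1 : (i : ℤ) < j := by exact_mod_cast hij
    have h2 : (u i : ℤ) < u j := by exact_mod_cast hu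
    nlinarith
  induction h with
  | single h => exact key _ _ h
  | tail _ h ih => exact (key _ _ h).trans ih

theorem CompLT.irrefl (μ : Fin n → ℕ) : ¬ CompLT μ μ := by
  rintro (h | h)
  · exact h.1 rfl
  · exact lt_irrefl _ h.2.sum_lt

theorem CompLT.trans {a b c : Fin n → ℕ} (h1 : CompLT a b) (h2 : CompLT b c) : CompLT a c := by
  rcases h1 with h1 | ⟨h1, h1'⟩ <;> rcases h2 with h2 | ⟨h2, h2'⟩
  · exact Or.inl (h1.trans h2)
  · exact Or.inl (h2 ▸ h1)
  · exact Or.inl (h1 ▸ h2)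
  · exact Or.inr ⟨h1.trans h2, Relation.TransGen.trans h1' h2'⟩

theorem CompLT.sum_eq {a b : Fin n → ℕ} (h : CompLT a b) : ∑ i, a i = ∑ i, b i := by
  rw [← sum_part a fun x => x, ← sum_part b fun x => x]
  rcases h with h | h
  · exact h.2.1
  · rw [h.1]

theorem finite_compLT (μ : Fin n → ℕ) : {ν | CompLT ν μ}.Finite := by
  refine (Set.Finite.pi' (t := fun _ => Set.Iic (∑ i, μ i)) fun _ => Set.finite_Iic _).subset ?_
  intro ν hν i
  rw [Set.mem_Iic, ← CompLT.sum_eq hν]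
  exact Finset.single_le_sum (fun _ _ => Nat.zero_le _) (Finset.mem_univ i)

/-- If no entry strictly between the two positions equals one of the exchanged values, then `w_μ`
changes by exactly this transposition. Otherwise an equal entry in between splits the exchange into
two shorter ones. -/
theorem bruhatLT_wPerm_comp_swap (μ : Fin n → ℕ) {p q : Fin n} (hpq : p < q) (h : μ q < μ p) :
    BruhatLT (wPerm (μ ∘ Equiv.swap p q)) (wPerm μ) := by
  obtain ⟨N, hN⟩ : ∃ N : ℕ, (q : ℕ) - p = N := ⟨_, rfl⟩
  induction N using Nat.strong_induction_on generalizing μ p q with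
  | _ N ih =>
    by_cases h1 : ∃ m, p < m ∧ m < q ∧ (μ m = μ p ∨ μ m = μ q)
    · obtain ⟨m, hpm, hmq, hm⟩ := h1
      rcases hm with hm | hm
      · have e : μ ∘ Equiv.swap p q = (μ ∘ Equiv.swap m q) ∘ Equiv.swap p m := by
          funext k
          simp only [Function.comp_apply, Equiv.swap_apply_def]
          grind
        have a1 := ih (m - p) (by omega) (μ ∘ Equiv.swap m q) hpm (by
          simp [Equiv.swap_apply_of_ne_of_ne hpm.ne hpq.ne, h]) rfl
        have a2 := ih (q - m) (by omega) μ hmq (by omega) rfl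
        rw [e]
        exact Relation.TransGen.trans a1 a2
      · have e : μ ∘ Equiv.swap p q = (μ ∘ Equiv.swap p m) ∘ Equiv.swap m q := by
          funext k
          simp only [Function.comp_apply, Equiv.swap_apply_def]
          grind
        have a1 := ih (q - m) (by omega) (μ ∘ Equiv.swap p m) hmq (by
          simp [Equiv.swap_apply_of_ne_of_ne hpq.ne' hmq.ne', h]) rfl
        have a2 := ih (m - p) (by omega) μ hpm (by omega) rfl
        rw [e]
        exact Relation.TransGen.trans a1 a2
    · push Not at h1
      have e : wPerm (μ ∘ Equiv.swap p q) * Equiv.swap p q = wPerm μ := by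
        refine eq_wPerm fun i k hik => ?_
        rw [Equiv.Perm.mul_apply, Equiv.Perm.mul_apply, wPerm_lt_wPerm]
        simp only [Function.comp_apply, Equiv.swap_apply_self]
        have := h1 i
        have := h1 k
        simp only [Equiv.swap_apply_def]
        grind
      refine Relation.TransGen.single ⟨p, q, hpq, ?_, e.symm⟩
      rw [wPerm_lt_wPerm]
      simp [hpq, h]

theorem compLT_comp_swap (μ : Fin n → ℕ) {p q : Fin n} (hpq : p < q) (h : μ q < μ p) :
    CompLT (μ ∘ Equiv.swap p q) μ :=
  Or.inr ⟨part_comp μ _, bruhatLT_wPerm_comp_swap μ hpq h⟩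

/-- Moving two entries of a composition towards each other makes it smaller. -/
theorem compLT_of_between {μ ν : Fin n → ℕ} {i j : Fin n} (hij : i ≠ j)
    (hk : ∀ k, k ≠ i → k ≠ j → ν k = μ k) (hs : ν i + ν j = μ i + μ j)
    (h1 : ν i < max (μ i) (μ j)) (h2 : ν j < max (μ i) (μ j)) : CompLT ν μ := by
  classical
  have hsum : ∀ (A : Finset (Fin n)) (f : Fin n → ℕ), ∑ k ∈ A, f k =
      (if i ∈ A then f i else 0) + (if j ∈ A then f j else 0) +
        ∑ k ∈ (A.erase i).erase j, f k := by
    intro A f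
    by_cases hi : i ∈ A <;> by_cases hj : j ∈ A
    · rw [if_pos hi, if_pos hj, add_assoc, Finset.add_sum_erase _ _ (by simp [hj, hij.symm]),
        Finset.add_sum_erase _ _ hi]
    · rw [if_pos hi, if_neg hj, add_zero, Finset.erase_eq_of_notMem (a := j) (by simp [hj]),
        Finset.add_sum_erase _ _ hi]
    · rw [if_neg hi, if_pos hj, Finset.erase_eq_of_notMem hi, zero_add, Finset.add_sum_erase _ _ hj]
    · rw [if_neg hi, if_neg hj, Finset.erase_eq_of_notMem hi, Finset.erase_eq_of_notMem hj]; simp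
  have hrest : ∀ A : Finset (Fin n), ∑ k ∈ (A.erase i).erase j, ν k =
      ∑ k ∈ (A.erase i).erase j, μ k := fun A => Finset.sum_congr rfl fun k hk' => by
    simp only [Finset.mem_erase] at hk'
    exact hk k hk'.2.1 hk'.1
  refine Or.inl ⟨fun h => ?_, ?_, fun k => ?_⟩
  -- The sum of squares distinguishes the two sorted compositions, since it strictly decreases when
  -- two entries with fixed sum move inwards.
  · have := sum_part μ fun x => x * x
    rw [← h, sum_part ν fun x => x * x, hsum, hsum Finset.univ fun i => μ i * μ i] at this
    have h3 : ∑ k ∈ (Finset.univ.erase i).erase j, ν k * ν k =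
        ∑ k ∈ (Finset.univ.erase i).erase j, μ k * μ k := Finset.sum_congr rfl fun k hk' => by
      simp only [Finset.mem_erase] at hk'
      rw [hk k hk'.2.1 hk'.1]
    simp only [Finset.mem_univ, if_true, h3] at this
    rcases max_cases (μ i) (μ j) with ⟨hm, _⟩ | ⟨hm, _⟩ <;> rw [hm] at h1 h2 <;> nlinarith
  · rw [sum_part ν fun x => x, sum_part μ fun x => x, hsum, hsum Finset.univ μ, hrest]
    simp [hs]
  -- If `A` contains both or neither of `i`, `j`, its sum is unchanged. If it contains one, the new
  -- entry is below the larger old one, so `μ` on `A` or on `A` with `i` and `j` exchanged has at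
  -- least the same sum.
  · obtain ⟨A, hA, h⟩ := exists_sum_eq_sum_part ν k
    rw [h]
    have hswap : ∑ i ∈ A.map (Equiv.swap i j).toEmbedding, μ i ≤ ∑ i ∈ Finset.Iic k, part μ i :=
      sum_le_sum_part μ (by simpa using hA)
    have hself : ∑ i ∈ A, μ i ≤ ∑ i ∈ Finset.Iic k, part μ i := sum_le_sum_part μ hA
    rw [Finset.sum_map, hsum] at hswap
    rw [hsum] at hself ⊢
    rw [hrest]
    have h4 : ∑ k ∈ (A.erase i).erase j, μ ((Equiv.swap i j).toEmbedding k) =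
        ∑ k ∈ (A.erase i).erase j, μ k := Finset.sum_congr rfl fun k hk' => by
      simp only [Finset.mem_erase] at hk'
      exact congrArg μ (Equiv.swap_apply_of_ne_of_ne hk'.2.1 hk'.1)
    rw [h4] at hswap
    simp only [Equiv.coe_toEmbedding, Equiv.swap_apply_left, Equiv.swap_apply_right] at hswap
    split_ifs at * <;> omega

end CompOrder


/-! ### The commutative subalgebra `𝔱` -/

section Torus

variable {F : Type} [Field F] [Algebra ℂ F] {r n : ℕ} [NeZero r] (p : Param r → F)

theorem ht_mul_hy_mul_hx (w : W r n) (i : Fin n) : htHom p w * (hy p i * hx p i) =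
    hy p (w.right i) * hx p (w.right i) * htHom p w := by
  rw [← mul_assoc, ht_mul_hy, smul_mul_assoc, mul_assoc, ht_mul_hx, mul_smul_comm, smul_smul,
    zetaPow_mul_neg, one_smul, mul_assoc]

theorem sum_smul_refl_mul_hx (i j : Fin n) (hij : i ≠ j) :
    (∑ l : ZMod r, zetaPow F (-l) • htHom p (refl j i l)) * hx p j =
      hx p i * reflSum (htHom p) i j := by
  rw [reflSum_comm, reflSum, Finset.sum_mul, Finset.mul_sum]
  refine Finset.sum_congr rfl fun l _ => ?_
  rw [smul_mul_assoc, ht_mul_hx, smul_smul, refl_right, Equiv.swap_apply_left, refl_left,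
    if_pos rfl, if_neg hij, zero_sub, neg_neg, zetaPow_neg_mul, one_smul]

theorem reflSum_mul_hy_mul_hx (i j k : Fin n) : reflSum (htHom p) i j * (hy p k * hx p k) =
    hy p (Equiv.swap i j k) * hx p (Equiv.swap i j k) * reflSum (htHom p) i j := by
  rw [reflSum, Finset.sum_mul, Finset.mul_sum]
  exact Finset.sum_congr rfl fun l _ => ht_mul_hy_mul_hx p _ _

theorem hy_hx_mul_hy_hx {i j : Fin n} (hij : i ≠ j) :
    hy p i * hx p i * (hy p j * hx p j) =
      hy p i * hy p j * (hx p i * hx p j) -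
        p Param.c0 • (hy p i * hx p i * reflSum (htHom p) i j) := by
  have h1 : hx p i * hy p j = hy p j * hx p i -
      p Param.c0 • ∑ l : ZMod r, zetaPow F (-l) • htHom p (refl j i l) := by
    rw [hy_mul_hx, commElt_of_ne _ _ hij.symm, add_sub_cancel_right]
  calc hy p i * hx p i * (hy p j * hx p j) = hy p i * (hx p i * hy p j) * hx p j := by
        simp only [mul_assoc]
    _ = _ := by
        rw [h1, mul_sub, sub_mul, mul_smul_comm, smul_mul_assoc,
          mul_assoc (hy p i) (Finset.sum _ _), sum_smul_refl_mul_hx p i j hij]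
        simp only [mul_assoc]

/-- Moving `x_i` past `y_j` in `y_i x_i y_j x_j` leaves a term symmetric in `i` and `j`, so only the
reflection terms contribute to the commutator. -/
theorem hy_hx_commutator {i j : Fin n} (hij : i ≠ j) :
    hy p i * hx p i * (hy p j * hx p j) - hy p j * hx p j * (hy p i * hx p i) =
      p Param.c0 • ((hy p j * hx p j - hy p i * hx p i) * reflSum (htHom p) i j) := by
  rw [hy_hx_mul_hy_hx p hij, hy_hx_mul_hy_hx p hij.symm, hy_mul_hy p j i, hx_mul_hx p j i,
    reflSum_comm _ j i, sub_mul, smul_sub]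
  abel

theorem hz_eq (i : Fin n) : hz p i = hy p i * hx p i + p Param.c0 • jm (htHom p) i := rfl

theorem jm_mul_hy_hx {i j : Fin n} (hij : i < j) :
    jm (htHom p) i * (hy p j * hx p j) = hy p j * hx p j * jm (htHom p) i := by
  rw [jm_eq, Finset.sum_mul, Finset.mul_sum]
  refine Finset.sum_congr rfl fun k hk => ?_
  simp only [Finset.mem_filter, Finset.mem_univ, true_and] at hk
  rw [reflSum_mul_hy_mul_hx, Equiv.swap_apply_of_ne_of_ne hij.ne' (hk.trans hij).ne']

theorem hy_hx_mul_jm {i j : Fin n} (hij : i < j) :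
    hy p i * hx p i * jm (htHom p) j - jm (htHom p) j * (hy p i * hx p i) =
      (hy p i * hx p i - hy p j * hx p j) * reflSum (htHom p) i j := by
  rw [jm_eq, Finset.sum_mul, Finset.mul_sum, ← Finset.sum_sub_distrib]
  rw [Finset.sum_eq_single i]
  · rw [reflSum_mul_hy_mul_hx, Equiv.swap_apply_right, sub_mul, reflSum_comm _ j i]
  · intro k hk hki
    rw [reflSum_mul_hy_mul_hx, Equiv.swap_apply_of_ne_of_ne hij.ne (Ne.symm hki), sub_self]
  · intro h; simp [hij] at h

theorem jm_mul_jm {i j : Fin n} (hij : i < j) :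
    jm (htHom p) i * jm (htHom p) j = jm (htHom (n := n) p) j * jm (htHom p) i := by
  rw [jm_eq _ i, Finset.sum_mul, Finset.mul_sum]
  refine Finset.sum_congr rfl fun k hk => ?_
  simp only [Finset.mem_filter, Finset.mem_univ, true_and] at hk
  rw [reflSum, Finset.sum_mul, Finset.mul_sum]
  refine Finset.sum_congr rfl fun l _ => mul_jm_of_lt _ _ _ ?_ fun m => ?_
  · rw [refl_right, Equiv.swap_apply_of_ne_of_ne hij.ne' (hk.trans hij).ne']
  · rw [refl_right, Equiv.swap_apply_def]
    split_ifs <;> grind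

/-- The Jucys-Murphy terms are chosen to repair commutativity: for `i < j` the commutator of `y_i
x_i` with `c_0 φ_j` is opposite to that of `y_i x_i` with `y_j x_j`, and the other mixed pairs
commute. -/
theorem hz_mul_hz (i j : Fin n) : hz p i * hz p j = hz p j * hz p i := by
  have key : ∀ i j : Fin n, i < j → hz p i * hz p j = hz p j * hz p i := by
    intro i j hij
    have h1 := hy_hx_commutator p hij.ne
    have h2 := hy_hx_mul_jm p hij
    have h3 := jm_mul_hy_hx p hij
    have h4 := jm_mul_jm p hij
    rw [← sub_eq_zero]
    simp only [hz_eq, mul_add, add_mul, mul_smul_comm, smul_mul_assoc, smul_add, h3, h4]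
    have h5 : p Param.c0 • (hy p i * hx p i * jm (htHom p) j) -
        p Param.c0 • (jm (htHom p) j * (hy p i * hx p i)) = p Param.c0 •
          ((hy p i * hx p i - hy p j * hx p j) * reflSum (htHom p) i j) := by
      rw [← smul_sub, h2]
    rw [sub_mul, smul_sub] at h5 h1
    linear_combination (norm := abel) h1 + h5
  rcases lt_trichotomy i j with h | rfl | h
  · exact key i j h
  · rfl
  · exact (key j i h).symm

theorem ht_zeta_mul_hz (i j : Fin n) :
    ht p (zetaElt r i) * hz p j = hz p j * ht p (zetaElt r i) := by
  have h2 : htHom p (zetaElt r i) * (hy p j * hx p j) = _ := ht_mul_hy_mul_hx p (zetaElt r i) j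
  have h3 : htHom p (zetaElt r i) * jm (htHom p) j = _ :=
    mul_jm_of_lt (htHom p) (zetaElt r i) j rfl fun _ => Iff.rfl
  change htHom p (zetaElt r i) * _ = _ * htHom p (zetaElt r i)
  rw [hz_eq, mul_add, add_mul, h2, mul_smul_comm, h3, smul_mul_assoc]
  rfl

theorem ht_zeta_mul_ht_zeta (i j : Fin n) :
    ht p (zetaElt r i) * ht p (zetaElt r j) = ht p (zetaElt r j) * ht p (zetaElt r i) := by
  change htHom p (zetaElt r i) * htHom p (zetaElt r j) = htHom p _ * htHom p _
  rw [← map_mul, ← map_mul, zetaElt_eq, zetaElt_eq, diagRefl_comm]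

theorem isMulCommutative_tAlg : IsMulCommutative (tAlg n p) := by
  refine Algebra.isMulCommutative_adjoin F ?_
  rintro _ (⟨i, rfl⟩ | ⟨i, rfl⟩) _ (⟨j, rfl⟩ | ⟨j, rfl⟩)
  · exact hz_mul_hz p i j
  · exact (ht_zeta_mul_hz p j i).symm
  · exact ht_zeta_mul_hz p i j
  · exact ht_zeta_mul_ht_zeta p i j

theorem hz_mem_tAlg (i : Fin n) : hz p i ∈ tAlg n p :=
  Algebra.subset_adjoin (Or.inl ⟨i, rfl⟩)

theorem ht_zeta_mem_tAlg (i : Fin n) : ht p (zetaElt r i) ∈ tAlg n p :=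
  Algebra.subset_adjoin (Or.inr ⟨i, rfl⟩)

theorem piElt_mem_tAlg (i j : Fin n) : piElt (htHom p) i j ∈ tAlg n p := by
  rw [piElt_eq]
  refine sum_mem fun l _ => ?_
  have h : ∀ (i : Fin n) (l : ZMod r), htHom p (diagRefl i l) ∈ tAlg n p := fun i l => by
    have := zetaElt_pow (r := r) i l.val
    rw [ZMod.natCast_val, ZMod.cast_id] at this
    rw [← this, map_pow]
    exact pow_mem (ht_zeta_mem_tAlg p i) _
  rw [map_mul]
  exact mul_mem (h _ _) (h _ _)

/-- The relation between `t_{s_i}` and `z_i`, `z_{i+1}`. -/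
theorem ht_swap_mul_hz {i j : Fin n} (hij : (i : ℕ) + 1 = j) :
    htHom p (permElt r (Equiv.swap i j)) * hz p i =
      hz p j * htHom p (permElt r (Equiv.swap i j)) - p Param.c0 • piElt (htHom p) i j := by
  set s := htHom p (permElt r (Equiv.swap i j)) with hs
  have h0 : s * s = 1 := permElt_swap_mul_self _ i j
  have h1 : s * (hy p i * hx p i) = hy p j * hx p j * s := by
    rw [hs, ht_mul_hy_mul_hx, permElt_right, Equiv.swap_apply_left]
  have h2 : jm (htHom p) j * s = s * jm (htHom p) i + piElt (htHom p) i j := by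
    have h3 : s * piElt (htHom p) i j = reflSum (htHom p) i j := permElt_mul_piElt _ i j
    have h4 : s * reflSum (htHom p) i j = reflSum (htHom p) i j * s := by
      rw [hs, mul_reflSum, permElt_right, Equiv.swap_apply_left, Equiv.swap_apply_right,
        reflSum_comm]
    rw [jm_succ (htHom p) hij, add_mul, ← h4, ← h3, mul_assoc, ← hs, h0, ← mul_assoc, h0, one_mul,
      mul_one]
  rw [hz_eq, hz_eq, mul_add, add_mul, mul_smul_comm, smul_mul_assoc, h1, h2, smul_add]
  abel

end Torus

set_option linter.unusedSectionVars false

/-! ### Triangularity of the action of `𝔱` -/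

section LowerPoly

variable {F : Type} [Field F] {n : ℕ}

/-- The span of the monomials `x^ν` with `ν < μ`. -/
def lowerPoly (F : Type) [Field F] {n : ℕ} (μ : Fin n → ℕ) :
    Submodule F (MvPolynomial (Fin n) F) :=
  Submodule.span F (mon F '' {ν | CompLT ν μ})

/-- The part of `x^μ` without the variables `x_i` and `x_j`. -/
def monRest (F : Type) [Field F] {n : ℕ} (μ : Fin n → ℕ) (i j : Fin n) :
    MvPolynomial (Fin n) F :=
  ∏ k ∈ (Finset.univ.erase i).erase j, MvPolynomial.X k ^ μ k

theorem mon_eq_mul_monRest {μ ν : Fin n → ℕ} {i j : Fin n} (hij : i ≠ j)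
    (h : ∀ k, k ≠ i → k ≠ j → ν k = μ k) :
    mon F ν = MvPolynomial.X i ^ ν i * MvPolynomial.X j ^ ν j * monRest F μ i j := by
  have h1 : monRest F μ i j = monRest F ν i j := Finset.prod_congr rfl fun k hk => by
    simp only [Finset.mem_erase] at hk
    rw [h k hk.2.1 hk.1]
  rw [h1, mon, monRest, mul_assoc,
    Finset.mul_prod_erase _ (fun k => MvPolynomial.X k ^ ν k) (by simp [hij.symm]),
    Finset.mul_prod_erase _ (fun k => MvPolynomial.X k ^ ν k) (Finset.mem_univ i)]

theorem mul_monRest_eq_mon (μ : Fin n → ℕ) {i j : Fin n} (hij : i ≠ j) (a b : ℕ) :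
    MvPolynomial.X i ^ a * MvPolynomial.X j ^ b * monRest F μ i j =
      mon F (Function.update (Function.update μ i a) j b) := by
  rw [mon_eq_mul_monRest (μ := μ) hij fun k h1 h2 => by simp [h1, h2]]
  simp [hij]

theorem mul_monRest_mem_lowerPoly (μ : Fin n → ℕ) {i j : Fin n} (hij : i ≠ j) {a b : ℕ}
    (hs : a + b = μ i + μ j) (h1 : a < max (μ i) (μ j)) (h2 : b < max (μ i) (μ j)) :
    MvPolynomial.X i ^ a * MvPolynomial.X j ^ b * monRest F μ i j ∈ lowerPoly F μ := by
  rw [mul_monRest_eq_mon μ hij]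
  exact Submodule.subset_span ⟨_, compLT_of_between hij (fun k h1 h2 => by simp [h1, h2])
    (by simp [hij, hs]) (by simp [hij, h1]) (by simp [h2]), rfl⟩

theorem mon_comp_swap (μ : Fin n → ℕ) {i j : Fin n} (hij : i ≠ j) :
    mon F (μ ∘ Equiv.swap i j) =
      MvPolynomial.X i ^ μ j * MvPolynomial.X j ^ μ i * monRest F μ i j := by
  rw [mon_eq_mul_monRest (μ := μ) hij fun k h1 h2 => by
    simp [Equiv.swap_apply_of_ne_of_ne h1 h2]]
  simp

theorem mul_monRest_swap_mem_lowerPoly (μ : Fin n → ℕ) {i j : Fin n}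
    (h : (i < j ∧ μ j < μ i) ∨ (j < i ∧ μ i < μ j)) :
    MvPolynomial.X i ^ μ j * MvPolynomial.X j ^ μ i * monRest F μ i j ∈ lowerPoly F μ := by
  have hij : i ≠ j := by grind
  rw [← mon_comp_swap μ hij]
  refine Submodule.subset_span ⟨_, ?_, rfl⟩
  rcases h with ⟨h1, h2⟩ | ⟨h1, h2⟩
  · exact compLT_comp_swap μ h1 h2
  · rw [Equiv.swap_comm]; exact compLT_comp_swap μ h1 h2

variable [Algebra ℂ F] {r : ℕ} [NeZero r]

theorem polyAct_refl_mul_monRest (μ : Fin n → ℕ) {i j : Fin n} (hij : i ≠ j) (l : ZMod r)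
    (a b : ℕ) :
    polyAct F (refl i j l) (MvPolynomial.X i ^ a * MvPolynomial.X j ^ b * monRest F μ i j) =
      MvPolynomial.C (zetaPow F l) ^ a * MvPolynomial.C (zetaPow F (-l)) ^ b *
        (MvPolynomial.X i ^ b * MvPolynomial.X j ^ a * monRest F μ i j) := by
  have h1 : polyAct F (refl i j l) (monRest F μ i j) = monRest F μ i j := by
    rw [monRest, map_prod]
    refine Finset.prod_congr rfl fun k hk => ?_
    simp only [Finset.mem_erase] at hk
    rw [map_pow, polyAct_X, refl_right, Equiv.swap_apply_of_ne_of_ne hk.2.1 hk.1, refl_left,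
      if_neg hk.1, if_neg hk.2.1]
    simp
  rw [map_mul, map_mul, map_pow, map_pow, h1, polyAct_X, polyAct_X, refl_right,
    Equiv.swap_apply_left, Equiv.swap_apply_right, refl_left, refl_left, if_pos rfl,
    if_pos rfl, if_neg hij, if_neg hij.symm, zero_sub, neg_neg, sub_zero, mul_pow, mul_pow]
  ring

theorem C_zetaPow_mul (l : ZMod r) :
    (MvPolynomial.C (zetaPow F l) * MvPolynomial.C (zetaPow F (-l)) : MvPolynomial (Fin n) F) = 1 := by
  rw [← map_mul, zetaPow_mul_neg, map_one]

theorem reflDiff_eq {i j : Fin n} (hij : i ≠ j) {l : ZMod r} {f g : MvPolynomial (Fin n) F}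
    (h : reflRoot F i j l * g = f - polyAct F (refl i j l) f) : reflDiff F i j l f = g :=
  mul_left_cancel₀ (reflRoot_ne_zero F hij l) ((reflRoot_mul_reflDiff F hij l f).trans h.symm)

theorem reflRoot_mul_geom (i j : Fin n) (l : ZMod r) (d : ℕ) :
    reflRoot F i j l * (∑ s ∈ Finset.range d, MvPolynomial.X i ^ s *
      (MvPolynomial.C (zetaPow F l) * MvPolynomial.X j) ^ (d - 1 - s)) =
      MvPolynomial.X i ^ d - (MvPolynomial.C (zetaPow F l) * MvPolynomial.X j) ^ d :=
  (Commute.all _ _).mul_geom_sum₂ d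

/-- A geometric sum. Its monomials interpolate between the two ends, so the inner ones are lower in
dominance and only the end terms require attention. -/
theorem reflDiff_of_ge (μ : Fin n → ℕ) {i j : Fin n} (hij : i ≠ j) (l : ZMod r) (b d : ℕ) :
    reflDiff F i j l (MvPolynomial.X i ^ (b + d) * MvPolynomial.X j ^ b * monRest F μ i j) =
      ∑ s ∈ Finset.range d, zetaPow F l ^ (d - 1 - s) •
        (MvPolynomial.X i ^ (b + s) * MvPolynomial.X j ^ (b + (d - 1 - s)) * monRest F μ i j) := by
  apply reflDiff_eq hij
  have h : ∑ s ∈ Finset.range d, zetaPow F l ^ (d - 1 - s) •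
      (MvPolynomial.X i ^ (b + s) * MvPolynomial.X j ^ (b + (d - 1 - s)) * monRest F μ i j) =
      (∑ s ∈ Finset.range d, MvPolynomial.X i ^ s *
        (MvPolynomial.C (zetaPow F l) * MvPolynomial.X j) ^ (d - 1 - s)) *
      ((MvPolynomial.X i * MvPolynomial.X j) ^ b * monRest F μ i j) := by
    rw [Finset.sum_mul]
    refine Finset.sum_congr rfl fun s _ => ?_
    rw [MvPolynomial.smul_eq_C_mul, map_pow]
    ring
  rw [h, ← mul_assoc, reflRoot_mul_geom, polyAct_refl_mul_monRest μ hij]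
  have h1 := congrArg (· ^ b) (C_zetaPow_mul (n := n) (F := F) l)
  simp only [one_pow, mul_pow] at h1
  linear_combination (MvPolynomial.X i ^ b * MvPolynomial.X j ^ (b + d) * monRest F μ i j *
    MvPolynomial.C (zetaPow F l) ^ d) * h1

theorem reflDiff_of_le (μ : Fin n → ℕ) {i j : Fin n} (hij : i ≠ j) (l : ZMod r) (a d : ℕ) :
    reflDiff F i j l (MvPolynomial.X i ^ a * MvPolynomial.X j ^ (a + d) * monRest F μ i j) =
      ∑ s ∈ Finset.range d, (-zetaPow F (-l) ^ d * zetaPow F l ^ (d - 1 - s)) •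
        (MvPolynomial.X i ^ (a + s) * MvPolynomial.X j ^ (a + (d - 1 - s)) * monRest F μ i j) := by
  apply reflDiff_eq hij
  have h : ∑ s ∈ Finset.range d, (-zetaPow F (-l) ^ d * zetaPow F l ^ (d - 1 - s)) •
      (MvPolynomial.X i ^ (a + s) * MvPolynomial.X j ^ (a + (d - 1 - s)) * monRest F μ i j) =
      (∑ s ∈ Finset.range d, MvPolynomial.X i ^ s *
        (MvPolynomial.C (zetaPow F l) * MvPolynomial.X j) ^ (d - 1 - s)) *
      ((MvPolynomial.X i * MvPolynomial.X j) ^ a * (-MvPolynomial.C (zetaPow F (-l)) ^ d) *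
        monRest F μ i j) := by
    rw [Finset.sum_mul]
    refine Finset.sum_congr rfl fun s _ => ?_
    rw [MvPolynomial.smul_eq_C_mul, map_mul, map_neg, map_pow, map_pow]
    ring
  rw [h, ← mul_assoc, reflRoot_mul_geom, polyAct_refl_mul_monRest μ hij]
  have h1 := congrArg (· ^ a) (C_zetaPow_mul (n := n) (F := F) l)
  have h2 := congrArg (· ^ d) (C_zetaPow_mul (n := n) (F := F) l)
  simp only [one_pow, mul_pow] at h1 h2
  linear_combination (MvPolynomial.X i ^ (a + d) * MvPolynomial.X j ^ a * monRest F μ i j *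
    MvPolynomial.C (zetaPow F (-l)) ^ d) * h1 + (MvPolynomial.X i ^ a * MvPolynomial.X j ^ (a + d) *
    monRest F μ i j) * h2

/-- The leading term of the divided difference attached to a reflection. -/
theorem reflDiff_sub_mem_lowerPoly (μ : Fin n → ℕ) {i j : Fin n} (hij : i ≠ j) (l : ZMod r) :
    reflDiff F i j l (MvPolynomial.X i * mon F μ) -
      (if j < i then polyAct F (refl i j l) (mon F μ) else 0) -
      (if wPerm μ j < wPerm μ i then mon F μ else 0) ∈ lowerPoly F μ := by
  have hμ : mon F μ = _ := mon_eq_mul_monRest hij fun _ _ _ => rfl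
  have hX : MvPolynomial.X i * mon F μ =
      MvPolynomial.X i ^ (μ i + 1) * MvPolynomial.X j ^ μ j * monRest F μ i j := by
    rw [hμ]; ring
  have hs : polyAct F (refl i j l) (mon F μ) = (zetaPow F l ^ μ i * zetaPow F (-l) ^ μ j) •
      (MvPolynomial.X i ^ μ j * MvPolynomial.X j ^ μ i * monRest F μ i j) := by
    rw [hμ, polyAct_refl_mul_monRest μ hij, MvPolynomial.smul_eq_C_mul, map_mul, map_pow, map_pow]
  rw [hX]
  simp only [wPerm_lt_wPerm]
  rcases lt_trichotomy (μ i) (μ j) with h | h | h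
  -- For `μ_i < μ_j` all exponents of the geometric sum lie strictly below `μ_j`, so the divided
  -- difference has no leading term. The reflected monomial, subtracted when `j < i`, is lower in
  -- Bruhat order.
  · obtain ⟨d, hd⟩ := Nat.exists_eq_add_of_lt h
    rw [if_neg (c := (j < i ∧ _) ∨ _) (by omega), sub_zero]
    refine sub_mem ?_ ?_
    · rw [hd, show μ i + d + 1 = μ i + 1 + d by ring, reflDiff_of_le μ hij]
      refine sum_mem fun s hs => Submodule.smul_mem _ _ (mul_monRest_mem_lowerPoly μ hij ?_ ?_ ?_) <;>
      · rw [Finset.mem_range] at hs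
        omega
    · split_ifs with hji
      · rw [hs]
        exact Submodule.smul_mem _ _ (mul_monRest_swap_mem_lowerPoly μ (Or.inr ⟨hji, h⟩))
      · exact zero_mem _
  -- For equal parts the divided difference is `x^μ`, which the reflection fixes, and exactly one of
  -- the two subtracted terms is present.
  · have h1 : reflDiff F i j l (MvPolynomial.X i ^ (μ i + 1) * MvPolynomial.X j ^ μ j *
        monRest F μ i j) = mon F μ := by
      rw [← h, reflDiff_of_ge μ hij, Finset.sum_range_one, hμ]
      simp [h]
    have h2 : polyAct F (refl i j l) (mon F μ) = mon F μ := by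
      rw [hs, ← h, ← mul_pow, zetaPow_mul_neg, one_pow, one_smul, hμ, h]
    rw [h1, h2]
    rcases lt_or_gt_of_ne hij with h3 | h3
    · rw [if_neg h3.not_gt, if_pos (by omega)]; simp
    · rw [if_pos h3, if_neg (by omega)]; simp
  -- For `μ_i > μ_j` the two end terms of the sum are `x^μ` and the reflected monomial. The latter
  -- is lower when `i < j`; when `j < i` it must be subtracted, and in `z_i` this subtraction is
  -- made by `c_0 φ_i`.
  · obtain ⟨d, hd⟩ := Nat.exists_eq_add_of_lt h
    have h1 : reflDiff F i j l (MvPolynomial.X i ^ (μ i + 1) * MvPolynomial.X j ^ μ j *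
        monRest F μ i j) - mon F μ - polyAct F (refl i j l) (mon F μ) ∈ lowerPoly F μ := by
      have e2 : zetaPow F l ^ μ i * zetaPow F (-l) ^ μ j = zetaPow F l ^ (d + 1) := by
        rw [hd, add_assoc, pow_add, mul_right_comm, ← mul_pow, zetaPow_mul_neg, one_pow, one_mul]
      rw [show μ i + 1 = μ j + (d + 2) by omega, reflDiff_of_ge μ hij,
        Finset.sum_range_succ, Finset.sum_range_succ', hs, e2, hμ]
      have e3 : ∀ A B C : MvPolynomial (Fin n) F, A + B + C - C - B = A := fun A B C => by ring
      have e4 : d + 2 - 1 - 0 = d + 1 := rfl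
      have e5 : d + 2 - 1 - (d + 1) = 0 := by omega
      rw [e5, e4, add_zero, pow_zero, one_smul, ← add_assoc (μ j) d 1, ← hd, e3]
      refine sum_mem fun s hs => Submodule.smul_mem _ _ (mul_monRest_mem_lowerPoly μ hij ?_ ?_ ?_) <;>
      · rw [Finset.mem_range] at hs
        omega
    rcases lt_or_gt_of_ne hij with h3 | h3
    · rw [if_neg h3.not_gt, if_pos (by omega), sub_zero]
      have h4 : polyAct F (refl i j l) (mon F μ) ∈ lowerPoly F μ := by
        rw [hs]
        exact Submodule.smul_mem _ _ (mul_monRest_swap_mem_lowerPoly μ (Or.inl ⟨h3, h⟩))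
      simpa using add_mem h1 h4
    · rw [if_pos h3, if_pos (by omega), sub_right_comm]
      exact h1

theorem polyAct_diagRefl_mon (i : Fin n) (l : ZMod r) (μ : Fin n → ℕ) :
    polyAct F (diagRefl i l) (mon F μ) = zetaPow F (-((μ i : ZMod r) * l)) • mon F μ := by
  rw [mon, map_prod, MvPolynomial.smul_eq_C_mul]
  have h : ∀ k, polyAct F (diagRefl i l) (MvPolynomial.X k ^ μ k) =
      (if k = i then MvPolynomial.C (zetaPow F (-((μ i : ZMod r) * l))) else 1) *
        MvPolynomial.X k ^ μ k := by
    intro k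
    rw [map_pow, polyAct_X, mul_pow, diagRefl_right, Equiv.Perm.one_apply, diagRefl_left]
    split_ifs with h
    · subst h; rw [← map_pow, ← zetaPow_nsmul, mul_neg]
    · simp
  rw [Finset.prod_congr rfl fun k _ => h k, Finset.prod_mul_distrib]
  simp

theorem diagDiff_X_mul_mon (i : Fin n) (l : ZMod r) (μ : Fin n → ℕ) :
    diagDiff F i l (MvPolynomial.X i * mon F μ) =
      (1 - zetaPow F (-(((μ i : ZMod r) + 1) * l))) • mon F μ := by
  refine mul_left_cancel₀ (MvPolynomial.X_ne_zero i) ?_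
  rw [X_mul_diagDiff, map_mul, polyAct_diagRefl_mon, polyAct_X, diagRefl_right,
    Equiv.Perm.one_apply, diagRefl_left, if_pos rfl, add_mul, neg_add, zetaPow_add, one_mul,
    MvPolynomial.smul_eq_C_mul, MvPolynomial.smul_eq_C_mul, map_sub, map_one, map_mul]
  ring

theorem pderiv_X_mul_mon (i : Fin n) (μ : Fin n → ℕ) :
    MvPolynomial.pderiv i (MvPolynomial.X i * mon F μ) = ((μ i : F) + 1) • mon F μ := by
  have h : MvPolynomial.X i * MvPolynomial.pderiv i (mon F μ) = (μ i : F) • mon F μ := by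
    rw [mon_eq, MvPolynomial.X_mul_pderiv_monomial, Nat.cast_smul_eq_nsmul]
    rfl
  rw [Derivation.leibniz, MvPolynomial.pderiv_X_self, smul_eq_mul, h, add_smul, one_smul,
    smul_eq_mul, mul_one]

end LowerPoly

/-! ### Leading terms of the `z_i` on `F[x] ⊗ V` -/

section Triangular

variable {F : Type} [Field F] [Algebra ℂ F] {r n : ℕ} [NeZero r] (p : Param r → F)
  {V : Type} [AddCommGroup V] [Module F V] (ρ : W r n →* Module.End F V)

/-- The span of the `x^ν ⊗ v` with `ν < μ`. -/
def lowerMod (F : Type) [Field F] (V : Type) [AddCommGroup V] [Module F V] {n : ℕ}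
    (μ : Fin n → ℕ) : Submodule F (PolyMod F n V) :=
  Submodule.span F {z | ∃ ν v, CompLT ν μ ∧ z = tm (mon F ν) v}

theorem tm_mem_lowerMod {μ : Fin n → ℕ} {f : MvPolynomial (Fin n) F} (hf : f ∈ lowerPoly F μ)
    (v : V) : tm f v ∈ lowerMod F V μ := by
  induction hf using Submodule.span_induction with
  | mem f hf =>
    obtain ⟨ν, hν, rfl⟩ := hf
    exact Submodule.subset_span ⟨ν, v, hν, rfl⟩
  | zero => rw [map_zero, LinearMap.zero_apply]; exact zero_mem _
  | add f g _ _ hf hg => rw [map_add, LinearMap.add_apply]; exact add_mem hf hg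
  | smul c f _ hf => rw [map_smul, LinearMap.smul_apply]; exact Submodule.smul_mem _ _ hf

theorem polyRep_hz (i : Fin n) (μ : Fin n → ℕ) (v : V) :
    polyRep p ρ (hz p i) (tm (mon F μ) v) =
      opY ρ p i (tm (MvPolynomial.X i * mon F μ) v) + p Param.c0 •
        ∑ j ∈ Finset.univ.filter (· < i), ∑ l : ZMod r,
          tm (polyAct F (refl i j l) (mon F μ)) (ρ (refl i j l) v) := by
  rw [hz_eq, map_add, map_mul, map_smul, polyRep_hy, polyRep_hx, LinearMap.add_apply,
    Module.End.mul_apply, opX_tm, LinearMap.smul_apply, jm_eq, map_sum, LinearMap.sum_apply]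
  simp only [reflSum, map_sum, LinearMap.sum_apply]
  congr 2
  refine Finset.sum_congr rfl fun j _ => Finset.sum_congr rfl fun l _ => ?_
  rw [htHom_apply, polyRep_ht, opT_tm]

/-- The derivative and the diagonal reflections preserve `x^μ`. Among the other reflections, `φ_i`
cancels the reflected monomials that are not lower, and those surviving on `x^μ` are indexed by the
`j` sorted before `i` by `w_μ`. -/
theorem polyRep_hz_sub_mem (i : Fin n) (μ : Fin n → ℕ) (v : V) :
    polyRep p ρ (hz p i) (tm (mon F μ) v) -
      tm (mon F μ) ((p Param.kappa * (μ i + 1)) • v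
        - ∑ l : ZMod r, (dFourier p l * (1 - zetaPow F (-(((μ i : ZMod r) + 1) * l)))) •
            ρ (diagRefl i l) v
        - p Param.c0 • ∑ j ∈ Finset.univ.filter (fun j => wPerm μ j < wPerm μ i),
            reflSum ρ i j v) ∈ lowerMod F V μ := by
  have hw : Finset.univ.filter (fun j => wPerm μ j < wPerm μ i) =
      (Finset.univ.filter (· ≠ i)).filter (fun j => wPerm μ j < wPerm μ i) := by
    ext j
    simp only [Finset.mem_filter, Finset.mem_univ, true_and, iff_and_self]
    rintro h rfl; exact lt_irrefl _ h
  have hl : Finset.univ.filter (fun j => j < i) =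
      (Finset.univ.filter (· ≠ i)).filter (fun j => j < i) := by
    ext j
    simp only [Finset.mem_filter, Finset.mem_univ, true_and, iff_and_self]
    rintro h rfl; exact lt_irrefl _ h
  have key : -(p Param.c0 • ∑ j ∈ Finset.univ.filter (· ≠ i), ∑ l : ZMod r,
      tm (reflDiff F i j l (MvPolynomial.X i * mon F μ) -
        (if j < i then polyAct F (refl i j l) (mon F μ) else 0) -
        (if wPerm μ j < wPerm μ i then mon F μ else 0)) (ρ (refl i j l) v)) ∈ lowerMod F V μ := by
    refine neg_mem (Submodule.smul_mem _ _ (sum_mem fun j hj => sum_mem fun l _ =>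
      tm_mem_lowerMod (reflDiff_sub_mem_lowerPoly μ ?_ l) _))
    simp only [Finset.mem_filter, Finset.mem_univ, true_and] at hj
    exact hj.symm
  convert key using 1
  rw [polyRep_hz, opY_tm, pderiv_X_mul_mon, hw, hl, Finset.sum_filter (fun j => j < i),
    Finset.sum_filter (fun j => wPerm μ j < wPerm μ i)]
  simp only [diagDiff_X_mul_mon, map_sub, map_smul, LinearMap.sub_apply, LinearMap.smul_apply,
    map_sum, smul_smul, Finset.sum_sub_distrib, smul_sub, reflSum, LinearMap.sum_apply]
  have h1 : ∀ (q : Fin n → Prop) [DecidablePred q] (f : ZMod r → Fin n → MvPolynomial (Fin n) F),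
      ∑ j ∈ Finset.univ.filter (· ≠ i), ∑ l : ZMod r,
        tm (if q j then f l j else 0) (ρ (refl i j l) v) =
      ∑ j ∈ Finset.univ.filter (· ≠ i), if q j then ∑ l : ZMod r,
        tm (f l j) (ρ (refl i j l) v) else 0 := by
    intro q _ f
    refine Finset.sum_congr rfl fun j _ => ?_
    split_ifs
    · rfl
    · simp
  rw [h1, h1]
  have h2 : ∑ j ∈ Finset.univ.filter (· ≠ i), tm (mon F μ) (if wPerm μ j < wPerm μ i then
      ∑ l : ZMod r, ρ (refl i j l) v else 0) = ∑ j ∈ Finset.univ.filter (· ≠ i),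
      if wPerm μ j < wPerm μ i then ∑ l : ZMod r, tm (mon F μ) (ρ (refl i j l) v) else 0 := by
    refine Finset.sum_congr rfl fun j _ => ?_
    split_ifs
    · rw [map_sum]
    · rw [map_zero]
  rw [h2]
  abel

end Triangular


/-! ### Weights of the basis vectors -/

section Weights

variable {F : Type} [Field F] [Algebra ℂ F] {r n : ℕ} [NeZero r] (p : Param r → F)

theorem sum_dFourier_mul (b : ZMod r) : ∑ l : ZMod r, dFourier p l * zetaPow F (l * b) = dPar p b := by
  have h : ∀ l : ZMod r, dFourier p l * zetaPow F (l * b) =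
      (1 / (r : F)) * ∑ j : ZMod r, dPar p j * zetaPow F (l * (b - j)) := by
    intro l
    rw [dFourier, mul_assoc, Finset.sum_mul]
    congr 1
    refine Finset.sum_congr rfl fun j _ => ?_
    rw [mul_assoc, ← zetaPow_add]
    congr 2; ring
  rw [Finset.sum_congr rfl fun l _ => h l, ← Finset.mul_sum, Finset.sum_comm]
  simp only [← Finset.mul_sum, sum_zetaPow_mul, sub_eq_zero, mul_ite, mul_zero]
  rw [Finset.sum_ite_eq, if_pos (Finset.mem_univ _)]
  have := natCast_ne_zero_of_neZero F r
  field_simp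

theorem sum_dFourier_mul_sub (m b : ZMod r) :
    ∑ l : ZMod r, (dFourier p l * (1 - zetaPow F (-(m * l)))) * zetaPow F (l * b) =
      dPar p b - dPar p (b - m) := by
  rw [← sum_dFourier_mul p b, ← sum_dFourier_mul p (b - m), ← Finset.sum_sub_distrib]
  refine Finset.sum_congr rfl fun l _ => ?_
  rw [show l * (b - m) = -(m * l) + l * b by ring, zetaPow_add]
  ring

variable {lam : RPartition r n}

/-- The eigenvalue of `z_i` on the leading term `x^μ v_T^μ`. -/
def zWeight (μ : Fin n → ℕ) (T : SYT lam) (i : Fin n) : F :=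
  p Param.kappa * (μ i + 1) -
    (dPar p (beta (T.box (wPerm μ i))) -
      dPar p (beta (T.box (wPerm μ i)) - ((μ i : ZMod r) + 1))) -
    p Param.c0 * ((r : F) * (ct (T.box (wPerm μ i)) : F))

theorem spechtRep_diagRefl_inv_vec (s : Equiv.Perm (Fin n)) (i : Fin n) (l : ZMod r) (T : SYT lam) :
    spechtRep F lam (diagRefl i l) (spechtRep F lam (permElt r s)⁻¹ (vec F T)) =
      zetaPow F (l * beta (T.box (s i))) • spechtRep F lam (permElt r s)⁻¹ (vec F T) := by
  have h : (permElt r s)⁻¹ * diagRefl (s i) l = diagRefl i l * (permElt r s)⁻¹ := by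
    have := mul_diagRefl (permElt r s)⁻¹ (s i) l
    simpa using this
  rw [← Module.End.mul_apply, ← map_mul, ← h, map_mul, Module.End.mul_apply,
    spechtRep_diagRefl_vec, map_smul]

/-- The sum is the conjugate by `s⁻¹` of the Jucys-Murphy element at `s(i)`. With `s = w_μ` it
explains the twist in `v_T^μ = t_{w_μ}⁻¹.v_T`: this vector diagonalizes the leading coefficient of
every `z_i`. -/
theorem sum_reflSum_spechtRep_inv_vec (s : Equiv.Perm (Fin n)) (i : Fin n) (T : SYT lam) :
    ∑ j ∈ Finset.univ.filter (fun j => s j < s i),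
      reflSum (spechtRep F lam) i j (spechtRep F lam (permElt r s)⁻¹ (vec F T)) =
      ((r : F) * (ct (T.box (s i)) : F)) • spechtRep F lam (permElt r s)⁻¹ (vec F T) := by
  rw [← map_smul, ← jm_spechtRep_vec, jm_eq, LinearMap.sum_apply, map_sum]
  refine Finset.sum_equiv s (by simp) fun j _ => ?_
  have h := mul_reflSum (spechtRep F lam) (permElt r s)⁻¹ (s i) (s j)
  rw [← Module.End.mul_apply, ← Module.End.mul_apply, h]
  simp

/-- The span of the basis vectors `x^ν v_S^ν` with `ν < μ`. -/
def lowerSpan (lam : RPartition r n) (μ : Fin n → ℕ) : Submodule F (M p lam) :=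
  Submodule.span F {m | ∃ (ν : Fin n → ℕ) (S : SYT lam), CompLT ν μ ∧ m = basisVec p (ν, S)}

theorem mem_lowerSpan {μ : Fin n → ℕ} {m : M p lam}
    (hm : mEquiv p lam m ∈ lowerMod F (Specht F lam) μ) : m ∈ lowerSpan p lam μ := by
  suffices h : ∀ z ∈ lowerMod F (Specht F lam) μ, (mEquiv p lam).symm z ∈ lowerSpan p lam μ by
    simpa using h _ hm
  intro z hz
  induction hz using Submodule.span_induction with
  | mem z hz =>
    obtain ⟨ν, v, hν, rfl⟩ := hz
    let f : Specht F lam →ₗ[F] M p lam := (mEquiv p lam).symm.toLinearMap ∘ₗ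
      tm (mon F ν) ∘ₗ spechtRep F lam (permElt r (wPerm ν))⁻¹
    have hf : ∀ u, f u ∈ lowerSpan p lam μ := by
      intro u
      have h1 : Submodule.span F (Set.range (vec F (lam := lam))) ≤
          (lowerSpan p lam μ).comap f := by
        rw [Submodule.span_le]
        rintro _ ⟨S, rfl⟩
        refine Submodule.subset_span ⟨ν, S, hν, ?_⟩
        change (mEquiv p lam).symm _ = _
        rw [LinearEquiv.symm_apply_eq, mEquiv_basisVec]
        rfl
      exact h1 (by rw [span_vec]; trivial)
    have h2 := hf (spechtRep F lam (permElt r (wPerm ν)) v)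
    have h3 : f (spechtRep F lam (permElt r (wPerm ν)) v) =
        (mEquiv p lam).symm (tm (mon F ν) v) := by
      change (mEquiv p lam).symm (tm (mon F ν) (spechtRep F lam (permElt r (wPerm ν))⁻¹
        (spechtRep F lam (permElt r (wPerm ν)) v))) = _
      rw [← Module.End.mul_apply, ← map_mul, inv_mul_cancel, map_one]
      rfl
    rwa [h3] at h2
  | zero => rw [map_zero]; exact zero_mem _
  | add f g _ _ hf hg => rw [map_add]; exact add_mem hf hg
  | smul c f _ hf => rw [map_smul]; exact Submodule.smul_mem _ _ hf

theorem hz_smul_basisVec (μ : Fin n → ℕ) (T : SYT lam) (i : Fin n) :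
    hz p i • basisVec p (μ, T) - zWeight p μ T i • basisVec p (μ, T) ∈ lowerSpan p lam μ := by
  apply mem_lowerSpan
  have h := polyRep_hz_sub_mem p (spechtRep F lam) i μ
    (spechtRep F lam (permElt r (wPerm μ))⁻¹ (vec F T))
  rw [map_sub, mEquiv_smul, map_smul, mEquiv_basisVec, ← map_smul (tm _)]
  convert h using 3
  rw [sum_reflSum_spechtRep_inv_vec]
  simp only [spechtRep_diagRefl_inv_vec, smul_smul]
  rw [← Finset.sum_smul, sum_dFourier_mul_sub, ← sub_smul, ← sub_smul]
  rfl

theorem ht_diagRefl_smul_basisVec (μ : Fin n → ℕ) (T : SYT lam) (i : Fin n) (l : ZMod r) :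
    ht p (diagRefl i l) • basisVec p (μ, T) =
      zetaPow F (l * (beta (T.box (wPerm μ i)) - (μ i : ZMod r))) • basisVec p (μ, T) := by
  apply (mEquiv p lam).injective
  rw [mEquiv_smul, map_smul, mEquiv_basisVec, polyRep_ht, opT_tm, polyAct_diagRefl_mon,
    spechtRep_diagRefl_inv_vec, map_smul, map_smul, LinearMap.smul_apply, smul_smul, ← zetaPow_add]
  congr 2; ring

end Weights

theorem wt_eq {r n : ℕ} [NeZero r] {lam : RPartition r n} (c0 : ℂ) (d : {j : ZMod r // j ≠ 0} → ℂ)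
    (μ : Fin n → ℕ) (T : SYT lam) (i : Fin n) : wt c0 d μ T i =
      (zWeight (point c0 d) μ T i, zetaPow ℂ (beta (T.box (wPerm μ i)) - (μ i : ZMod r))) := by
  rw [wt, zWeight]
  simp only [point]
  congr 1
  rw [sub_sub (beta _), one_mul, mul_assoc]


set_option linter.unusedSectionVars false

/-! ### Commuting operators that are triangular in a basis -/

section Triangular

variable {K V I : Type} [Field K] [AddCommGroup V] [Module K V] [PartialOrder I]
  (b : Module.Basis I K V)

/-- The span of the basis vectors below `a`. -/
def lowerOf (a : I) : Submodule K V := Submodule.span K (b '' Set.Iio a)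

theorem lowerOf_mono {a c : I} (h : c ≤ a) : lowerOf b c ≤ lowerOf b a :=
  Submodule.span_mono (Set.image_mono (Set.Iio_subset_Iio h))

theorem basis_mem_lowerOf {a c : I} (h : c < a) : b c ∈ lowerOf b a :=
  Submodule.subset_span ⟨c, h, rfl⟩

theorem repr_eq_zero_of_mem_lowerOf {a c : I} {m : V} (hm : m ∈ lowerOf b a) (h : ¬ c < a) :
    b.repr m c = 0 := by
  induction hm using Submodule.span_induction with
  | mem m hm =>
    obtain ⟨e, he, rfl⟩ := hm
    rw [Module.Basis.repr_self, Finsupp.single_eq_of_ne]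
    rintro rfl; exact h he
  | zero => simp
  | add x y _ _ hx hy => simp [hx, hy]
  | smul c x _ hx => simp [hx]

theorem lowerOf_induction (hfin : ∀ a : I, (Set.Iio a).Finite) {q : I → Prop}
    (h : ∀ a, (∀ c, c < a → q c) → q a) (a : I) : q a := by
  have hwf : WellFounded ((· < ·) : I → I → Prop) := by
    refine Subrelation.wf (r := InvImage (· < ·) fun a => (Set.Iio a).ncard) ?_
      (InvImage.wf _ wellFounded_lt)
    intro c a hca
    exact Set.ncard_lt_ncard (Set.Iio_ssubset_Iio hca) (hfin a)
  exact hwf.induction a h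

theorem linearIndependent_of_unitriangular {f : I → V} (hf : ∀ a, f a - b a ∈ lowerOf b a) :
    LinearIndependent K f := by
  classical
  rw [linearIndependent_iff']
  intro s g hg
  by_contra! hc
  obtain ⟨i, hi, hgi⟩ := hc
  -- At a maximal index of the support no other term can contribute to the coordinate.
  obtain ⟨a, ha⟩ := (s.filter (g · ≠ 0)).exists_maximal ⟨i, by simp [hi, hgi]⟩
  have has := Finset.mem_filter.1 ha.1
  refine has.2 ?_
  have h1 : b.repr (∑ c ∈ s, g c • f c) a = g a := by
    rw [map_sum, Finset.sum_apply', Finset.sum_eq_single a]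
    · have h2 := repr_eq_zero_of_mem_lowerOf b (hf a) (lt_irrefl a)
      rw [map_sub, Finsupp.sub_apply, sub_eq_zero, Module.Basis.repr_self,
        Finsupp.single_eq_same] at h2
      rw [map_smul, Finsupp.smul_apply, h2, smul_eq_mul, mul_one]
    · intro c hc hca
      rw [map_smul, Finsupp.smul_apply, smul_eq_mul]
      by_cases hgc : g c = 0
      · rw [hgc, zero_mul]
      · have h3 : ¬ a < c := fun h => (ha.2 (Finset.mem_filter.2 ⟨hc, hgc⟩) h.le).not_gt h
        have h2 := repr_eq_zero_of_mem_lowerOf b (hf c) h3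
        rw [map_sub, Finsupp.sub_apply, sub_eq_zero, Module.Basis.repr_self,
          Finsupp.single_eq_of_ne (Ne.symm hca)] at h2
        rw [h2, mul_zero]
    · intro h; exact absurd has.1 h
  rw [← h1, hg]; simp

theorem span_of_unitriangular (hfin : ∀ a : I, (Set.Iio a).Finite) {f : I → V}
    (hf : ∀ a, f a - b a ∈ lowerOf b a) : Submodule.span K (Set.range f) = ⊤ := by
  have h : ∀ a, b a ∈ Submodule.span K (Set.range f) := by
    intro a
    induction a using lowerOf_induction hfin with
    | h a ih =>
      have h1 : lowerOf b a ≤ Submodule.span K (Set.range f) := by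
        rw [lowerOf, Submodule.span_le]
        rintro _ ⟨c, hc, rfl⟩
        exact ih c hc
      have h2 := sub_mem (Submodule.subset_span ⟨a, rfl⟩ : f a ∈ Submodule.span K (Set.range f))
        (h1 (hf a))
      simpa using h2
  rw [eq_top_iff, ← b.span_eq, Submodule.span_le]
  rintro _ ⟨a, rfl⟩
  exact h a

/-- A family that is unitriangular with respect to a basis is a basis. -/
def unitriBasis (hfin : ∀ a : I, (Set.Iio a).Finite) {f : I → V}
    (hf : ∀ a, f a - b a ∈ lowerOf b a) : Module.Basis I K V :=
  Module.Basis.mk (linearIndependent_of_unitriangular b hf) (span_of_unitriangular b hfin hf).ge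

theorem unitriBasis_apply (hfin : ∀ a : I, (Set.Iio a).Finite) {f : I → V}
    (hf : ∀ a, f a - b a ∈ lowerOf b a) (a : I) : unitriBasis b hfin hf a = f a :=
  Module.Basis.mk_apply _ _ _

variable {A : Type} [CommRing A] [Algebra K A] [Module A V] [IsScalarTower K A V]
  (χ : I → A →ₐ[K] K)

/-- A Cayley-Hamilton argument: the factor at `a` sends `b a` below `a`, and the remaining factors
kill everything there by induction. The test element at each index can be chosen freely, which
`pow_smul_weightProj` exploits. -/
theorem prod_smul_eq_zero (hχ : ∀ a g, g • b a - χ a g • b a ∈ lowerOf b a)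
    (hfin : ∀ a : I, (Set.Iio a).Finite) (h : I → A) (a : I) :
    ∀ s : Finset I, (∀ c, c ≤ a → c ∈ s) →
      (∏ c ∈ s, (h c - algebraMap K A (χ c (h c)))) • b a = 0 := by
  classical
  induction a using lowerOf_induction hfin with
  | h a ih =>
    intro s hs
    have h1 : (∏ c ∈ s, (h c - algebraMap K A (χ c (h c)))) =
        (∏ c ∈ s.erase a, (h c - algebraMap K A (χ c (h c)))) *
          (h a - algebraMap K A (χ a (h a))) := (Finset.prod_erase_mul _ _ (hs a le_rfl)).symm
    rw [h1, mul_smul, sub_smul, algebraMap_smul]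
    have h2 := hχ a (h a)
    have h3 : lowerOf b a ≤ LinearMap.ker (Algebra.lsmul K K V
        (∏ c ∈ s.erase a, (h c - algebraMap K A (χ c (h c))))) := by
      rw [lowerOf, Submodule.span_le]
      rintro _ ⟨c, hc, rfl⟩
      refine ih c hc _ fun e he => Finset.mem_erase.2 ⟨?_, hs e (he.trans (le_of_lt hc))⟩
      rintro rfl; exact lt_irrefl _ (lt_of_le_of_lt he hc)
    exact h3 h2

open Classical in
/-- The element that projects `b a` to its weight space, by removing the other weights below `a`. -/
def weightProj (a : I) (hfin : (Set.Iio a).Finite) (h : I → A) : A :=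
  ∏ c ∈ hfin.toFinset.filter (fun c => χ c ≠ χ a), (h c - algebraMap K A (χ c (h c)))

open Classical in
-- In the vanishing product the test element is `g` at indices of the same weight as `a`, and a
-- given `h c` at the others. The first kind collects to a power of `g - χ_a(g)`, and the second
-- kind is the projector.
theorem pow_smul_weightProj (hχ : ∀ a g, g • b a - χ a g • b a ∈ lowerOf b a)
    (hfin : ∀ a : I, (Set.Iio a).Finite) (a : I) (h : I → A) (g : A) :
    (g - algebraMap K A (χ a g)) ^ (((hfin a).toFinset.filter (fun c => χ c = χ a)).card + 1) •
      weightProj χ a (hfin a) h • b a = 0 := by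
  have h1 := prod_smul_eq_zero b χ hχ hfin (fun c => if χ c = χ a then g else h c) a
    (insert a (hfin a).toFinset) (fun c hc => by
      rcases hc.eq_or_lt with rfl | hc <;> simp [*])
  rw [smul_smul, ← h1, weightProj]
  congr 1
  rw [Finset.prod_insert (by simp), if_pos rfl,
    ← Finset.prod_filter_mul_prod_filter_not (hfin a).toFinset (fun c => χ c = χ a),
    pow_succ', mul_assoc]
  congr 2
  · rw [Finset.prod_congr rfl (g := fun _ => g - algebraMap K A (χ a g)), Finset.prod_const]
    intro c hc
    rw [Finset.mem_filter] at hc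
    rw [if_pos hc.2, hc.2]
  · refine Finset.prod_congr (by congr) fun c hc => ?_
    rw [Finset.mem_filter] at hc
    rw [if_neg hc.2]

theorem weight_weightProj (a : I) (hfin : (Set.Iio a).Finite) {h : I → A}
    (hh : ∀ c, χ c ≠ χ a → χ a (h c) ≠ χ c (h c)) : χ a (weightProj χ a hfin h) ≠ 0 := by
  classical
  rw [weightProj, map_prod]
  refine Finset.prod_ne_zero_iff.2 fun c hc => ?_
  rw [Finset.mem_filter] at hc
  rw [map_sub, AlgHom.commutes]
  exact sub_ne_zero.2 (hh c hc.2)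

theorem exists_separating (a : I) : ∃ h : I → A, ∀ c, χ c ≠ χ a → χ a (h c) ≠ χ c (h c) := by
  have : ∀ c, ∃ g, χ c ≠ χ a → χ a g ≠ χ c g := by
    intro c
    by_cases hc : χ c = χ a
    · exact ⟨0, fun h => absurd hc h⟩
    · obtain ⟨g, hg⟩ := DFunLike.ne_iff.1 hc
      exact ⟨g, fun _ => hg.symm⟩
  choose h hh using this
  exact ⟨h, hh⟩

/-- Every weight is afforded by a generalized eigenvector with the expected leading term. -/
theorem exists_generalized_eigenvector (hχ : ∀ a g, g • b a - χ a g • b a ∈ lowerOf b a)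
    (hfin : ∀ a : I, (Set.Iio a).Finite) (a : I) :
    ∃ u : V, u - b a ∈ lowerOf b a ∧ ∃ q : ℕ, 0 < q ∧
      ∀ g : A, (g - algebraMap K A (χ a g)) ^ q • u = 0 := by
  obtain ⟨h, hh⟩ := exists_separating χ a
  have h0 := weight_weightProj χ a (hfin a) hh
  set P := weightProj χ a (hfin a) h
  classical
  refine ⟨(χ a P)⁻¹ • P • b a, ?_, ((hfin a).toFinset.filter (fun c => χ c = χ a)).card + 1,
    Nat.succ_pos _, fun g => ?_⟩
  · have h1 := (lowerOf b a).smul_mem (χ a P)⁻¹ (hχ a P)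
    rwa [smul_sub, smul_smul, inv_mul_cancel₀ h0, one_smul] at h1
  · rw [smul_comm, pow_smul_weightProj b χ hχ hfin a h g, smul_zero]

/-- If the weights are distinct, then there is a basis of eigenvectors. -/
theorem exists_eigenvector (hχ : ∀ a g, g • b a - χ a g • b a ∈ lowerOf b a)
    (hfin : ∀ a : I, (Set.Iio a).Finite) (hinj : Function.Injective χ) (a : I) (h : I → A)
    (g : A) : g • weightProj χ a (hfin a) h • b a = χ a g • weightProj χ a (hfin a) h • b a := by
  classical
  have h1 := pow_smul_weightProj b χ hχ hfin a h g
  have h2 : (hfin a).toFinset.filter (fun c => χ c = χ a) = ∅ := by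
    ext c
    simp only [Finset.mem_filter, Set.Finite.mem_toFinset, Set.mem_Iio, Finset.notMem_empty,
      iff_false, not_and]
    intro hc hca
    exact hc.ne (hinj hca)
  rw [h2, Finset.card_empty, zero_add, pow_one, sub_smul, algebraMap_smul, sub_eq_zero] at h1
  exact h1

end Triangular

/-! ### The weights of the standard module -/

section Weight

variable {F : Type} [Field F] [Algebra ℂ F] {r n : ℕ} [NeZero r]

/-- The index set of the basis `x^μ v_T^μ`. -/
def JackIdx (lam : RPartition r n) : Type := (Fin n → ℕ) × SYT lam

instance (lam : RPartition r n) : PartialOrder (JackIdx lam) where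
  le a c := a = c ∨ CompLT a.1 c.1
  lt a c := CompLT a.1 c.1
  le_refl _ := Or.inl rfl
  le_trans a b c := by
    rintro (rfl | h1) (rfl | h2)
    · exact Or.inl rfl
    · exact Or.inr h2
    · exact Or.inr h1
    · exact Or.inr (h1.trans h2)
  lt_iff_le_not_ge a c := by
    refine ⟨fun h => ⟨Or.inr h, ?_⟩, ?_⟩
    · rintro (rfl | h2)
      · exact CompLT.irrefl _ h
      · exact CompLT.irrefl _ (h.trans h2)
    · rintro ⟨rfl | h1, h2⟩
      · exact absurd (Or.inl rfl) h2
      · exact h1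
  le_antisymm a c := by
    rintro (rfl | h1) (h2 | h2)
    · rfl
    · rfl
    · exact h2.symm
    · exact absurd (h1.trans h2) (CompLT.irrefl _)

theorem finite_Iio_jackIdx {lam : RPartition r n} (a : JackIdx lam) : (Set.Iio a).Finite :=
  ((finite_compLT a.1).prod (Set.finite_univ (α := SYT lam))).subset fun _ hc => ⟨hc, trivial⟩

variable (p : Param r → F) (lam : RPartition r n)

/-- The basis `x^μ v_T^μ` of `M(λ)`. -/
def jackB : Module.Basis (JackIdx lam) F (M p lam) := jackBasis p lam

variable {lam}

theorem jackB_apply (a : JackIdx lam) : jackB p lam a = basisVec p a := jackBasis_apply p a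

theorem lowerOf_jackB (a : JackIdx lam) : lowerOf (jackB p lam) a = lowerSpan p lam a.1 := by
  rw [lowerOf, lowerSpan]
  congr 1
  ext m
  constructor
  · rintro ⟨c, hc, rfl⟩
    exact ⟨c.1, c.2, hc, jackB_apply p c⟩
  · rintro ⟨ν, S, h, rfl⟩
    exact ⟨(ν, S), h, jackB_apply p _⟩

theorem hz_smul_jackB (a : JackIdx lam) (i : Fin n) :
    hz p i • jackB p lam a - zWeight p a.1 a.2 i • jackB p lam a ∈ lowerOf (jackB p lam) a := by
  rw [lowerOf_jackB, jackB_apply]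
  exact hz_smul_basisVec p a.1 a.2 i

/-- The eigenvalue of `t_{ζ_i}` on `x^μ v_T^μ`, as a residue modulo `r`. -/
def tWeight (μ : Fin n → ℕ) (T : SYT lam) (i : Fin n) : ZMod r :=
  beta (T.box (wPerm μ i)) - (μ i : ZMod r)

theorem ht_diagRefl_smul_jackB (a : JackIdx lam) (i : Fin n) (l : ZMod r) :
    ht p (diagRefl i l) • jackB p lam a = zetaPow F (l * tWeight a.1 a.2 i) • jackB p lam a := by
  rw [jackB_apply]
  exact ht_diagRefl_smul_basisVec p a.1 a.2 i l

theorem ht_zeta_smul_jackB (a : JackIdx lam) (i : Fin n) :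
    ht p (zetaElt r i) • jackB p lam a = zetaPow F (tWeight a.1 a.2 i) • jackB p lam a := by
  rw [zetaElt_eq, ht_diagRefl_smul_jackB, one_mul]

theorem smul_mem_lowerOf {g : H n p}
    (hg : ∀ a, ∃ s : F, g • jackB p lam a - s • jackB p lam a ∈ lowerOf (jackB p lam) a)
    {a : JackIdx lam} {m : M p lam} (hm : m ∈ lowerOf (jackB p lam) a) :
    g • m ∈ lowerOf (jackB p lam) a := by
  have h : lowerOf (jackB p lam) a ≤
      (lowerOf (jackB p lam) a).comap (Algebra.lsmul F F (M p lam) g) := by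
    nth_rewrite 1 [lowerOf]
    rw [Submodule.span_le]
    rintro _ ⟨c, hc, rfl⟩
    obtain ⟨s, hs⟩ := hg c
    have h1 := add_mem (lowerOf_mono (jackB p lam) (le_of_lt hc) hs)
      (Submodule.smul_mem _ s (basis_mem_lowerOf (jackB p lam) hc))
    rw [sub_add_cancel] at h1
    exact h1
  exact h hm

theorem tAlg_triangular {g : H n p} (hg : g ∈ tAlg n p) (a : JackIdx lam) :
    ∃ s : F, g • jackB p lam a - s • jackB p lam a ∈ lowerOf (jackB p lam) a := by
  induction hg using Algebra.adjoin_induction generalizing a with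
  | mem g hg =>
    rcases hg with ⟨i, rfl⟩ | ⟨i, rfl⟩
    · exact ⟨_, hz_smul_jackB p a i⟩
    · exact ⟨_, by rw [ht_zeta_smul_jackB, sub_self]; exact zero_mem _⟩
  | algebraMap c => exact ⟨c, by rw [algebraMap_smul, sub_self]; exact zero_mem _⟩
  | add g h _ _ hg hh =>
    obtain ⟨s, hs⟩ := hg a
    obtain ⟨t, ht⟩ := hh a
    exact ⟨s + t, by convert add_mem hs ht using 1; rw [add_smul, add_smul]; abel⟩
  | mul g h _ _ hg hh =>
    obtain ⟨s, hs⟩ := hg a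
    obtain ⟨t, ht⟩ := hh a
    refine ⟨t * s, ?_⟩
    have h1 := add_mem (smul_mem_lowerOf p hg ht) (Submodule.smul_mem _ t hs)
    convert h1 using 1
    rw [smul_sub, smul_sub, smul_smul, smul_smul, smul_comm t g]
    abel

theorem repr_smul_eq {g : H n p} {a : JackIdx lam} {s : F}
    (hs : g • jackB p lam a - s • jackB p lam a ∈ lowerOf (jackB p lam) a) :
    (jackB p lam).repr (g • jackB p lam a) a = s := by
  have h1 := repr_eq_zero_of_mem_lowerOf _ hs (lt_irrefl a)
  rwa [map_sub, map_smul _ s, Finsupp.sub_apply, Module.Basis.repr_self, Finsupp.smul_single,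
    Finsupp.single_eq_same, smul_eq_mul, mul_one, sub_eq_zero] at h1

theorem tAlg_smul_sub_mem {g : H n p} (hg : g ∈ tAlg n p) (a : JackIdx lam) :
    g • jackB p lam a - (jackB p lam).repr (g • jackB p lam a) a • jackB p lam a ∈
      lowerOf (jackB p lam) a := by
  obtain ⟨s, hs⟩ := tAlg_triangular p hg a
  rwa [repr_smul_eq p hs]

/-- The weight of the basis vector `x^μ v_T^μ`: its eigenvalues modulo lower terms. -/
def weight (a : JackIdx lam) : tAlg n p →ₐ[F] F where
  toFun g := (jackB p lam).repr ((g : H n p) • jackB p lam a) a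
  map_one' := repr_smul_eq p (by rw [OneMemClass.coe_one, one_smul, one_smul, sub_self]; exact zero_mem _)
  map_zero' := repr_smul_eq p (by
    rw [ZeroMemClass.coe_zero, zero_smul, zero_smul, sub_self]; exact zero_mem _)
  map_add' g h := by
    rw [Subalgebra.coe_add, add_smul, map_add, Finsupp.add_apply]
  map_mul' g h := by
    apply repr_smul_eq
    have hg := tAlg_smul_sub_mem p g.2 a
    have hh := tAlg_smul_sub_mem p h.2 a
    have h1 := add_mem (smul_mem_lowerOf p (tAlg_triangular p g.2) hh)
      (Submodule.smul_mem _ ((jackB p lam).repr ((h : H n p) • jackB p lam a) a) hg)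
    convert h1 using 1
    rw [smul_sub, smul_sub, smul_smul, Subalgebra.coe_mul, smul_smul, smul_comm _ (g : H n p),
      mul_comm]
    abel
  commutes' c := repr_smul_eq p (by
    rw [Subalgebra.coe_algebraMap, algebraMap_smul]
    exact (sub_self (c • jackB p lam a)).symm ▸ zero_mem _)

theorem weight_spec (a : JackIdx lam) (g : tAlg n p) :
    g • jackB p lam a - weight p a g • jackB p lam a ∈ lowerOf (jackB p lam) a :=
  tAlg_smul_sub_mem p g.2 a

theorem weight_hz (a : JackIdx lam) (i : Fin n) :
    weight p a ⟨hz p i, hz_mem_tAlg p i⟩ = zWeight p a.1 a.2 i :=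
  repr_smul_eq p (hz_smul_jackB p a i)

theorem weight_ht (a : JackIdx lam) (i : Fin n) :
    weight p a ⟨ht p (zetaElt r i), ht_zeta_mem_tAlg p i⟩ = zetaPow F (tWeight a.1 a.2 i) :=
  repr_smul_eq p (by rw [ht_zeta_smul_jackB, sub_self]; exact zero_mem _)

theorem tAlg_hom_ext {α α' : tAlg n p →ₐ[F] F}
    (hz : ∀ i, α ⟨hz p i, hz_mem_tAlg p i⟩ = α' ⟨RCA.hz p i, hz_mem_tAlg p i⟩)
    (ht : ∀ i, α ⟨ht p (zetaElt r i), ht_zeta_mem_tAlg p i⟩ =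
      α' ⟨RCA.ht p (zetaElt r i), ht_zeta_mem_tAlg p i⟩) : α = α' := by
  refine AlgHom.adjoin_ext ?_
  rintro _ (⟨i, rfl⟩ | ⟨i, rfl⟩)
  · exact hz i
  · exact ht i

theorem weight_eq_iff (a c : JackIdx lam) : weight p a = weight p c ↔
    ∀ i, zWeight p a.1 a.2 i = zWeight p c.1 c.2 i ∧ tWeight a.1 a.2 i = tWeight c.1 c.2 i := by
  refine ⟨fun h i => ?_, fun h => tAlg_hom_ext p (fun i => ?_) fun i => ?_⟩
  · rw [← weight_hz, ← weight_hz, h]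
    refine ⟨rfl, zetaPow_injective F ?_⟩
    rw [← weight_ht p, ← weight_ht p, h]
  · rw [weight_hz, weight_hz, (h i).1]
  · rw [weight_ht, weight_ht, (h i).2]

instance : IsMulCommutative (tAlg n p) := isMulCommutative_tAlg p

end Weight

/-! ### Weight spaces, eigenbases and distinct weights -/

section Eigenbasis

open scoped IsMulCommutative

variable {F : Type} [Field F] [Algebra ℂ F] {r n : ℕ} [NeZero r] (p : Param r → F)
  {lam : RPartition r n}

theorem exists_pseudoeigenvector (a : JackIdx lam) :
    ∃ u : M p lam, u - jackB p lam a ∈ lowerOf (jackB p lam) a ∧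
      u ∈ weightSpace p (M p lam) (weight p a) := by
  obtain ⟨u, hu, q, hq, h⟩ := exists_generalized_eigenvector (jackB p lam) (weight p)
    (weight_spec p) finite_Iio_jackIdx a
  exact ⟨u, hu, q, hq, h⟩

/-- Two indices of equal weight would put two generalized eigenvectors with different leading terms,
hence linearly independent ones, into one line. -/
theorem injective_weight_of_finrank
    (h : ∀ α : tAlg n p →ₐ[F] F, weightSpace p (M p lam) α ≠ ⊥ →
      Module.finrank F (weightSpace p (M p lam) α) = 1) :
    Function.Injective (weight p (lam := lam)) := by
  choose u hu hu' using exists_pseudoeigenvector p (lam := lam)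
  have hli := linearIndependent_of_unitriangular (jackB p lam) hu
  intro a c hac
  by_contra hne
  have ha := hu' a
  have hc := hu' c
  rw [← hac] at hc
  have h1 := h (weight p a) (fun hbot => hli.ne_zero a (by rw [hbot] at ha; exact ha))
  obtain ⟨v, hv0, hv⟩ := finrank_eq_one_iff'.1 h1
  obtain ⟨x, hx⟩ := hv ⟨u a, ha⟩
  obtain ⟨y, hy⟩ := hv ⟨u c, hc⟩
  have hx' : x • (v : M p lam) = u a := congrArg Subtype.val hx
  have hy' : y • (v : M p lam) = u c := congrArg Subtype.val hy
  have h2 := @hli (Finsupp.single a y) (Finsupp.single c x) (by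
    rw [Finsupp.linearCombination_single, Finsupp.linearCombination_single, ← hx', ← hy',
      smul_smul, smul_smul, mul_comm])
  have hx0 : x = 0 := by
    rcases (Finsupp.single_eq_single_iff _ _ _ _).1 h2 with h3 | h3
    · exact absurd h3.1 hne
    · exact h3.2
  rw [hx0, zero_smul] at hx'
  exact hli.ne_zero a hx'.symm

/-- The eigenvector attached to a separating family of elements of `𝔱`. -/
theorem exists_jackBasis (hinj : Function.Injective (weight p (lam := lam))) :
    ∃ f : Module.Basis (JackIdx lam) F (M p lam),
      ∀ a, ∀ g : tAlg n p, g • f a = weight p a g • f a := by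
  choose h hh using exists_separating (weight p (lam := lam))
  let f : JackIdx lam → M p lam := fun a =>
    (weight p a (weightProj (weight p) a (finite_Iio_jackIdx a) (h a)))⁻¹ •
      weightProj (weight p) a (finite_Iio_jackIdx a) (h a) • jackB p lam a
  have hf : ∀ a, f a - jackB p lam a ∈ lowerOf (jackB p lam) a := by
    intro a
    have h0 := weight_weightProj (weight p) a (finite_Iio_jackIdx a) (hh a)
    have h1 := (lowerOf (jackB p lam) a).smul_mem
      (weight p a (weightProj (weight p) a (finite_Iio_jackIdx a) (h a)))⁻¹
      (weight_spec p a (weightProj (weight p) a (finite_Iio_jackIdx a) (h a)))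
    rwa [smul_sub, smul_smul, inv_mul_cancel₀ h0, one_smul] at h1
  refine ⟨unitriBasis (jackB p lam) finite_Iio_jackIdx hf, fun a g => ?_⟩
  rw [unitriBasis_apply]
  change g • _ • _ = _ • _ • _
  rw [smul_comm g, exists_eigenvector (jackB p lam) (weight p) (weight_spec p) finite_Iio_jackIdx
    hinj a (h a) g, smul_comm]

variable {p}

theorem repr_smul_of_eigen {f : Module.Basis (JackIdx lam) F (M p lam)}
    (hf : ∀ a, ∀ g : tAlg n p, g • f a = weight p a g • f a) (g : tAlg n p) (m : M p lam)
    (c : JackIdx lam) : f.repr (g • m) c = weight p c g * f.repr m c := by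
  have h : f.coord c ∘ₗ Algebra.lsmul F F (M p lam) g = weight p c g • f.coord c := by
    refine f.ext fun a => ?_
    have h1 : (f.coord c ∘ₗ Algebra.lsmul F F (M p lam) g) (f a) = f.repr (g • f a) c := rfl
    rw [h1, hf, map_smul, LinearMap.smul_apply, Module.Basis.coord_apply, Module.Basis.repr_self,
      Finsupp.smul_apply]
    rcases eq_or_ne a c with rfl | hac
    · rfl
    · rw [Finsupp.single_eq_of_ne (Ne.symm hac), smul_zero, smul_zero]
  exact LinearMap.congr_fun h m

theorem weight_eq_of_mem_weightSpace {f : Module.Basis (JackIdx lam) F (M p lam)}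
    (hf : ∀ a, ∀ g : tAlg n p, g • f a = weight p a g • f a) {α : tAlg n p →ₐ[F] F}
    {m : M p lam} (hm : m ∈ weightSpace p (M p lam) α) {c : JackIdx lam} (hc : f.repr m c ≠ 0) :
    weight p c = α := by
  obtain ⟨q, hq0, hq⟩ := hm
  ext g
  have h1 : f.repr ((g - algebraMap F (tAlg n p) (α g)) ^ q • m) c = 0 := by
    have h2 : (g - algebraMap F (tAlg n p) (α g)) ^ q • m = 0 := hq g
    rw [h2, map_zero, Finsupp.zero_apply]
  rw [repr_smul_of_eigen hf, map_pow, map_sub, AlgHom.commutes] at h1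
  exact sub_eq_zero.1 (eq_zero_of_pow_eq_zero
    ((mul_eq_zero.1 h1).resolve_right hc))

theorem mem_weightSpace_of_eigen {α : tAlg n p →ₐ[F] F} {m : M p lam}
    (h : ∀ g : tAlg n p, g • m = α g • m) : m ∈ weightSpace p (M p lam) α := by
  refine ⟨1, one_pos, fun g => ?_⟩
  rw [pow_one, sub_smul, algebraMap_smul, sub_eq_zero]
  exact h g

theorem eq_smul_of_mem_weightSpace (hinj : Function.Injective (weight p (lam := lam)))
    {f : Module.Basis (JackIdx lam) F (M p lam)}
    (hf : ∀ a, ∀ g : tAlg n p, g • f a = weight p a g • f a) {c : JackIdx lam}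
    {m : M p lam} (hm : m ∈ weightSpace p (M p lam) (weight p c)) : m = f.repr m c • f c := by
  apply f.repr.injective
  ext e
  rw [map_smul, Module.Basis.repr_self, Finsupp.smul_single, smul_eq_mul, mul_one]
  rcases eq_or_ne e c with rfl | hec
  · rw [Finsupp.single_eq_same]
  · rw [Finsupp.single_eq_of_ne hec]
    by_contra h0
    exact hec (hinj (weight_eq_of_mem_weightSpace hf hm h0))

theorem exists_weight_eq {f : Module.Basis (JackIdx lam) F (M p lam)}
    (hf : ∀ a, ∀ g : tAlg n p, g • f a = weight p a g • f a) {α : tAlg n p →ₐ[F] F}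
    (h : weightSpace p (M p lam) α ≠ ⊥) : ∃ c : JackIdx lam, weight p c = α := by
  obtain ⟨m, hm, hm0⟩ := Submodule.exists_mem_ne_zero_of_ne_bot h
  have h1 : f.repr m ≠ 0 := fun h0 => hm0 (f.repr.map_eq_zero_iff.1 h0)
  obtain ⟨c, hc⟩ := Finsupp.ne_iff.1 h1
  exact ⟨c, weight_eq_of_mem_weightSpace hf hm hc⟩

theorem finrank_weightSpace (hinj : Function.Injective (weight p (lam := lam)))
    {α : tAlg n p →ₐ[F] F} (h : weightSpace p (M p lam) α ≠ ⊥) :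
    Module.finrank F (weightSpace p (M p lam) α) = 1 := by
  obtain ⟨f, hf⟩ := exists_jackBasis p hinj
  obtain ⟨c, rfl⟩ := exists_weight_eq hf h
  refine finrank_eq_one_iff'.2 ⟨⟨f c, mem_weightSpace_of_eigen (hf c)⟩, ?_, fun m => ?_⟩
  · exact fun h0 => f.ne_zero c (congrArg Subtype.val h0)
  · exact ⟨f.repr m c, Subtype.ext (eq_smul_of_mem_weightSpace hinj hf m.2).symm⟩

theorem weight_piElt (a : JackIdx lam) (i j : Fin n) :
    weight p a ⟨piElt (ht p) i j, piElt_mem_tAlg p i j⟩ =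
      if tWeight a.1 a.2 i = tWeight a.1 a.2 j then (r : F) else 0 := by
  refine repr_smul_eq p ?_
  have h : piElt (ht p) i j • jackB p lam a =
      (if tWeight a.1 a.2 i = tWeight a.1 a.2 j then (r : F) else 0) • jackB p lam a := by
    have h1 : piElt (ht p) i j = ∑ l : ZMod r, htHom p (diagRefl i l * diagRefl j (-l)) :=
      piElt_eq (htHom p) i j
    rw [h1, Finset.sum_smul]
    have h2 : ∀ l : ZMod r, htHom p (diagRefl i l * diagRefl j (-l)) • jackB p lam a =
        zetaPow F (l * (tWeight a.1 a.2 i - tWeight a.1 a.2 j)) • jackB p lam a := by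
      intro l
      rw [map_mul, mul_smul, htHom_apply, htHom_apply, ht_diagRefl_smul_jackB, smul_comm,
        ht_diagRefl_smul_jackB, smul_smul, ← zetaPow_add]
      congr 2; ring
    rw [Finset.sum_congr rfl fun l _ => h2 l, ← Finset.sum_smul, sum_zetaPow_mul]
    simp only [sub_eq_zero]
  rw [h, sub_self]
  exact zero_mem _

end Eigenbasis

/-! ### Intertwiners and weight spaces -/

section Sigma

open scoped IsMulCommutative

variable {F : Type} [Field F] [Algebra ℂ F] {r n : ℕ} [NeZero r] {p : Param r → F}
  {lam : RPartition r n}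

/-- Every nonzero weight space is spanned by one eigenvector, on which `z_i - z_{i+1}` is a scalar.
If this scalar is zero, the second components of the weights differ, and then `π_i` has eigenvalue
zero. -/
theorem sigmaDefinedOn_of_injective (hinj : Function.Injective (weight p (lam := lam)))
    {i j : Fin n} (h : ∀ a : JackIdx lam, zWeight p a.1 a.2 i = zWeight p a.1 a.2 j →
      tWeight a.1 a.2 i ≠ tWeight a.1 a.2 j) (α : tAlg n p →ₐ[F] F) :
    SigmaDefinedOn p lam i j α := by
  obtain ⟨f, hf⟩ := exists_jackBasis p hinj
  by_cases hbot : weightSpace p (M p lam) α = ⊥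
  · right
    intro m hm
    rw [hbot, Submodule.mem_bot] at hm
    rw [hm, smul_zero]
  obtain ⟨c, rfl⟩ := exists_weight_eq hf hbot
  have key : ∀ g : tAlg n p, ∀ m ∈ weightSpace p (M p lam) (weight p c),
      g • m = weight p c g • m := by
    intro g m hm
    rw [eq_smul_of_mem_weightSpace hinj hf hm, smul_comm g, hf, smul_comm]
  by_cases h0 : zWeight p c.1 c.2 i = zWeight p c.1 c.2 j
  · right
    intro m hm
    have h1 := key ⟨piElt (ht p) i j, piElt_mem_tAlg p i j⟩ m hm
    rw [weight_piElt, if_neg (h c h0), zero_smul] at h1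
    exact h1
  · left
    have hs : zWeight p c.1 c.2 i - zWeight p c.1 c.2 j ≠ 0 := sub_ne_zero.2 h0
    have h1 : ∀ m ∈ weightSpace p (M p lam) (weight p c), (hz p i - hz p j) • m =
        (zWeight p c.1 c.2 i - zWeight p c.1 c.2 j) • m := by
      intro m hm
      have h2 := key ⟨hz p i, hz_mem_tAlg p i⟩ m hm
      have h3 := key ⟨hz p j, hz_mem_tAlg p j⟩ m hm
      rw [weight_hz] at h2 h3
      rw [sub_smul, sub_smul, ← h2, ← h3]
      rfl
    refine ⟨fun m hm => ?_, fun m hm m' hm' hmm => ?_, fun m hm => ?_⟩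
    · change (hz p i - hz p j) • m ∈ _
      rw [h1 m hm]
      exact Submodule.smul_mem _ _ hm
    · have h4 : (hz p i - hz p j) • m = (hz p i - hz p j) • m' := hmm
      rw [h1 m hm, h1 m' hm'] at h4
      exact smul_right_injective _ hs h4
    · refine ⟨(zWeight p c.1 c.2 i - zWeight p c.1 c.2 j)⁻¹ • m, Submodule.smul_mem _ _ hm, ?_⟩
      change (hz p i - hz p j) • _ = m
      rw [h1 _ (Submodule.smul_mem _ _ hm), smul_smul, mul_inv_cancel₀ hs, one_smul]

/-- On the generalized eigenvector with leading term `x^μ v_T^μ`, a coincidence makes `z_i -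
z_{i+1}` nilpotent, hence not injective on the weight space, while `π_i` has the nonzero generalized
eigenvalue `r`. Both alternatives fail. -/
theorem ne_of_sigmaDefinedOn {i j : Fin n} (a : JackIdx lam)
    (h : SigmaDefinedOn p lam i j (weight p a)) (hz : zWeight p a.1 a.2 i = zWeight p a.1 a.2 j) :
    tWeight a.1 a.2 i ≠ tWeight a.1 a.2 j := by
  intro ht
  obtain ⟨u, hu, huw⟩ := exists_pseudoeigenvector p a
  have hu0 : u ≠ 0 := by
    rintro rfl
    have := repr_eq_zero_of_mem_lowerOf (jackB p lam) hu (lt_irrefl a)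
    simp at this
  have huq := huw
  obtain ⟨q, _, hq⟩ := huq
  rcases h with h | h
  · have hpow : ∀ k : ℕ, (RCA.hz p i - RCA.hz p j) ^ k • u ∈
        weightSpace p (M p lam) (weight p a) ∧ ((RCA.hz p i - RCA.hz p j) ^ k • u ≠ 0) := by
      intro k
      induction k with
      | zero => rw [pow_zero, one_smul]; exact ⟨huw, hu0⟩
      | succ k ih =>
        rw [pow_succ', mul_smul]
        refine ⟨h.1 ih.1, fun h0 => ih.2 ?_⟩
        exact h.2.1 ih.1 (zero_mem _) (h0.trans (smul_zero _).symm)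
    refine (hpow q).2 ?_
    have h1 := hq (⟨RCA.hz p i, hz_mem_tAlg p i⟩ - ⟨RCA.hz p j, hz_mem_tAlg p j⟩)
    rw [map_sub, weight_hz, weight_hz, hz, sub_self, map_zero, sub_zero] at h1
    exact h1
  · have h1 := hq ⟨piElt (RCA.ht p) i j, piElt_mem_tAlg p i j⟩
    rw [weight_piElt, if_pos ht] at h1
    have h2 : ∀ k : ℕ, (piElt (RCA.ht p) i j - algebraMap F (H n p) (r : F)) ^ k • u =
        (-(r : F)) ^ k • u := by
      intro k
      induction k with
      | zero => rw [pow_zero, pow_zero, one_smul, one_smul]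
      | succ k ih =>
        rw [pow_succ', mul_smul, ih, smul_comm, sub_smul, h u huw, algebraMap_smul, zero_sub,
          ← neg_smul, smul_smul, pow_succ]
    exact hu0 ((smul_eq_zero.1 ((h2 q).symm.trans h1)).resolve_left
      (pow_ne_zero _ (neg_ne_zero.2 (natCast_ne_zero_of_neZero F r))))

end Sigma

set_option linter.unusedSectionVars false

/-! ### Adjacent weights -/

section Adjacent

variable {F : Type} [Field F] [Algebra ℂ F] {r n : ℕ} [NeZero r] (p : Param r → F)
  {lam : RPartition r n}

theorem wPerm_comp_swap (μ : Fin n → ℕ) {i j : Fin n} (hij : (i : ℕ) + 1 = j) (h : μ i ≠ μ j) :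
    wPerm (μ ∘ Equiv.swap i j) = wPerm μ * Equiv.swap i j := by
  symm
  refine eq_wPerm fun k l hkl => ?_
  rw [Equiv.Perm.mul_apply, Equiv.Perm.mul_apply, wPerm_lt_wPerm]
  simp only [Function.comp_apply, Equiv.swap_apply_def] at hkl ⊢
  grind

/-- Equal parts are sorted in reverse order of position, and nothing can be sorted between two
adjacent ones. The bound with `3` is weaker than consecutiveness and has the form that `SYT.ct_ne`
requires. -/
theorem wPerm_adjacent (μ : Fin n → ℕ) {i j : Fin n} (hij : (i : ℕ) + 1 = j) (h : μ i = μ j) :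
    wPerm μ j < wPerm μ i ∧ (wPerm μ i : ℕ) < wPerm μ j + 3 := by
  have h1 : wPerm μ j < wPerm μ i := (wPerm_lt_wPerm μ).2 (by right; constructor <;> omega)
  refine ⟨h1, ?_⟩
  by_contra! hc
  obtain ⟨k, hk⟩ := (wPerm μ).surjective ⟨wPerm μ j + 1, by omega⟩
  have h2 : wPerm μ j < wPerm μ k := by rw [hk, Fin.lt_def]; simp
  have h3 : wPerm μ k < wPerm μ i := by rw [hk, Fin.lt_def]; simp; omega
  rw [wPerm_lt_wPerm] at h2 h3
  grind

theorem zWeight_comp_swap (μ : Fin n → ℕ) (T : SYT lam) {i j : Fin n} (hij : (i : ℕ) + 1 = j)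
    (h : μ i ≠ μ j) (k : Fin n) :
    zWeight p (μ ∘ Equiv.swap i j) T k = zWeight p μ T (Equiv.swap i j k) := by
  rw [zWeight, zWeight, wPerm_comp_swap μ hij h]
  rfl

theorem tWeight_comp_swap (μ : Fin n → ℕ) (T : SYT lam) {i j : Fin n} (hij : (i : ℕ) + 1 = j)
    (h : μ i ≠ μ j) (k : Fin n) :
    tWeight (μ ∘ Equiv.swap i j) T k = tWeight μ T (Equiv.swap i j k) := by
  rw [tWeight, tWeight, wPerm_comp_swap μ hij h]
  rfl

/-- If `μ_i = μ_{i+1}`, the boxes involved contain consecutive entries of `T`, so in one component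
their contents differ, and `c_0 ≠ 0` makes this visible in the weight. If the parts differ,
exchanging them permutes the weight, which a coincidence would leave fixed, against injectivity. -/
theorem tWeight_ne_of_injective (hc0 : p Param.c0 ≠ 0)
    (hinj : Function.Injective (weight p (lam := lam))) (a : JackIdx lam) {i j : Fin n}
    (hij : (i : ℕ) + 1 = j) (hz : zWeight p a.1 a.2 i = zWeight p a.1 a.2 j) :
    tWeight a.1 a.2 i ≠ tWeight a.1 a.2 j := by
  intro ht
  obtain ⟨μ, T⟩ := a
  by_cases h : μ i = μ j
  · obtain ⟨h1, h2⟩ := wPerm_adjacent μ hij h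
    have hβ : beta (T.box (wPerm μ j)) = beta (T.box (wPerm μ i)) := by
      simp only [tWeight, h] at ht
      exact (sub_left_injective ht).symm
    refine SYT.ct_ne T h1 h2 hβ ?_
    have h3 : (r : F) * (ct (T.box (wPerm μ i)) : F) = r * (ct (T.box (wPerm μ j)) : F) := by
      simp only [zWeight, h, hβ] at hz
      exact mul_left_cancel₀ hc0 (by linear_combination -hz)
    have h4 := mul_left_cancel₀ (natCast_ne_zero_of_neZero F r) h3
    have : CharZero F := charZero_of_injective_algebraMap (algebraMap ℂ F).injective
    exact_mod_cast h4.symm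
  · have h1 : weight p (lam := lam) (μ ∘ Equiv.swap i j, T) = weight p (μ, T) := by
      refine (weight_eq_iff p _ _).2 fun k => ?_
      change zWeight p (μ ∘ Equiv.swap i j) T k = zWeight p μ T k ∧
        tWeight (μ ∘ Equiv.swap i j) T k = tWeight μ T k
      rw [zWeight_comp_swap p μ T hij h, tWeight_comp_swap μ T hij h, Equiv.swap_apply_def]
      split_ifs with hk hk
      · subst hk; exact ⟨hz.symm, ht.symm⟩
      · subst hk; exact ⟨hz, ht⟩
      · exact ⟨rfl, rfl⟩
    have h2 : μ ∘ Equiv.swap i j = μ := congrArg Prod.fst (hinj h1)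
    have h3 := congrFun h2 i
    rw [Function.comp_apply, Equiv.swap_apply_left] at h3
    exact h h3.symm

end Adjacent

/-! ### Exceptional hyperplanes and coincidences of weights -/

section Diagrams

theorem ctMax_mem {ν : YoungDiagram} (h : ν ≠ ⊥) :
    ∃ c ∈ ν, cellContent c = ctMax ν := by
  have hne : (cellContent '' (ν.cells : Set (ℕ × ℕ))).Nonempty := by
    rw [Set.image_nonempty, Finset.coe_nonempty, Finset.nonempty_iff_ne_empty]
    intro h0
    exact h (YoungDiagram.ext (by simpa using h0))
  obtain ⟨c, hc, h1⟩ := Int.csSup_mem hne ((ν.cells.finite_toSet.image _).bddAbove)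
  exact ⟨c, hc, h1⟩

theorem ctMin_mem {ν : YoungDiagram} (h : ν ≠ ⊥) :
    ∃ c ∈ ν, cellContent c = ctMin ν := by
  have hne : (cellContent '' (ν.cells : Set (ℕ × ℕ))).Nonempty := by
    rw [Set.image_nonempty, Finset.coe_nonempty, Finset.nonempty_iff_ne_empty]
    intro h0
    exact h (YoungDiagram.ext (by simpa using h0))
  obtain ⟨c, hc, h1⟩ := Int.csInf_mem hne ((ν.cells.finite_toSet.image _).bddBelow)
  exact ⟨c, hc, h1⟩

theorem le_ctMax {ν : YoungDiagram} {c : ℕ × ℕ} (hc : c ∈ ν) : cellContent c ≤ ctMax ν :=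
  le_csSup ((ν.cells.finite_toSet.image _).bddAbove) ⟨c, hc, rfl⟩

theorem ctMin_le {ν : YoungDiagram} {c : ℕ × ℕ} (hc : c ∈ ν) : ctMin ν ≤ cellContent c :=
  csInf_le ((ν.cells.finite_toSet.image _).bddBelow) ⟨c, hc, rfl⟩

theorem mem_arm {ν : YoungDiagram} (h : ν ≠ ⊥) {c : ℕ} (hc : (c : ℤ) ≤ ctMax ν) :
    ((0, c) : ℕ × ℕ) ∈ ν := by
  obtain ⟨⟨i, j⟩, hmem, h1⟩ := ctMax_mem h
  refine YoungDiagram.up_left_mem ν (Nat.zero_le i) ?_ hmem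
  simp only [cellContent] at h1
  omega

theorem mem_leg {ν : YoungDiagram} (h : ν ≠ ⊥) {c : ℕ} (hc : ctMin ν ≤ -(c : ℤ)) :
    ((c, 0) : ℕ × ℕ) ∈ ν := by
  obtain ⟨⟨i, j⟩, hmem, h1⟩ := ctMin_mem h
  refine YoungDiagram.up_left_mem ν ?_ (Nat.zero_le j) hmem
  simp only [cellContent] at h1
  omega

theorem ctMax_nonneg {ν : YoungDiagram} (h : ν ≠ ⊥) : 0 ≤ ctMax ν := by
  obtain ⟨⟨i, j⟩, hmem, _⟩ := ctMax_mem h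
  have h0 : ((0, 0) : ℕ × ℕ) ∈ ν :=
    YoungDiagram.up_left_mem ν (Nat.zero_le i) (Nat.zero_le j) hmem
  simpa [cellContent] using le_ctMax h0

theorem ctMin_nonpos {ν : YoungDiagram} (h : ν ≠ ⊥) : ctMin ν ≤ 0 := by
  obtain ⟨⟨i, j⟩, hmem, _⟩ := ctMin_mem h
  have h0 : ((0, 0) : ℕ × ℕ) ∈ ν :=
    YoungDiagram.up_left_mem ν (Nat.zero_le i) (Nat.zero_le j) hmem
  simpa [cellContent] using ctMin_le h0

theorem exists_cell_of_content {ν : YoungDiagram} (h : ν ≠ ⊥) {c : ℤ} (h1 : ctMin ν ≤ c)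
    (h2 : c ≤ ctMax ν) : ∃ x ∈ ν, cellContent x = c := by
  rcases le_or_gt 0 c with h0 | h0
  · refine ⟨(0, c.toNat), mem_arm h (by omega), ?_⟩
    simp only [cellContent]; omega
  · refine ⟨((-c).toNat, 0), mem_leg h (by omega), ?_⟩
    simp only [cellContent]; omega

theorem ctMax_pos_of_not_isColumn {ν : YoungDiagram} (h : ν ≠ ⊥) (hc : ¬ IsColumn ν) :
    0 < ctMax ν := by
  simp only [IsColumn, not_and, not_forall] at hc
  obtain ⟨⟨i, j⟩, hmem, hj⟩ := hc h
  have h0 : ((0, 1) : ℕ × ℕ) ∈ ν :=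
    YoungDiagram.up_left_mem ν (Nat.zero_le i) (by simp only at hj; omega) hmem
  have := le_ctMax h0
  simp only [cellContent] at this
  omega

theorem ctMin_neg_of_not_isRow {ν : YoungDiagram} (h : ν ≠ ⊥) (hr : ¬ IsRow ν) :
    ctMin ν < 0 := by
  simp only [IsRow, not_and, not_forall] at hr
  obtain ⟨⟨i, j⟩, hmem, hi⟩ := hr h
  have h0 : ((1, 0) : ℕ × ℕ) ∈ ν :=
    YoungDiagram.up_left_mem ν (by simp only at hi; omega) (Nat.zero_le j) hmem
  have := ctMin_le h0
  simp only [cellContent] at this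
  omega

/-- Two cells with a given difference of contents, the first of which is not above and to the
left of the second. -/
theorem exists_cells {ν : YoungDiagram} (h : ν ≠ ⊥) {m : ℤ}
    (hm : (IsRow ν ∧ 0 < m ∧ m ≤ ctMax ν) ∨ (IsColumn ν ∧ ctMin ν ≤ m ∧ m < 0) ∨
      (¬ IsRow ν ∧ ¬ IsColumn ν ∧ m ≠ 0 ∧ ctMin ν - ctMax ν ≤ m ∧ m ≤ ctMax ν - ctMin ν)) :
    ∃ x ∈ ν, ∃ y ∈ ν, cellContent x - cellContent y = m ∧ ¬ (x.1 ≤ y.1 ∧ x.2 ≤ y.2) := by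
  have h00 : ((0, 0) : ℕ × ℕ) ∈ ν := mem_arm h (ctMax_nonneg h)
  have hpos : 0 < m → m ≤ ctMax ν → ∃ x ∈ ν, ∃ y ∈ ν, cellContent x - cellContent y = m ∧
      ¬ (x.1 ≤ y.1 ∧ x.2 ≤ y.2) := fun h1 h2 =>
    ⟨(0, m.toNat), mem_arm h (by omega), (0, 0), h00, by simp only [cellContent]; omega,
      by simp only; omega⟩
  have hneg : m < 0 → ctMin ν ≤ m → ∃ x ∈ ν, ∃ y ∈ ν, cellContent x - cellContent y = m ∧
      ¬ (x.1 ≤ y.1 ∧ x.2 ≤ y.2) := fun h1 h2 =>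
    ⟨((-m).toNat, 0), mem_leg h (by omega), (0, 0), h00, by simp only [cellContent]; omega,
      by simp only; omega⟩
  rcases hm with ⟨_, h1, h2⟩ | ⟨_, h1, h2⟩ | ⟨hr, hc, h0, h1, h2⟩
  · exact hpos h1 h2
  · exact hneg h2 h1
  · have hA := ctMax_pos_of_not_isColumn h hc
    have hL := ctMin_neg_of_not_isRow h hr
    rcases lt_or_gt_of_ne h0 with hm | hm
    · by_cases h3 : ctMin ν ≤ m
      · exact hneg hm h3
      -- A difference below `ctMin ν` is not reached from the corner: the end of the first column is
      -- paired with a suitable box of the first row.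
      · refine ⟨((-ctMin ν).toNat, 0), mem_leg h (by omega), (0, (ctMin ν - m).toNat),
          mem_arm h (by omega), by simp only [cellContent]; omega, by simp only; omega⟩
    · by_cases h3 : m ≤ ctMax ν
      · exact hpos hm h3
      · refine ⟨(0, (ctMax ν).toNat), mem_arm h (by omega), ((m - ctMax ν).toNat, 0),
          mem_leg h (by omega), by simp only [cellContent]; omega, by simp only; omega⟩

end Diagrams

/-! ### Coincidences of adjacent weights on the hyperplanes -/

section Coincidence

variable {r n : ℕ} [NeZero r] {lam : RPartition r n}

/-- A box can be filled before any box that is not weakly above and to the left of it. -/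
theorem exists_syt_lt (b b' : Box lam)
    (h : ¬ (b.1.1 = b'.1.1 ∧ b.1.2.1 ≤ b'.1.2.1 ∧ b.1.2.2 ≤ b'.1.2.2)) :
    ∃ T : SYT lam, T.1.symm b' < T.1.symm b := by
  classical
  obtain ⟨e⟩ : Nonempty (Fin n ≃ Box lam) := by
    have : Finite (Box lam) := inferInstance
    exact ⟨(Finite.equivFinOfCardEq (card_box lam)).symm⟩
  -- The boxes weakly above and to the left of `b'` come first, then all others, each group ordered
  -- by distance from the corner. The offset exceeds the distance of `b'`, so the groups do not
  -- overlap. Ties may be broken arbitrarily, because moving right or down strictly increases the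
  -- key.
  let key : Box lam → ℕ := fun x =>
    (if x.1.1 = b'.1.1 ∧ x.1.2.1 ≤ b'.1.2.1 ∧ x.1.2.2 ≤ b'.1.2.2 then 0
      else b'.1.2.1 + b'.1.2.2 + 1) + (x.1.2.1 + x.1.2.2)
  let T : Fin n ≃ Box lam := (Tuple.sort (key ∘ e)).trans e
  have hmono : Monotone (key ∘ T) := Tuple.monotone_sort (key ∘ e)
  have hlt : ∀ x y, key x < key y → T.symm x < T.symm y := by
    intro x y hxy
    by_contra hc
    have := hmono (not_lt.1 hc)
    simp only [Function.comp_apply, Equiv.apply_symm_apply] at this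
    omega
  refine ⟨⟨T, fun x y hxy hpos => hlt x y ?_⟩, hlt b' b ?_⟩
  · by_cases hc : y.1.1 = b'.1.1
    · simp only [key, hxy, hc, true_and]
      split_ifs <;> omega
    · simp only [key, hxy, hc, false_and, if_false]
      omega
  · simp only [key, if_neg h, le_refl, and_self, if_true]
    omega

/-- The composition `0^{p-q-1} k^{n-p} 0^{q+1}`. -/
def stepComp (n p q k : ℕ) (x : Fin n) : ℕ := if p - q - 1 ≤ x ∧ (x : ℕ) + q + 1 < n then k else 0

/-- The last `k` of the block and the first zero after it are neighbours. Ties are sorted by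
reversed position, so this zero comes last among the `q + 1` trailing zeros, and this `k` follows
all `p` zeros and precedes the other entries of the block. -/
theorem wPerm_stepComp {p q : Fin n} (hpq : q < p) {k : ℕ} (hk : 0 < k) :
    ∃ i j : Fin n, (i : ℕ) + 1 = j ∧ stepComp n p q k i = k ∧ stepComp n p q k j = 0 ∧
      wPerm (stepComp n p q k) i = p ∧ wPerm (stepComp n p q k) j = q := by
  have hp := p.2
  have hpq' : (q : ℕ) < p := hpq
  refine ⟨⟨n - q - 2, by omega⟩, ⟨n - q - 1, by omega⟩, by simp only; omega, ?_, ?_, ?_, ?_⟩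
  · rw [stepComp, if_pos (by simp only; omega)]
  · rw [stepComp, if_neg (by simp only; omega)]
  · refine Fin.ext ?_
    change wFun _ _ = _
    have h1 : (Finset.univ.filter fun x : Fin n => (x < (⟨n - q - 2, by omega⟩ : Fin n) ∧
        stepComp n p q k x < stepComp n p q k ⟨n - q - 2, by omega⟩) ∨
        ((⟨n - q - 2, by omega⟩ : Fin n) < x ∧
        stepComp n p q k x ≤ stepComp n p q k ⟨n - q - 2, by omega⟩)) =
        Finset.Iio (⟨p - q - 1, by omega⟩ : Fin n) ∪ Finset.Ioi ⟨n - q - 2, by omega⟩ := by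
      ext x
      simp only [Finset.mem_filter, Finset.mem_univ, true_and, Finset.mem_union, Finset.mem_Iio,
        Finset.mem_Ioi, stepComp, Fin.lt_def]
      split_ifs <;> omega
    rw [wFun, h1, Finset.card_union_of_disjoint, Fin.card_Iio, Fin.card_Ioi]
    · simp only; omega
    · rw [Finset.disjoint_left]
      intro x hx hx'
      simp only [Finset.mem_Iio, Finset.mem_Ioi, Fin.lt_def] at hx hx'
      omega
  · refine Fin.ext ?_
    change wFun _ _ = _
    have h1 : (Finset.univ.filter fun x : Fin n => (x < (⟨n - q - 1, by omega⟩ : Fin n) ∧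
        stepComp n p q k x < stepComp n p q k ⟨n - q - 1, by omega⟩) ∨
        ((⟨n - q - 1, by omega⟩ : Fin n) < x ∧
        stepComp n p q k x ≤ stepComp n p q k ⟨n - q - 1, by omega⟩)) =
        Finset.Ioi ⟨n - q - 1, by omega⟩ := by
      ext x
      simp only [Finset.mem_filter, Finset.mem_univ, true_and, Finset.mem_Ioi, stepComp, Fin.lt_def]
      split_ifs <;> omega
    rw [wFun, h1, Fin.card_Ioi]
    simp only; omega

/-- Two boxes whose parameters satisfy the equation of a hyperplane produce a coincidence of
adjacent weights. -/
theorem exists_wt_eq {c0 : ℂ} {d : {j : ZMod r // j ≠ 0} → ℂ} {b b' : Box lam}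
    (h : ¬ (b.1.1 = b'.1.1 ∧ b.1.2.1 ≤ b'.1.2.1 ∧ b.1.2.2 ≤ b'.1.2.2)) {k : ℕ} (hk : 0 < k)
    (hβ : beta b' = beta b - (k : ZMod r))
    (he : (k : ℂ) = dPar (point c0 d) (beta b) - dPar (point c0 d) (beta b') +
      ((ct b - ct b' : ℤ) : ℂ) * r * c0) :
    ∃ (μ : Fin n → ℕ) (T : SYT lam) (i j : Fin n), (i : ℕ) + 1 = j ∧
      wt c0 d μ T i = wt c0 d μ T j := by
  obtain ⟨T, hT⟩ := exists_syt_lt b b' h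
  obtain ⟨i, j, hij, hi, hj, hwi, hwj⟩ := wPerm_stepComp hT hk
  refine ⟨stepComp n (T.1.symm b) (T.1.symm b') k, T, i, j, hij, ?_⟩
  have h1 : T.box (T.1.symm b) = b := T.1.apply_symm_apply b
  have h2 : T.box (T.1.symm b') = b' := T.1.apply_symm_apply b'
  rw [wt, wt, hi, hj, hwi, hwj, h1, h2]
  refine Prod.ext ?_ ?_
  · simp only [Nat.cast_zero, sub_zero, hβ] at he ⊢
    push_cast at he
    linear_combination he
  · simp only [Nat.cast_zero, sub_zero, hβ]

theorem exists_wt_eq_of_mem {c0 : ℂ} {d : {j : ZMod r // j ≠ 0} → ℂ}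
    {E : Set (ℂ × ({j : ZMod r // j ≠ 0} → ℂ))} (hE : E ∈ excHyper lam) (hmem : (c0, d) ∈ E) :
    ∃ (μ : Fin n → ℕ) (T : SYT lam) (i j : Fin n), (i : ℕ) + 1 = j ∧
      wt c0 d μ T i = wt c0 d μ T j := by
  rcases hE with ⟨k, l, m, hk, hr, h1, h2, h3, h4, rfl⟩ | ⟨i, k, m, hk, h1, hm, rfl⟩
  · have hkz : ((k.toNat : ℕ) : ℤ) = k := Int.toNat_of_nonneg hk.le
    have hkr : ((k.toNat : ℕ) : ZMod r) = (k : ZMod r) := by rw [← Int.cast_natCast, hkz]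
    have hkc : ((k.toNat : ℕ) : ℂ) = (k : ℂ) := by rw [← Int.cast_natCast, hkz]
    have a1 := ctMin_nonpos h1
    have a2 := ctMax_nonneg h1
    have a3 := ctMin_nonpos h2
    have a4 := ctMax_nonneg h2
    -- The smallest content in the first component for which the content lower by `m` is not below
    -- the range of the second; the bounds on `m` place both contents in range.
    obtain ⟨x, hx, hxc⟩ := exists_cell_of_content h1
      (c := max (ctMin (lam.comp l)) (m + ctMin (lam.comp (l - (k : ZMod r)))))
      (by omega) (by omega)
    obtain ⟨y, hy, hyc⟩ := exists_cell_of_content h2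
      (c := max (ctMin (lam.comp l)) (m + ctMin (lam.comp (l - (k : ZMod r)))) - m)
      (by omega) (by omega)
    refine exists_wt_eq (b := ⟨(l, x), hx⟩) (b' := ⟨(l - (k : ZMod r), y), hy⟩) ?_
      (k := k.toNat) (by omega) ?_ ?_
    · rintro ⟨h5, -⟩
      have h6 : l - (k : ZMod r) = l := Eq.symm h5
      exact hr ((ZMod.intCast_zmod_eq_zero_iff_dvd k r).1 (sub_eq_self.1 h6))
    · simp only [beta, hkr]
    · have h5 : (k : ℂ) = _ := hmem
      simp only [beta, ct, hxc, hyc, hkc, sub_sub_cancel]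
      exact h5
  · obtain ⟨x, hx, y, hy, hxy, hnle⟩ := exists_cells h1 hm
    have hkz : ((k.toNat : ℕ) : ℤ) = k := Int.toNat_of_nonneg hk.le
    have hkc : ((k.toNat : ℕ) : ℂ) = (k : ℂ) := by rw [← Int.cast_natCast, hkz]
    -- The part used is `r k`, which leaves the residue unchanged; the required equation is `r`
    -- times that of the hyperplane.
    refine exists_wt_eq (b := ⟨(i, x), hx⟩) (b' := ⟨(i, y), hy⟩) ?_
      (k := r * k.toNat) (Nat.mul_pos (NeZero.pos r) (by omega)) ?_ ?_
    · rintro ⟨-, h5⟩; exact hnle h5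
    · simp [beta]
    · have h5 : (k : ℂ) = c0 * (m : ℂ) := hmem
      simp only [beta, ct, hxy, Nat.cast_mul, hkc, h5]
      ring

end Coincidence

/-! ### Distinct weights away from the exceptional hyperplanes -/

section Distinct

variable {r n : ℕ} [NeZero r] {lam : RPartition r n}

/-- Two enumerations of initial segments that induce the same order agree. -/
theorem eq_of_same_order {J : Type*} {f g : J → ℕ} (h : ∀ i j, f i < f j ↔ g i < g j)
    (hf : ∀ i, ∀ x < f i, ∃ j, f j = x) (hg : ∀ i, ∀ x < g i, ∃ j, g j = x) : f = g := by
  have key : ∀ N, ∀ i, f i = N → g i = N := by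
    intro N
    induction N using Nat.strong_induction_on with
    | _ N ih =>
      intro i hi
      rcases lt_trichotomy (g i) N with h1 | h1 | h1
      · obtain ⟨j, hj⟩ := hf i (g i) (by omega)
        have h2 := ih _ h1 j hj
        have h3 := (h j i).1 (by omega)
        omega
      · exact h1
      · obtain ⟨j, hj⟩ := hg i N h1
        have h2 := (h j i).2 (by omega)
        have h3 := ih (f j) (by omega) j rfl
        omega
  exact funext fun i => (key _ i rfl).symm

/-- The distance of a box from the corner of its diagram. -/
def Box.rank (b : Box lam) : ℕ := b.1.2.1 + b.1.2.2

/-- In a component that is a row or a column the boxes are ordered linearly. -/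
theorem wPerm_lt_of_rank_lt {l : ZMod r} (hl : IsRow (lam.comp l) ∨ IsColumn (lam.comp l))
    (T : SYT lam) {p q : Fin n} (hp : beta (T.box p) = l) (hq : beta (T.box q) = l)
    (h : (T.box p).rank < (T.box q).rank) : p < q := by
  have h1 := T.2 (T.box p) (T.box q) (hp.trans hq.symm) (by
    simp only [Box.rank] at h
    have m1 : (T.box p).1.2 ∈ lam.comp l := hp ▸ (T.box p).2
    have m2 : (T.box q).1.2 ∈ lam.comp l := hq ▸ (T.box q).2
    rcases hl with hl | hl
    · have := hl.2 _ m1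
      have := hl.2 _ m2
      left; omega
    · have := hl.2 _ m1
      have := hl.2 _ m2
      right; omega)
  have h2 : ∀ p, T.1.symm (T.box p) = p := fun p => T.1.symm_apply_apply p
  rwa [h2, h2] at h1

theorem eq_of_rank_eq {l : ZMod r} (hl : IsRow (lam.comp l) ∨ IsColumn (lam.comp l))
    {b b' : Box lam} (hp : beta b = l) (hq : beta b' = l)
    (h : b.rank = b'.rank) : b = b' := by
  simp only [Box.rank] at h
  have m1 : b.1.2 ∈ lam.comp l := hp ▸ b.2
  have m2 : b'.1.2 ∈ lam.comp l := hq ▸ b'.2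
  rcases hl with hl | hl
  · have := hl.2 _ m1
    have := hl.2 _ m2
    exact Box.ext' (hp.trans hq.symm) (by omega) (by omega)
  · have := hl.2 _ m1
    have := hl.2 _ m2
    exact Box.ext' (hp.trans hq.symm) (by omega) (by omega)

theorem exists_rank_eq (b : Box lam) {x : ℕ} (hx : x < b.rank) :
    ∃ b' : Box lam, beta b' = beta b ∧ b'.rank = x := by
  rcases le_or_gt x b.1.2.1 with h | h
  · exact ⟨b.upLeft x 0 h (Nat.zero_le _), rfl, rfl⟩
  · refine ⟨b.upLeft b.1.2.1 (x - b.1.2.1) le_rfl ?_, rfl, ?_⟩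
    · simp only [Box.rank] at hx; omega
    · simp only [Box.rank, Box.upLeft]; omega

/-- In a component that is a row or a column, `μ_i + g · rank` determines the ranks if `g > 0`. -/
theorem rank_eq_of_add_eq {l : ZMod r} (hl : IsRow (lam.comp l) ∨ IsColumn (lam.comp l))
    {g : ℝ} (hg : 0 < g) {μ ν : Fin n → ℕ} {T S : SYT lam}
    (hβ : ∀ i, beta (T.box (wPerm μ i)) = l ↔ beta (S.box (wPerm ν i)) = l)
    (he : ∀ i, beta (T.box (wPerm μ i)) = l → (μ i : ℝ) + g * (T.box (wPerm μ i)).rank =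
      (ν i : ℝ) + g * (S.box (wPerm ν i)).rank) (i : Fin n) (hi : beta (T.box (wPerm μ i)) = l) :
    (T.box (wPerm μ i)).rank = (S.box (wPerm ν i)).rank := by
  -- In a row or column larger rank means a later entry of `T`. Since `w_μ` sorts `μ`, the parts
  -- weakly increase with the rank, and adding `g · rank` with `g > 0` makes the increase strict.
  have hlt : ∀ (μ : Fin n → ℕ) (T : SYT lam) (i j : Fin n), beta (T.box (wPerm μ i)) = l →
      beta (T.box (wPerm μ j)) = l → ((T.box (wPerm μ i)).rank < (T.box (wPerm μ j)).rank ↔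
      (μ i : ℝ) + g * (T.box (wPerm μ i)).rank < (μ j : ℝ) + g * (T.box (wPerm μ j)).rank) := by
    intro μ T
    have h1 : ∀ i j : Fin n, beta (T.box (wPerm μ i)) = l → beta (T.box (wPerm μ j)) = l →
        (T.box (wPerm μ i)).rank < (T.box (wPerm μ j)).rank →
        (μ i : ℝ) + g * (T.box (wPerm μ i)).rank < (μ j : ℝ) + g * (T.box (wPerm μ j)).rank := by
      intro i j hi hj hij
      have h2 := (wPerm_lt_wPerm μ).1 (wPerm_lt_of_rank_lt hl T hi hj hij)
      have h3 : (μ i : ℝ) ≤ μ j := by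
        rw [Nat.cast_le]; omega
      have h4 : ((T.box (wPerm μ i)).rank : ℝ) < (T.box (wPerm μ j)).rank := by exact_mod_cast hij
      nlinarith
    intro i j hi hj
    refine ⟨h1 i j hi hj, fun h => ?_⟩
    rcases lt_trichotomy (T.box (wPerm μ i)).rank (T.box (wPerm μ j)).rank with h2 | h2 | h2
    · exact h2
    · have h3 := eq_of_rank_eq hl hi hj h2
      have h4 : i = j := (wPerm μ).injective (T.1.injective h3)
      rw [h4] at h
      exact absurd h (lt_irrefl _)
    · exact absurd (h1 j i hj hi h2) h.not_gt
  have hex : ∀ (μ : Fin n → ℕ) (T : SYT lam) (i : Fin n), beta (T.box (wPerm μ i)) = l →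
      ∀ x < (T.box (wPerm μ i)).rank, ∃ j, beta (T.box (wPerm μ j)) = l ∧
        (T.box (wPerm μ j)).rank = x := by
    intro μ T i hi x hx
    obtain ⟨b', h1, h2⟩ := exists_rank_eq _ hx
    have h3 : T.box (wPerm μ ((wPerm μ).symm (T.1.symm b'))) = b' := by
      rw [Equiv.apply_symm_apply]; exact T.1.apply_symm_apply b'
    exact ⟨(wPerm μ).symm (T.1.symm b'), by rw [h3, h1, hi], by rw [h3, h2]⟩
  have := eq_of_same_order (J := {i // beta (T.box (wPerm μ i)) = l})
    (f := fun i => (T.box (wPerm μ i)).rank) (g := fun i => (S.box (wPerm ν i)).rank)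
    (fun i j => by
      rw [hlt μ T i j i.2 j.2, hlt ν S i j ((hβ i).1 i.2) ((hβ j).1 j.2), he i i.2, he j j.2])
    (fun i x hx => by
      obtain ⟨j, h1, h2⟩ := hex μ T i i.2 x hx
      exact ⟨⟨j, h1⟩, h2⟩)
    (fun i x hx => by
      obtain ⟨j, h1, h2⟩ := hex ν S i ((hβ i).1 i.2) x hx
      exact ⟨⟨j, (hβ j).2 h1⟩, h2⟩)
  exact congrFun this ⟨i, hi⟩

variable {c0 : ℂ} {d : {j : ZMod r // j ≠ 0} → ℂ}

theorem comp_ne_bot (b : Box lam) : lam.comp (beta b) ≠ ⊥ := by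
  intro h
  have h1 : b.1.2 ∈ lam.comp (beta b) := b.2
  rw [h] at h1
  exact YoungDiagram.notMem_bot _ h1

theorem ctMin_le_ct (b : Box lam) : ctMin (lam.comp (beta b)) ≤ ct b := ctMin_le b.2

theorem ct_le_ctMax (b : Box lam) : ct b ≤ ctMax (lam.comp (beta b)) := le_ctMax b.2

/-- If a positive integer is the difference of two entries with the same weight, then either a
hyperplane contains the point or the boxes lie in the same row or column. -/
theorem same_component_of_avoid (hE : ∀ E ∈ excHyper lam, (c0, d) ∉ E) {b b' : Box lam} {k : ℤ}
    (hk : 0 < k) (hβ : beta b' = beta b - (k : ZMod r))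
    (he : (k : ℂ) = dPar (point c0 d) (beta b) - dPar (point c0 d) (beta b') +
      c0 * r * (ct b - ct b' : ℤ)) :
    beta b = beta b' ∧
      ((IsRow (lam.comp (beta b)) ∧ ∃ g : ℝ, 0 < g ∧ c0 * r = -g) ∨
        (IsColumn (lam.comp (beta b)) ∧ ∃ g : ℝ, 0 < g ∧ c0 * r = g)) := by
  have a1 := ctMin_le_ct b
  have a2 := ct_le_ctMax b
  have a3 := ctMin_le_ct b'
  have a4 := ct_le_ctMax b'
  by_cases hr : (r : ℤ) ∣ k
  · have hk0 : (k : ZMod r) = 0 := (ZMod.intCast_zmod_eq_zero_iff_dvd k r).2 hr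
    have hββ : beta b = beta b' := by rw [hβ, hk0, sub_zero]
    refine ⟨hββ, ?_⟩
    rw [← hββ] at a3 a4
    rw [hββ, sub_self, zero_add] at he
    obtain ⟨k', rfl⟩ := hr
    have hr0 : (0 : ℤ) < r := by exact_mod_cast NeZero.pos r
    have hk' : 0 < k' := by
      by_contra hc
      push Not at hc
      nlinarith
    have hrc : (r : ℂ) ≠ 0 := by exact_mod_cast NeZero.ne r
    have he' : (k' : ℂ) = c0 * ((ct b - ct b' : ℤ) : ℂ) := by
      refine mul_left_cancel₀ hrc ?_
      push_cast at he ⊢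
      linear_combination he
    have hm0 : ct b - ct b' ≠ 0 := by
      intro h0
      rw [h0, Int.cast_zero, mul_zero] at he'
      have : k' = 0 := by exact_mod_cast he'
      omega
    have hnot : ¬ ((IsRow (lam.comp (beta b)) ∧ 0 < ct b - ct b' ∧
          ct b - ct b' ≤ ctMax (lam.comp (beta b))) ∨
        (IsColumn (lam.comp (beta b)) ∧ ctMin (lam.comp (beta b)) ≤ ct b - ct b' ∧
          ct b - ct b' < 0) ∨
        (¬ IsRow (lam.comp (beta b)) ∧ ¬ IsColumn (lam.comp (beta b)) ∧ ct b - ct b' ≠ 0 ∧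
          ctMin (lam.comp (beta b)) - ctMax (lam.comp (beta b)) ≤ ct b - ct b' ∧
          ct b - ct b' ≤ ctMax (lam.comp (beta b)) - ctMin (lam.comp (beta b)))) := fun h =>
      hE _ (Or.inr ⟨beta b, k', ct b - ct b', hk', comp_ne_bot b, h, rfl⟩) he'
    have hc0 : c0 = ((k' / (ct b - ct b' : ℤ) : ℝ) : ℂ) := by
      have : ((ct b - ct b' : ℤ) : ℂ) ≠ 0 := by exact_mod_cast hm0
      push_cast at this he' ⊢
      rw [eq_div_iff this, he']
    have hk'R : (0 : ℝ) < k' := by exact_mod_cast hk'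
    have hrR : (0 : ℝ) < r := by exact_mod_cast NeZero.pos r
    have hrow : IsRow (lam.comp (beta b)) → 0 ≤ ct b' := fun h => by
      have m2 : b'.1.2 ∈ lam.comp (beta b) := hββ ▸ b'.2
      have := h.2 _ m2
      simp only [ct, cellContent]; omega
    have hcol : IsColumn (lam.comp (beta b)) → ct b' ≤ 0 := fun h => by
      have m2 : b'.1.2 ∈ lam.comp (beta b) := hββ ▸ b'.2
      have := h.2 _ m2
      simp only [ct, cellContent]; omega
    by_cases h1 : IsRow (lam.comp (beta b))
    · left
      have := hrow h1
      -- Contents in a row are nonnegative, so a positive difference is at most the maximal content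
      -- and would give an excluded hyperplane. The difference is thus negative, and `c_0` is
      -- negative with it.
      have hneg : ct b - ct b' < 0 := by
        by_contra hc
        exact hnot (Or.inl ⟨h1, by omega, by omega⟩)
      have hnegR : ((ct b - ct b' : ℤ) : ℝ) < 0 := by exact_mod_cast hneg
      refine ⟨h1, -(k' / (ct b - ct b' : ℤ) * r : ℝ), ?_, ?_⟩
      · have := mul_neg_of_neg_of_pos (div_neg_of_pos_of_neg hk'R hnegR) hrR
        linarith
      · rw [hc0]; push_cast; ring
    · by_cases h2 : IsColumn (lam.comp (beta b))
      · right
        have := hcol h2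
        have hpos : 0 < ct b - ct b' := by
          by_contra hc
          exact hnot (Or.inr (Or.inl ⟨h2, by omega, by omega⟩))
        have hposR : (0 : ℝ) < ((ct b - ct b' : ℤ) : ℝ) := by exact_mod_cast hpos
        refine ⟨h2, (k' / (ct b - ct b' : ℤ) * r : ℝ), by positivity, ?_⟩
        rw [hc0]; push_cast; ring
      · exact absurd (Or.inr (Or.inr ⟨h1, h2, hm0, by omega, by omega⟩)) hnot
  · refine absurd ?_ (hE _ (Or.inl ⟨k, beta b, ct b - ct b', hk, hr, comp_ne_bot b,
      hβ ▸ comp_ne_bot b', ?_, ?_, rfl⟩))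
    · change (k : ℂ) = _
      rw [he, ← hβ]
      ring
    · rw [← hβ]; omega
    · rw [← hβ]; omega

theorem ct_of_isRow {b : Box lam} (h : IsRow (lam.comp (beta b))) : ct b = b.rank := by
  have := h.2 _ b.2
  simp only [ct, cellContent, Box.rank]; omega

theorem ct_of_isColumn {b : Box lam} (h : IsColumn (lam.comp (beta b))) : ct b = -b.rank := by
  have := h.2 _ b.2
  simp only [ct, cellContent, Box.rank]; omega

/-- The weights determine the index if the point avoids the exceptional hyperplanes. -/
theorem injective_weight_of_avoid (hc0 : c0 ≠ 0) (hE : ∀ E ∈ excHyper lam, (c0, d) ∉ E) :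
    Function.Injective (weight (point c0 d) (lam := lam)) := by
  rintro ⟨μ, T⟩ ⟨ν, S⟩ h
  have h' := (weight_eq_iff (point c0 d) _ _).1 h
  have ht : ∀ i, beta (T.box (wPerm μ i)) - (μ i : ZMod r) =
      beta (S.box (wPerm ν i)) - (ν i : ZMod r) := fun i => (h' i).2
  have hz : ∀ i, (μ i : ℂ) - ν i = dPar (point c0 d) (beta (T.box (wPerm μ i))) -
      dPar (point c0 d) (beta (S.box (wPerm ν i))) +
      c0 * r * ((ct (T.box (wPerm μ i)) : ℂ) - ct (S.box (wPerm ν i))) := by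
    intro i
    have h1 := (h' i).1
    simp only [zWeight, point, ← sub_sub (beta _), ht i] at h1
    linear_combination h1
  -- The second components of the weights show that the residues of the two boxes differ by the
  -- difference of the parts. The larger part supplies the positive integer for the hyperplane
  -- equation, hence the two symmetric cases.
  have hbad : ∀ i, μ i ≠ ν i → beta (T.box (wPerm μ i)) = beta (S.box (wPerm ν i)) ∧
      ((IsRow (lam.comp (beta (T.box (wPerm μ i)))) ∧ ∃ g : ℝ, 0 < g ∧ c0 * r = -g) ∨
        (IsColumn (lam.comp (beta (T.box (wPerm μ i)))) ∧ ∃ g : ℝ, 0 < g ∧ c0 * r = g)) := by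
    intro i hi
    rcases lt_or_gt_of_ne hi with h1 | h1
    · have h2 := same_component_of_avoid hE (b := S.box (wPerm ν i)) (b' := T.box (wPerm μ i))
        (k := (ν i : ℤ) - μ i) (by omega) (by push_cast; linear_combination ht i)
        (by push_cast; linear_combination -hz i)
      refine ⟨h2.1.symm, ?_⟩
      rw [← h2.1]
      exact h2.2
    · exact same_component_of_avoid hE (k := (μ i : ℤ) - ν i) (by omega)
        (by push_cast; linear_combination -ht i) (by push_cast; linear_combination hz i)
  have hβ : ∀ i, beta (T.box (wPerm μ i)) = beta (S.box (wPerm ν i)) := by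
    intro i
    by_cases hi : μ i = ν i
    · have := ht i
      rw [hi] at this
      exact sub_left_injective this
    · exact (hbad i hi).1
  have hμ : μ = ν := by
    funext i
    by_contra hi
    obtain ⟨-, h1⟩ := hbad i hi
    have hz' : ∀ j, (μ j : ℂ) - ν j =
        c0 * r * ((ct (T.box (wPerm μ j)) : ℂ) - ct (S.box (wPerm ν j))) := by
      intro j
      rw [hz j, hβ j, sub_self, zero_add]
    -- In a row `c_0 r = -g` and the content is the rank; in a column `c_0 r = g` and the content is
    -- minus the rank. Either way, equality of weights says that `part + g · rank` agrees throughout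
    -- the component.
    have key : ∀ g : ℝ, 0 < g → (IsRow (lam.comp (beta (T.box (wPerm μ i)))) ∨
        IsColumn (lam.comp (beta (T.box (wPerm μ i))))) →
        (∀ j, beta (T.box (wPerm μ j)) = beta (T.box (wPerm μ i)) →
          (μ j : ℝ) + g * (T.box (wPerm μ j)).rank =
          (ν j : ℝ) + g * (S.box (wPerm ν j)).rank) → False := by
      intro g hg hl he
      have h2 := rank_eq_of_add_eq hl hg (fun j => by rw [hβ j]) he i rfl
      have h3 := he i rfl
      rw [h2] at h3
      have h4 : (μ i : ℝ) = ν i := by linarith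
      exact hi (by exact_mod_cast h4)
    rcases h1 with ⟨hl, g, hg, hgc⟩ | ⟨hl, g, hg, hgc⟩
    · refine key g hg (Or.inl hl) fun j hj => ?_
      have h2 := hz' j
      rw [ct_of_isRow (by rwa [hj]), ct_of_isRow (by rwa [← hβ j, hj]), hgc] at h2
      have h3 : (((μ j : ℝ) + g * (T.box (wPerm μ j)).rank : ℝ) : ℂ) =
          (((ν j : ℝ) + g * (S.box (wPerm ν j)).rank : ℝ) : ℂ) := by
        push_cast at h2 ⊢
        linear_combination h2
      exact_mod_cast h3
    · refine key g hg (Or.inr hl) fun j hj => ?_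
      have h2 := hz' j
      rw [ct_of_isColumn (by rwa [hj]), ct_of_isColumn (by rwa [← hβ j, hj]), hgc] at h2
      have h3 : (((μ j : ℝ) + g * (T.box (wPerm μ j)).rank : ℝ) : ℂ) =
          (((ν j : ℝ) + g * (S.box (wPerm ν j)).rank : ℝ) : ℂ) := by
        push_cast at h2 ⊢
        linear_combination h2
      exact_mod_cast h3
  subst hμ
  refine Prod.ext rfl (SYT.ext_of_content (fun i => ?_) fun i => ?_)
  · simpa using hβ ((wPerm μ).symm i)
  -- With equal parts and components only the content term of the weight remains, and its
  -- coefficient `c_0 r` is nonzero.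
  · have h1 := hz ((wPerm μ).symm i)
    rw [hβ, sub_self, sub_self, zero_add, Equiv.apply_symm_apply] at h1
    have hrc : (r : ℂ) ≠ 0 := by exact_mod_cast NeZero.ne r
    have h2 := (mul_eq_zero.1 h1.symm).resolve_left (mul_ne_zero hc0 hrc)
    exact_mod_cast sub_eq_zero.1 h2

end Distinct

/-! ### Local finiteness of the arrangement -/

section LocallyFinite

variable {r n : ℕ} [NeZero r] (lam : RPartition r n)

theorem continuous_dPar_point (l : ZMod r) :
    Continuous fun q : ℂ × ({j : ZMod r // j ≠ 0} → ℂ) => dPar (point q.1 q.2) l := by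
  unfold dPar
  split_ifs
  · simp only [point]; fun_prop
  · simp only [point]; fun_prop

/-- Near a point the parameters are bounded, and `m` is bounded by the contents in `λ`. The equation
then bounds `k`, and only finitely many triples of labels remain. -/
theorem locallyFinite_excHyper :
    LocallyFinite (fun E : excHyper lam => (E : Set (ℂ × ({j : ZMod r // j ≠ 0} → ℂ)))) := by
  intro x
  let g : ℂ × ({j : ZMod r // j ≠ 0} → ℂ) → ℝ := fun q =>
    ‖q.1‖ + ∑ l : ZMod r, ‖dPar (point q.1 q.2) l‖
  have hg : Continuous g :=
    continuous_fst.norm.add (continuous_finsetSum _ fun l _ => (continuous_dPar_point l).norm)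
  have hg0 : ∀ q, ‖q.1‖ ≤ g q := fun q =>
    le_add_of_nonneg_right (Finset.sum_nonneg fun _ _ => norm_nonneg _)
  have hgl : ∀ q l, ‖dPar (point q.1 q.2) l‖ ≤ g q := fun q l =>
    (Finset.single_le_sum (f := fun l => ‖dPar (point q.1 q.2) l‖)
      (fun _ _ => norm_nonneg _) (Finset.mem_univ l)).trans (le_add_of_nonneg_left (norm_nonneg _))
  refine ⟨{q | g q < g x + 1}, (isOpen_lt hg continuous_const).mem_nhds (by simp), ?_⟩
  let C : ℤ := ∑ l : ZMod r, (|ctMax (lam.comp l)| + |ctMin (lam.comp l)|)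
  have hC : ∀ l, |ctMax (lam.comp l)| + |ctMin (lam.comp l)| ≤ C := fun l =>
    Finset.single_le_sum (f := fun l => |ctMax (lam.comp l)| + |ctMin (lam.comp l)|)
      (fun _ _ => by positivity) (Finset.mem_univ l)
  have hC' : ∀ l, -C ≤ ctMin (lam.comp l) ∧ ctMax (lam.comp l) ≤ C ∧ -C ≤ ctMax (lam.comp l) ∧
      ctMin (lam.comp l) ≤ C := by
    intro l
    have h1 := hC l
    have h2 := abs_le.1 (show |ctMax (lam.comp l)| ≤ C by have := abs_nonneg (ctMin (lam.comp l)); omega)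
    have h3 := abs_le.1 (show |ctMin (lam.comp l)| ≤ C by have := abs_nonneg (ctMax (lam.comp l)); omega)
    omega
  -- Each parameter has norm at most `g q < g x + 1` and `|m| ≤ 2C`: two values of `d` contribute
  -- the summand `2`, and the term with `c_0` contributes `2Cr`.
  obtain ⟨B, hB⟩ := exists_int_gt ((g x + 1) * (2 + (2 * C : ℤ) * r))
  have hbound : ∀ q, g q < g x + 1 → ∀ (k m : ℤ) (u v : ℂ) (ρ : ℕ), ρ ≤ r → ‖u‖ ≤ g q → ‖v‖ ≤ g q →
      |m| ≤ 2 * C → (k : ℂ) = u - v + m * ρ * q.1 → k ≤ B := by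
    intro q hq k m u v ρ hρ hu hv hm he
    have hq0 : 0 ≤ g q := (norm_nonneg _).trans (hg0 q)
    have h1 : (k : ℝ) ≤ ‖(k : ℂ)‖ := by
      rw [Complex.norm_intCast]; exact le_abs_self _
    have h2 : ‖(m * ρ * q.1 : ℂ)‖ ≤ (2 * C : ℤ) * r * g q := by
      rw [norm_mul, norm_mul, Complex.norm_intCast, Complex.norm_natCast]
      have hm' : |(m : ℝ)| ≤ (2 * C : ℤ) := by exact_mod_cast hm
      have hρ' : (ρ : ℝ) ≤ r := by exact_mod_cast hρ
      gcongr
      exact hg0 q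
    have h3 : ‖(k : ℂ)‖ ≤ g q + g q + (2 * C : ℤ) * r * g q := by
      rw [he]
      exact (norm_add_le _ _).trans (add_le_add ((norm_sub_le _ _).trans (add_le_add hu hv)) h2)
    have hC0 : (0 : ℝ) ≤ (2 * C : ℤ) := by exact_mod_cast (abs_nonneg m).trans hm
    have h4 : (g q) * (2 + (2 * C : ℤ) * r) ≤ (g x + 1) * (2 + (2 * C : ℤ) * r) := by
      gcongr
    have h5 : (k : ℝ) < B := by nlinarith
    exact le_of_lt (by exact_mod_cast h5)
  let s1 : Set (Set (ℂ × ({j : ZMod r // j ≠ 0} → ℂ))) :=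
    (fun y : (ℤ × ZMod r) × ℤ => hyper y.1.1 y.1.2 y.2) ''
      ((Set.Icc 0 B ×ˢ Set.univ) ×ˢ Set.Icc (-(2 * C)) (2 * C))
  let s2 : Set (Set (ℂ × ({j : ZMod r // j ≠ 0} → ℂ))) :=
    (fun y : ℤ × ℤ => {q | (y.1 : ℂ) = q.1 * (y.2 : ℂ)}) ''
      (Set.Icc 0 B ×ˢ Set.Icc (-(2 * C)) (2 * C))
  have hfin : (s1 ∪ s2).Finite :=
    ((((Set.finite_Icc _ _).prod Set.finite_univ).prod (Set.finite_Icc _ _)).image _).union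
      (((Set.finite_Icc _ _).prod (Set.finite_Icc _ _)).image _)
  refine (hfin.preimage Subtype.val_injective.injOn).subset ?_
  rintro ⟨E, hE⟩ ⟨q, hqE, hq⟩
  have hq' : g q < g x + 1 := hq
  rcases hE with ⟨k, l, m, hk, hr, h1, h2, h3, h4, rfl⟩ | ⟨i, k, m, hk, h1, hm, rfl⟩
  · have a1 := hC' l
    have a2 := hC' (l - (k : ZMod r))
    have hm : |m| ≤ 2 * C := abs_le.2 ⟨by omega, by omega⟩
    refine Or.inl ⟨((k, l), m), ⟨⟨⟨hk.le, ?_⟩, trivial⟩, abs_le.1 hm⟩, rfl⟩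
    exact hbound q hq' k m _ _ r le_rfl (hgl q l) (hgl q _) hm hqE
  · have a1 := hC' i
    have hm' : |m| ≤ 2 * C := abs_le.2 (by
      rcases hm with ⟨_, h2, h3⟩ | ⟨_, h2, h3⟩ | ⟨_, _, _, h2, h3⟩ <;> constructor <;> omega)
    refine Or.inr ⟨(k, m), ⟨⟨hk.le, ?_⟩, abs_le.1 hm'⟩, rfl⟩
    have hk2 : (k : ℂ) = q.1 * (m : ℂ) := hqE
    -- The second family fits the same estimate, with both values of `d` replaced by `0` and the
    -- factor `r` by `1`.
    refine hbound q hq' k m 0 0 1 (NeZero.one_le) (by simpa using (norm_nonneg _).trans (hg0 q))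
      (by simpa using (norm_nonneg _).trans (hg0 q)) hm' ?_
    rw [hk2]; push_cast; ring

end LocallyFinite

/-! ### Specialization of the parameters -/

section Spec

variable {r : ℕ} (p : Param r → ℂ)

/-- The rational function `a` is regular at `p` and has the value `z` there. -/
def SpecTo (a : GenField r) (z : ℂ) : Prop :=
  ∃ u v : MvPolynomial (Param r) ℂ, MvPolynomial.eval p v ≠ 0 ∧
    a * algebraMap _ (GenField r) v = algebraMap _ (GenField r) u ∧
    z * MvPolynomial.eval p v = MvPolynomial.eval p u

variable {p}

/-- Cross-multiplication of two representing fractions, followed by evaluation. Uniqueness lets the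
relation `SpecTo` serve as a partially defined evaluation map at `p`. -/
theorem SpecTo.unique {a : GenField r} {z z' : ℂ} (h : SpecTo p a z) (h' : SpecTo p a z') :
    z = z' := by
  obtain ⟨u, v, hv, h1, h2⟩ := h
  obtain ⟨u', v', hv', h1', h2'⟩ := h'
  have h3 : u * v' = u' * v := by
    apply IsFractionRing.injective (MvPolynomial (Param r) ℂ) (GenField r)
    rw [map_mul, map_mul, ← h1, ← h1']; ring
  have h4 := congrArg (MvPolynomial.eval p) h3
  rw [map_mul, map_mul, ← h2, ← h2'] at h4
  have h5 : MvPolynomial.eval p v * MvPolynomial.eval p v' ≠ 0 := mul_ne_zero hv hv'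
  refine mul_right_cancel₀ h5 ?_
  linear_combination h4

theorem SpecTo.add {a b : GenField r} {z w : ℂ} (h : SpecTo p a z) (h' : SpecTo p b w) :
    SpecTo p (a + b) (z + w) := by
  obtain ⟨u, v, hv, h1, h2⟩ := h
  obtain ⟨u', v', hv', h1', h2'⟩ := h'
  refine ⟨u * v' + u' * v, v * v', by rw [map_mul]; exact mul_ne_zero hv hv', ?_, ?_⟩
  · simp only [map_mul, map_add, ← h1, ← h1']; ring
  · simp only [map_mul, map_add, ← h2, ← h2']; ring

theorem SpecTo.mul {a b : GenField r} {z w : ℂ} (h : SpecTo p a z) (h' : SpecTo p b w) :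
    SpecTo p (a * b) (z * w) := by
  obtain ⟨u, v, hv, h1, h2⟩ := h
  obtain ⟨u', v', hv', h1', h2'⟩ := h'
  refine ⟨u * u', v * v', by rw [map_mul]; exact mul_ne_zero hv hv', ?_, ?_⟩
  · simp only [map_mul, ← h1, ← h1']; ring
  · simp only [map_mul, ← h2, ← h2']; ring

theorem SpecTo.inv {a : GenField r} {z : ℂ} (h : SpecTo p a z) (hz : z ≠ 0) :
    SpecTo p a⁻¹ z⁻¹ := by
  obtain ⟨u, v, hv, h1, h2⟩ := h
  have hu : MvPolynomial.eval p u ≠ 0 := h2 ▸ mul_ne_zero hz hv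
  have ha : a ≠ 0 := by
    rintro rfl
    rw [zero_mul] at h1
    have : u = 0 := by
      apply IsFractionRing.injective (MvPolynomial (Param r) ℂ) (GenField r)
      rw [← h1, map_zero]
    exact hu (by rw [this, map_zero])
  exact ⟨v, u, hu, by rw [← h1, inv_mul_cancel_left₀ ha], by rw [← h2, inv_mul_cancel_left₀ hz]⟩

theorem specTo_algebraMap (z : ℂ) : SpecTo p (algebraMap ℂ (GenField r) z) z :=
  ⟨MvPolynomial.C z, 1, by simp, by
    rw [map_one, mul_one, ← MvPolynomial.algebraMap_eq, ← IsScalarTower.algebraMap_apply],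
    by simp⟩

theorem specTo_genPar (i : Param r) : SpecTo p (genPar r i) (p i) :=
  ⟨MvPolynomial.X i, 1, by simp, by rw [map_one, mul_one]; rfl, by simp⟩

theorem specTo_zero : SpecTo p 0 0 := by simpa using specTo_algebraMap (p := p) 0

theorem specTo_one : SpecTo p 1 1 := by simpa using specTo_algebraMap (p := p) 1

theorem specTo_natCast (k : ℕ) : SpecTo p (k : GenField r) k := by
  simpa using specTo_algebraMap (p := p) k

theorem specTo_intCast (k : ℤ) : SpecTo p (k : GenField r) k := by
  simpa using specTo_algebraMap (p := p) k

theorem SpecTo.neg {a : GenField r} {z : ℂ} (h : SpecTo p a z) : SpecTo p (-a) (-z) := by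
  simpa using (specTo_intCast (-1)).mul h

theorem SpecTo.sub {a b : GenField r} {z w : ℂ} (h : SpecTo p a z) (h' : SpecTo p b w) :
    SpecTo p (a - b) (z - w) := by
  simpa [sub_eq_add_neg] using h.add h'.neg

theorem specTo_sum {ι : Type*} (s : Finset ι) {f : ι → GenField r} {g : ι → ℂ}
    (h : ∀ i ∈ s, SpecTo p (f i) (g i)) : SpecTo p (∑ i ∈ s, f i) (∑ i ∈ s, g i) := by
  classical
  induction s using Finset.induction_on with
  | empty => simpa using specTo_zero
  | insert a s ha ih =>
    rw [Finset.sum_insert ha, Finset.sum_insert ha]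
    exact (h a (by simp)).add (ih fun i hi => h i (by simp [hi]))

theorem regularAt_iff {a : GenField r} : RegularAt p a ↔ ∃ z, SpecTo p a z := by
  have hinj := IsFractionRing.injective (MvPolynomial (Param r) ℂ) (GenField r)
  have hv0 : ∀ v : MvPolynomial (Param r) ℂ, MvPolynomial.eval p v ≠ 0 →
      algebraMap _ (GenField r) v ≠ 0 := by
    intro v hv h0
    have : v = 0 := hinj (by rw [h0, map_zero])
    exact hv (by rw [this, map_zero])
  constructor
  · rintro ⟨u, v, hv, h⟩
    exact ⟨MvPolynomial.eval p u / MvPolynomial.eval p v, u, v, hv,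
      by rw [h, div_mul_cancel₀ _ (hv0 v hv)], div_mul_cancel₀ _ hv⟩
  · rintro ⟨z, u, v, hv, h1, h2⟩
    exact ⟨u, v, hv, by rw [← h1, mul_div_cancel_right₀ _ (hv0 v hv)]⟩

variable [NeZero r]

theorem specTo_zetaPow (j : ZMod r) : SpecTo p (zetaPow (GenField r) j) (zetaPow ℂ j) :=
  specTo_algebraMap _

theorem specTo_dPar (j : ZMod r) : SpecTo p (dPar (genPar r) j) (dPar p j) := by
  unfold dPar
  split_ifs
  · exact (specTo_sum _ fun k _ => specTo_genPar _).neg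
  · exact specTo_genPar _

theorem specTo_dFourier (l : ZMod r) : SpecTo p (dFourier (genPar r) l) (dFourier p l) := by
  unfold dFourier
  refine SpecTo.mul ?_ (specTo_sum _ fun j _ => (specTo_dPar j).mul (specTo_zetaPow _))
  rw [one_div, one_div]
  exact (specTo_natCast r).inv (by exact_mod_cast NeZero.ne r)

theorem specTo_zWeight {n : ℕ} {lam : RPartition r n} (μ : Fin n → ℕ) (T : SYT lam) (i : Fin n) :
    SpecTo p (zWeight (genPar r) μ T i) (zWeight p μ T i) := by
  unfold zWeight
  exact (((specTo_genPar _).mul ((specTo_natCast _).add specTo_one)).sub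
    ((specTo_dPar _).sub (specTo_dPar _))).sub ((specTo_genPar _).mul
      ((specTo_natCast _).mul (specTo_intCast _)))

end Spec

/-! ### Specialization of vectors of the standard module -/

section SpecModule

variable {r n : ℕ} [NeZero r] (p : Param r → ℂ) (lam : RPartition r n)

/-- The vector `m'` of the standard module at `p` is a specialization of the generic vector `m`. -/
inductive MRel : M (genPar r) lam → M p lam → Prop
  | zero : MRel 0 0
  | vec (T : SYT lam) : MRel (mTensor (genPar r) lam 1 (vec _ T)) (mTensor p lam 1 (vec _ T))
  | add {m k : M (genPar r) lam} {m' k' : M p lam} :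
      MRel m m' → MRel k k' → MRel (m + k) (m' + k')
  | smul {a : GenField r} {z : ℂ} {m : M (genPar r) lam} {m' : M p lam} :
      SpecTo p a z → MRel m m' → MRel (a • m) (z • m')
  | hx (i : Fin n) {m : M (genPar r) lam} {m' : M p lam} :
      MRel m m' → MRel (RCA.hx (genPar r) i • m) (RCA.hx p i • m')

variable {p lam}

theorem MRel.sum {ι : Type*} (s : Finset ι) {f : ι → M (genPar r) lam} {g : ι → M p lam}
    (h : ∀ i ∈ s, MRel p lam (f i) (g i)) : MRel p lam (∑ i ∈ s, f i) (∑ i ∈ s, g i) := by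
  classical
  induction s using Finset.induction_on with
  | empty => simpa using MRel.zero
  | insert a s ha ih =>
    rw [Finset.sum_insert ha, Finset.sum_insert ha]
    exact (h a (by simp)).add (ih fun i hi => h i (by simp [hi]))

theorem MRel.neg {m : M (genPar r) lam} {m' : M p lam} (h : MRel p lam m m') :
    MRel p lam (-m) (-m') := by
  simpa using MRel.smul (specTo_intCast (-1)) h

theorem MRel.sub {m k : M (genPar r) lam} {m' k' : M p lam} (h : MRel p lam m m')
    (h' : MRel p lam k k') : MRel p lam (m - k) (m' - k') := by
  simpa [sub_eq_add_neg] using h.add h'.neg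

/-- On constants `t_w` has complex structure constants independent of the field, and past an `x_i`
it acquires only a root of unity. So it acts compatibly on both sides. -/
theorem MRel.ht (w : W r n) {m : M (genPar r) lam} {m' : M p lam} (h : MRel p lam m m') :
    MRel p lam (RCA.ht (genPar r) w • m) (RCA.ht p w • m') := by
  induction h with
  | zero => rw [smul_zero, smul_zero]; exact MRel.zero
  | vec T =>
    obtain ⟨c, hc⟩ := exists_spechtCoeff w T
    have key : ∀ (F : Type) [Field F] [Algebra ℂ F] (q : Param r → F),
        RCA.ht q w • mTensor q lam 1 (RCA.vec F T) =
          ∑ S ∈ c.support, algebraMap ℂ F (c S) • mTensor q lam 1 (RCA.vec F S) := by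
      intro F _ _ q
      rw [ht_smul_mTensor_one, hc F, Finsupp.sum]
      let f : Specht F lam →ₗ[F] M q lam :=
        { toFun := mTensor q lam 1
          map_add' := mTensor_add_right q lam 1
          map_smul' := fun a v => mTensor_smul_right q lam a 1 v }
      change f _ = _
      rw [map_sum]
      exact Finset.sum_congr rfl fun S _ => map_smul f _ _
    rw [key, key]
    exact MRel.sum _ fun S _ => MRel.smul (specTo_algebraMap _) (MRel.vec S)
  | add _ _ h h' => rw [smul_add, smul_add]; exact h.add h'
  | smul ha _ h => rw [smul_comm, smul_comm (RCA.ht p w)]; exact h.smul ha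
  | hx i _ h =>
    have key : ∀ (F : Type) [Field F] [Algebra ℂ F] (q : Param r → F) (m : M q lam),
        RCA.ht q w • RCA.hx q i • m = zetaPow F (-(w.left (w.right i)).toAdd) •
          RCA.hx q (w.right i) • RCA.ht q w • m := by
      intro F _ _ q m
      have h1 : RCA.ht q w * RCA.hx q i = zetaPow F (-(w.left (w.right i)).toAdd) •
          (RCA.hx q (w.right i) * RCA.ht q w) := ht_mul_hx q w i
      rw [smul_smul, h1, smul_assoc, mul_smul]
    rw [key, key]
    exact (h.hx _).smul (specTo_zetaPow _)

theorem MRel.commElt (i k : Fin n) {m : M (genPar r) lam} {m' : M p lam} (h : MRel p lam m m') :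
    MRel p lam (RCA.commElt (genPar r) (htHom (genPar r)) i k • m)
      (RCA.commElt p (htHom p) i k • m') := by
  rw [commElt_smul_eq, commElt_smul_eq]
  split_ifs
  · refine ((h.smul (specTo_genPar _)).sub (MRel.sum _ fun l _ => (h.ht _).smul
      ((specTo_dFourier l).mul (specTo_one.sub (specTo_zetaPow _))))).sub ?_
    exact (MRel.sum _ fun j _ => MRel.sum _ fun l _ => h.ht _).smul (specTo_genPar _)
  · exact (MRel.sum _ fun l _ => (h.ht _).smul (specTo_zetaPow _)).smul (specTo_genPar _)

/-- The `y_i` kill constants, and moving them past `x_k` produces `commElt`, whose coefficients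
specialize. This and the stability under `t_w` make `MRel` stable under all generators of `ℍ`. -/
theorem MRel.hy (i : Fin n) {m : M (genPar r) lam} {m' : M p lam} (h : MRel p lam m m') :
    MRel p lam (RCA.hy (genPar r) i • m) (RCA.hy p i • m') := by
  induction h with
  | zero => rw [smul_zero, smul_zero]; exact MRel.zero
  | vec T => rw [hy_smul_mTensor_one, hy_smul_mTensor_one]; exact MRel.zero
  | add _ _ h h' => rw [smul_add, smul_add]; exact h.add h'
  | smul ha _ h => rw [smul_comm, smul_comm (RCA.hy p i)]; exact h.smul ha
  | hx k hm h =>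
    rw [hy_smul_hx_smul, hy_smul_hx_smul]
    exact (h.hx k).add (hm.commElt i k)

theorem MRel.hz (i : Fin n) {m : M (genPar r) lam} {m' : M p lam} (h : MRel p lam m m') :
    MRel p lam (RCA.hz (genPar r) i • m) (RCA.hz p i • m') := by
  have key : ∀ (F : Type) [Field F] [Algebra ℂ F] (q : Param r → F) (m : M q lam),
      RCA.hz q i • m = RCA.hy q i • RCA.hx q i • m + q Param.c0 •
        ∑ j ∈ Finset.univ.filter (· < i), ∑ l : ZMod r, RCA.ht q (refl i j l) • m := by
    intro F _ _ q m
    rw [hz_eq, add_smul, mul_smul, smul_assoc, jm_eq, Finset.sum_smul]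
    simp only [reflSum, Finset.sum_smul]
    rfl
  rw [key, key]
  exact ((h.hx i).hy i).add
    ((MRel.sum _ fun j _ => MRel.sum _ fun l _ => h.ht _).smul (specTo_genPar _))

theorem MRel.hmon (μ : Fin n → ℕ) {m : M (genPar r) lam} {m' : M p lam} (h : MRel p lam m m') :
    MRel p lam (RCA.hmon (genPar r) μ • m) (RCA.hmon p μ • m') := by
  have hpow : ∀ (i : Fin n) (k : ℕ) {m : M (genPar r) lam} {m' : M p lam}, MRel p lam m m' →
      MRel p lam (RCA.hx (genPar r) i ^ k • m) (RCA.hx p i ^ k • m') := by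
    intro i k m m' h
    induction k with
    | zero => rw [pow_zero, pow_zero, one_smul, one_smul]; exact h
    | succ k ih => rw [pow_succ', pow_succ', mul_smul, mul_smul]; exact ih.hx i
  have key : ∀ l : List (Fin n), MRel p lam
      ((l.map fun i => RCA.hx (genPar r) i ^ μ i).prod • m)
      ((l.map fun i => RCA.hx p i ^ μ i).prod • m') := by
    intro l
    induction l with
    | nil =>
      rw [List.map_nil, List.map_nil, List.prod_nil, List.prod_nil, one_smul, one_smul]; exact h
    | cons i l ih =>
      rw [List.map_cons, List.map_cons, List.prod_cons, List.prod_cons, mul_smul, mul_smul]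
      exact hpow i _ ih
  rw [RCA.hmon, RCA.hmon, List.ofFn_eq_map, List.ofFn_eq_map]
  exact key _

theorem basisVec_eq {F : Type} [Field F] [Algebra ℂ F] (q : Param r → F)
    (a : (Fin n → ℕ) × SYT lam) : basisVec q a =
      hmon q a.1 • ht q (permElt r (wPerm a.1))⁻¹ • mTensor q lam 1 (vec F a.2) := by
  rw [ht_smul_mTensor_one, smul_mTensor, mul_one]
  rfl

theorem MRel.basisVec (a : (Fin n → ℕ) × SYT lam) :
    MRel p lam (RCA.basisVec (genPar r) a) (RCA.basisVec p a) := by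
  rw [basisVec_eq, basisVec_eq]
  exact ((MRel.vec _).ht _).hmon _

/-- The expansion of `x^ν ⊗ t_w.v_T` in the basis has complex coefficients that do not depend
on the parameters. -/
theorem exists_mTensor_coeff (ν : Fin n → ℕ) (w : W r n) (T : SYT lam) : ∃ c : SYT lam →₀ ℂ,
    ∀ (F : Type) [Field F] [Algebra ℂ F] (q : Param r → F),
      mTensor q lam (hmon q ν) (spechtRep F lam w (vec F T)) =
        ∑ S ∈ c.support, algebraMap ℂ F (c S) • basisVec q (ν, S) := by
  obtain ⟨c, hc⟩ := exists_spechtCoeff (lam := lam) (permElt r (wPerm ν) * w) T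
  refine ⟨c, fun F _ _ q => ?_⟩
  have h1 : spechtRep F lam w (vec F T) = spechtRep F lam (permElt r (wPerm ν))⁻¹
      (spechtRep F lam (permElt r (wPerm ν) * w) (vec F T)) := by
    rw [← Module.End.mul_apply, ← map_mul, inv_mul_cancel_left]
  let f : Specht F lam →ₗ[F] M q lam :=
    { toFun := mTensor q lam (hmon q ν)
      map_add' := mTensor_add_right q lam _
      map_smul' := fun a v => mTensor_smul_right q lam a _ v }
  rw [h1, hc F, Finsupp.sum]
  change f _ = _
  rw [map_sum, map_sum]
  refine Finset.sum_congr rfl fun S _ => ?_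
  rw [map_smul, map_smul]
  rfl

theorem hmon_zero {F : Type} [Field F] [Algebra ℂ F] (q : Param r → F) :
    hmon q (0 : Fin n → ℕ) = 1 := by
  rw [← polyHom_mon, mon]; simp

theorem hx_mul_hmon {F : Type} [Field F] [Algebra ℂ F] (q : Param r → F) (k : Fin n)
    (μ : Fin n → ℕ) : hx q k * hmon q μ = hmon q (μ + Pi.single k 1) := by
  rw [← polyHom_mon, ← polyHom_mon, ← polyHom_X, ← map_mul]
  congr 1
  rw [mon, mon]
  simp only [Pi.add_apply, pow_add, Finset.prod_mul_distrib]
  rw [mul_comm]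
  congr 1
  rw [Finset.prod_eq_single k]
  · simp
  · intro i _ hi; simp [hi]
  · simp

variable (p lam) in
/-- The pairs of combinations of the bases with corresponding coefficients. -/
inductive BasisRel : M (genPar r) lam → M p lam → Prop
  | zero : BasisRel 0 0
  | basis (a : JackIdx lam) : BasisRel (jackB (genPar r) lam a) (jackB p lam a)
  | add {m k : M (genPar r) lam} {m' k' : M p lam} :
      BasisRel m m' → BasisRel k k' → BasisRel (m + k) (m' + k')
  | smul {a : GenField r} {z : ℂ} {m : M (genPar r) lam} {m' : M p lam} :
      SpecTo p a z → BasisRel m m' → BasisRel (a • m) (z • m')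

theorem BasisRel.sum {ι : Type*} (s : Finset ι) {f : ι → M (genPar r) lam} {g : ι → M p lam}
    (h : ∀ i ∈ s, BasisRel p lam (f i) (g i)) :
    BasisRel p lam (∑ i ∈ s, f i) (∑ i ∈ s, g i) := by
  classical
  induction s using Finset.induction_on with
  | empty => exact BasisRel.zero
  | insert a s ha ih =>
    rw [Finset.sum_insert ha, Finset.sum_insert ha]
    exact (h a (by simp)).add (ih fun i hi => h i (by simp [hi]))

theorem BasisRel.basisVec (a : JackIdx lam) :
    BasisRel p lam (RCA.basisVec (genPar r) a) (RCA.basisVec p a) := by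
  have h := BasisRel.basis (p := p) (lam := lam) a
  rw [jackB_apply, jackB_apply] at h
  exact h

theorem BasisRel.mTensor (ν : Fin n → ℕ) (w : W r n) (T : SYT lam) :
    BasisRel p lam (RCA.mTensor (genPar r) lam (hmon _ ν) (spechtRep _ lam w (vec _ T)))
      (RCA.mTensor p lam (hmon _ ν) (spechtRep _ lam w (vec _ T))) := by
  obtain ⟨c, hc⟩ := exists_mTensor_coeff ν w T
  rw [hc, hc]
  exact BasisRel.sum _ fun S _ => (BasisRel.basisVec _).smul (specTo_algebraMap _)

/-- Multiplication by `x_k` changes the composition and hence the twist `w_μ`. The product must be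
re-expanded in the new basis of `S^λ`, but the coefficients of that expansion are complex constants.
-/
theorem BasisRel.hx (k : Fin n) {m : M (genPar r) lam} {m' : M p lam}
    (h : BasisRel p lam m m') :
    BasisRel p lam (RCA.hx (genPar r) k • m) (RCA.hx p k • m') := by
  induction h with
  | zero => rw [smul_zero, smul_zero]; exact BasisRel.zero
  | basis a =>
    have key : ∀ (F : Type) [Field F] [Algebra ℂ F] (q : Param r → F),
        RCA.hx q k • RCA.basisVec q a = RCA.mTensor q lam (hmon q (a.1 + Pi.single k 1))
          (spechtRep F lam (permElt r (wPerm a.1))⁻¹ (vec F a.2)) := by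
      intro F _ _ q
      rw [← hx_mul_hmon, ← smul_mTensor]
      rfl
    rw [jackB_apply, jackB_apply, key, key]
    exact BasisRel.mTensor _ _ _
  | add _ _ h h' => rw [smul_add, smul_add]; exact h.add h'
  | smul ha _ h => rw [smul_comm, smul_comm (RCA.hx p k)]; exact h.smul ha

theorem MRel.basisRel {m : M (genPar r) lam} {m' : M p lam} (h : MRel p lam m m') :
    BasisRel p lam m m' := by
  induction h with
  | zero => exact BasisRel.zero
  | vec T =>
    have h1 := BasisRel.mTensor (p := p) 0 1 T
    rwa [hmon_zero, hmon_zero, map_one, map_one] at h1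
  | add _ _ h h' => exact h.add h'
  | smul ha _ h => exact h.smul ha
  | hx i _ h => exact h.hx i

/-- The coefficients of a generic vector that can be specialized are regular. -/
theorem MRel.specTo_repr {m : M (genPar r) lam} {m' : M p lam} (h : MRel p lam m m')
    (a : JackIdx lam) : SpecTo p ((jackB (genPar r) lam).repr m a) ((jackB p lam).repr m' a) := by
  have h1 := h.basisRel
  clear h
  induction h1 with
  | zero => rw [map_zero, map_zero]; exact specTo_zero
  | basis c =>
    rw [Module.Basis.repr_self, Module.Basis.repr_self]
    rcases eq_or_ne a c with rfl | h
    · rw [Finsupp.single_eq_same, Finsupp.single_eq_same]; exact specTo_one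
    · rw [Finsupp.single_eq_of_ne h, Finsupp.single_eq_of_ne h]; exact specTo_zero
  | add _ _ h h' =>
    rw [map_add, map_add, Finsupp.add_apply, Finsupp.add_apply]; exact h.add h'
  | smul ha _ h =>
    rw [map_smul _ (_ : GenField r), map_smul _ (_ : ℂ), Finsupp.smul_apply, Finsupp.smul_apply]
    exact ha.mul h

/-- An identity between generic vectors therefore passes to any specializations of its two sides,
which is how eigenvector equations are transported to `p`. -/
theorem MRel.unique {m : M (genPar r) lam} {m' k' : M p lam} (h : MRel p lam m m')
    (h' : MRel p lam m k') : m' = k' :=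
  (jackB p lam).repr.injective (Finsupp.ext fun a => (h.specTo_repr a).unique (h'.specTo_repr a))

end SpecModule

/-! ### Eigenbases and generic eigenvectors -/

section Leading

variable {F : Type} [Field F] [Algebra ℂ F] {r n : ℕ} [NeZero r] {p : Param r → F}
  {lam : RPartition r n}

/-- The leading coordinate of `u` is one, and triangularity determines the leading coordinate of `g
• u`; comparison leaves no choice for the eigenvalue. -/
theorem eigenvalue_eq_weight {a : JackIdx lam} {u : M p lam}
    (hu : u - jackB p lam a ∈ lowerOf (jackB p lam) a) (g : tAlg n p) {x : F}
    (hx : g • u = x • u) : x = weight p a g := by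
  have h1 : (jackB p lam).repr u a = 1 := by
    have h2 := repr_eq_zero_of_mem_lowerOf _ hu (lt_irrefl a)
    rwa [map_sub, Finsupp.sub_apply, Module.Basis.repr_self, Finsupp.single_eq_same,
      sub_eq_zero] at h2
  have h2 := repr_eq_zero_of_mem_lowerOf _
    (smul_mem_lowerOf p (tAlg_triangular p g.2) hu) (lt_irrefl a)
  have h3 : (g : H n p) • u = x • u := hx
  rw [smul_sub, h3, map_sub, map_smul _ x, Finsupp.sub_apply, Finsupp.smul_apply, h1, smul_eq_mul,
    mul_one, sub_eq_zero] at h2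
  exact h2

theorem smul_eq_weight_smul {a : JackIdx lam} {u : M p lam}
    (hu : u - jackB p lam a ∈ lowerOf (jackB p lam) a)
    (hz : ∀ i, hz p i • u = zWeight p a.1 a.2 i • u)
    (ht : ∀ i, ht p (zetaElt r i) • u = zetaPow F (tWeight a.1 a.2 i) • u) (g : tAlg n p) :
    g • u = weight p a g • u := by
  have h : ∀ g ∈ tAlg n p, ∃ x : F, g • u = x • u := by
    intro g hg
    induction hg using Algebra.adjoin_induction with
    | mem g hg =>
      rcases hg with ⟨i, rfl⟩ | ⟨i, rfl⟩
      · exact ⟨_, hz i⟩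
      · exact ⟨_, ht i⟩
    | algebraMap c => exact ⟨c, algebraMap_smul _ _ _⟩
    | add g h _ _ hg hh =>
      obtain ⟨s, hs⟩ := hg
      obtain ⟨t, ht⟩ := hh
      exact ⟨s + t, by rw [add_smul, add_smul, hs, ht]⟩
    | mul g h _ _ hg hh =>
      obtain ⟨s, hs⟩ := hg
      obtain ⟨t, ht⟩ := hh
      exact ⟨t * s, by rw [mul_smul, ht, smul_comm, hs, smul_smul]⟩
  obtain ⟨x, hx⟩ := h g g.2
  have hx' : g • u = x • u := hx
  rw [← eigenvalue_eq_weight hu g hx', hx']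

/-- The relation `t_{s_i} z_i = z_{i+1} t_{s_i} - c_0 π_i` is applied to `f_a` and the coefficient
of `f_a` is taken. If both components of the adjacent weights agree, the terms with `t_{s_i}` cancel
and `c_0 r = 0` remains. -/
theorem tWeight_ne_of_eigenbasis {f : Module.Basis (JackIdx lam) F (M p lam)}
    (hf : ∀ a, ∀ g : tAlg n p, g • f a = weight p a g • f a) (hc0 : p Param.c0 ≠ 0)
    (a : JackIdx lam) {i j : Fin n} (hij : (i : ℕ) + 1 = j)
    (hz : zWeight p a.1 a.2 i = zWeight p a.1 a.2 j) : tWeight a.1 a.2 i ≠ tWeight a.1 a.2 j := by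
  intro ht
  have h1 := congrArg (fun g => f.repr (g • f a) a) (ht_swap_mul_hz (p := p) hij)
  have h2 : RCA.hz p i • f a = zWeight p a.1 a.2 i • f a := by
    rw [← weight_hz]; exact hf a ⟨RCA.hz p i, hz_mem_tAlg p i⟩
  have h3 : piElt (htHom p) i j • f a = (r : F) • f a := by
    have h4 := hf a ⟨piElt (RCA.ht p) i j, piElt_mem_tAlg p i j⟩
    rw [weight_piElt, if_pos ht] at h4
    exact h4
  have h5 : ∀ m, f.repr (RCA.hz p j • m) a = zWeight p a.1 a.2 j * f.repr m a := by
    intro m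
    rw [← weight_hz]; exact repr_smul_of_eigen hf ⟨RCA.hz p j, hz_mem_tAlg p j⟩ m a
  simp only [sub_smul, mul_smul, smul_assoc] at h1
  rw [h2, h3, smul_comm _ (zWeight p a.1 a.2 i), map_smul _ (zWeight p a.1 a.2 i), map_sub, map_smul _ (p Param.c0),
    map_smul _ (r : F), Finsupp.sub_apply, h5, Finsupp.smul_apply, Finsupp.smul_apply,
    Finsupp.smul_apply, Module.Basis.repr_self, Finsupp.single_eq_same, hz] at h1
  simp only [smul_eq_mul, mul_one] at h1
  have h6 : p Param.c0 * r = 0 := by linear_combination h1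
  rcases mul_eq_zero.1 h6 with h | h
  · exact hc0 h
  · exact natCast_ne_zero_of_neZero F r h

end Leading

/-! ### Generic eigenvectors and their specializations -/

section Generic

open scoped IsMulCommutative

variable {r n : ℕ} [NeZero r] {p : Param r → ℂ} {lam : RPartition r n}

/-- A coincidence of generic weights specializes to a coincidence at `p`, so distinctness at one
point implies generic distinctness. -/
theorem injective_weight_genPar (hinj : Function.Injective (weight p (lam := lam))) :
    Function.Injective (weight (genPar r) (lam := lam)) := by
  intro a c h
  apply hinj
  rw [weight_eq_iff] at h ⊢
  refine fun i => ⟨(specTo_zWeight a.1 a.2 i).unique ?_, (h i).2⟩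
  rw [(h i).1]
  exact specTo_zWeight c.1 c.2 i

variable (p lam) in
/-- The operator `g'` is a specialization of the generic operator `g`. -/
def OpRel (g : tAlg n (genPar r)) (g' : tAlg n p) : Prop :=
  ∀ ⦃m : M (genPar r) lam⦄ ⦃m' : M p lam⦄, MRel p lam m m' → MRel p lam (g • m) (g' • m')

theorem MRel.jackB (a : JackIdx lam) :
    MRel p lam (RCA.jackB (genPar r) lam a) (RCA.jackB p lam a) := by
  rw [jackB_apply, jackB_apply]
  exact MRel.basisVec _

theorem OpRel.specTo_weight {g : tAlg n (genPar r)} {g' : tAlg n p} (h : OpRel p lam g g')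
    (a : JackIdx lam) : SpecTo p (weight (genPar r) a g) (weight p a g') :=
  (h (MRel.jackB a)).specTo_repr a

theorem OpRel.sub_weight {g : tAlg n (genPar r)} {g' : tAlg n p} (h : OpRel p lam g g')
    (a : JackIdx lam) : OpRel p lam (g - algebraMap _ _ (weight (genPar r) a g))
      (g' - algebraMap _ _ (weight p a g')) := by
  intro m m' hm
  rw [sub_smul, sub_smul, algebraMap_smul, algebraMap_smul]
  exact (h hm).sub (hm.smul (h.specTo_weight a))

theorem OpRel.prod {ι : Type*} (s : Finset ι) {g : ι → tAlg n (genPar r)} {g' : ι → tAlg n p}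
    (h : ∀ i, OpRel p lam (g i) (g' i)) : OpRel p lam (∏ i ∈ s, g i) (∏ i ∈ s, g' i) := by
  classical
  induction s using Finset.induction_on with
  | empty =>
    intro m m' hm
    rw [Finset.prod_empty, Finset.prod_empty, one_smul, one_smul]; exact hm
  | insert a s ha ih =>
    intro m m' hm
    rw [Finset.prod_insert ha, Finset.prod_insert ha, mul_smul, mul_smul]
    exact h a (ih hm)

/-- Two different weights already differ on some `z_i` or `t_{ζ_i}`. Separating by these generators
ensures that the separating element has a generic counterpart. -/
theorem exists_opRel_separating (a c : JackIdx lam) : ∃ (g : tAlg n (genPar r)) (g' : tAlg n p),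
    OpRel p lam g g' ∧ (weight p c ≠ weight p a → weight p a g' ≠ weight p c g') := by
  by_cases h : weight p c = weight p a
  · exact ⟨1, 1, fun m m' hm => by rw [one_smul, one_smul]; exact hm, fun h' => absurd h h'⟩
  have h1 := h
  rw [weight_eq_iff] at h1
  push Not at h1
  obtain ⟨i, hi⟩ := h1
  by_cases hz : zWeight p c.1 c.2 i = zWeight p a.1 a.2 i
  · refine ⟨⟨ht _ (zetaElt r i), ht_zeta_mem_tAlg _ i⟩, ⟨ht _ (zetaElt r i), ht_zeta_mem_tAlg _ i⟩,
      fun m m' hm => hm.ht _, fun _ => ?_⟩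
    rw [weight_ht, weight_ht]
    exact fun h2 => hi hz (zetaPow_injective ℂ h2).symm
  · refine ⟨⟨RCA.hz _ i, hz_mem_tAlg _ i⟩, ⟨RCA.hz _ i, hz_mem_tAlg _ i⟩,
      fun m m' hm => hm.hz _, fun _ => ?_⟩
    rw [weight_hz, weight_hz]
    exact fun h2 => hz h2.symm

/-- The eigenvector is the projection of `x^μ v_T^μ` divided by the eigenvalue of the projector.
When all separating elements already work at `p`, this eigenvalue is nonzero there, so no
coefficient acquires a pole. -/
theorem jackWellDefined_of_injective (hinj : Function.Injective (weight p (lam := lam)))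
    (μ : Fin n → ℕ) (T : SYT lam) : JackWellDefined lam p μ T := by
  classical
  let a : JackIdx lam := (μ, T)
  have hgen := injective_weight_genPar hinj
  choose h h' hrel hsep using exists_opRel_separating (p := p) a
  set P := weightProj (weight (genPar r)) a (finite_Iio_jackIdx a) h with hP
  set P' := weightProj (weight p) a (finite_Iio_jackIdx a) h' with hP'
  have hPP : OpRel p lam P P' := by
    rw [hP, hP', weightProj, weightProj]
    -- Weights are distinct both generically and at `p`, so the two projectors are products over the
    -- same indices.
    have h1 : ∀ c, weight (genPar r) c ≠ weight (genPar r) a ↔ weight p c ≠ weight p a :=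
      fun c => (hgen.ne_iff).trans hinj.ne_iff.symm
    simp only [h1]
    exact OpRel.prod _ fun c => (hrel c).sub_weight c
  have h0 : weight p a P' ≠ 0 := weight_weightProj _ _ _ hsep
  have hspec := hPP.specTo_weight a
  have h0' : weight (genPar r) a P ≠ 0 := by
    intro h2
    rw [h2] at hspec
    exact h0 (hspec.unique specTo_zero)
  have hm := (hPP (MRel.jackB a)).smul (hspec.inv h0)
  set f := (weight (genPar r) a P)⁻¹ • P • jackB (genPar r) lam a with hf
  have hlow : f - jackB (genPar r) lam a ∈ lowerOf (jackB (genPar r) lam) a := by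
    have h1 := (lowerOf (jackB (genPar r) lam) a).smul_mem (weight (genPar r) a P)⁻¹
      (weight_spec (genPar r) a P)
    rwa [smul_sub, smul_smul, inv_mul_cancel₀ h0', one_smul] at h1
  refine ⟨(jackB (genPar r) lam).repr f, fun c => regularAt_iff.2 ⟨_, hm.specTo_repr c⟩, ?_⟩
  have hcomb : Finsupp.linearCombination (GenField r) (basisVec (genPar r))
      ((jackB (genPar r) lam).repr f) = f := by
    have h3 : (basisVec (genPar r) : JackIdx lam → _) = jackB (genPar r) lam :=
      funext fun c => (jackB_apply _ c).symm
    have h4 := (jackB (genPar r) lam).linearCombination_repr f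
    rw [← h3] at h4
    exact h4
  rw [hcomb]
  refine ⟨?_, ?_, fun g hg => ⟨weight (genPar r) a ⟨g, hg⟩, ?_⟩⟩
  · rw [lowerOf_jackB, jackB_apply] at hlow
    exact hlow
  · intro h1
    rw [h1] at hlow
    have h2 := repr_eq_zero_of_mem_lowerOf _ hlow (lt_irrefl a)
    simp at h2
  · have h1 := exists_eigenvector (jackB (genPar r) lam) (weight (genPar r)) (weight_spec _)
      finite_Iio_jackIdx hgen a h ⟨g, hg⟩
    rw [hf, smul_comm g, smul_comm (weight (genPar r) a ⟨g, hg⟩)]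
    exact congrArg _ h1

/-- Regular coefficients can be evaluated at `p`. The triangular form and the eigenvalue equations
survive evaluation, so the specialized vectors are a unitriangular family of eigenvectors, hence an
eigenbasis. -/
theorem exists_eigenbasis_of_jackWellDefined
    (hd : ∀ (μ : Fin n → ℕ) (T : SYT lam), JackWellDefined lam p μ T) :
    ∃ f : Module.Basis (JackIdx lam) ℂ (M p lam),
      ∀ a, ∀ g : tAlg n p, g • f a = weight p a g • f a := by
  have key : ∀ a : JackIdx lam, ∃ u : M p lam, u - jackB p lam a ∈ lowerOf (jackB p lam) a ∧
      ∀ g : tAlg n p, g • u = weight p a g • u := by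
    intro a
    obtain ⟨c, hc, hI⟩ := hd a.1 a.2
    choose v hv using fun e => regularAt_iff.1 (hc e)
    set f := Finsupp.linearCombination (GenField r) (basisVec (genPar r)) c with hf
    let u : M p lam := ∑ e ∈ c.support, v e • basisVec p e
    have hfu : MRel p lam f u := by
      rw [hf, Finsupp.linearCombination_apply, Finsupp.sum]
      exact MRel.sum _ fun e _ => (MRel.basisVec e).smul (hv e)
    have hlow : f - jackB (genPar r) lam a ∈ lowerOf (jackB (genPar r) lam) a := by
      rw [lowerOf_jackB, jackB_apply]
      exact hI.1
    have hulow : u - jackB p lam a ∈ lowerOf (jackB p lam) a := by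
      rw [lowerOf, Module.Basis.mem_span_image]
      intro e he
      -- Outside the lower set the generic coefficient of the difference is zero, so its value at
      -- `p` is zero as well.
      by_contra hlt
      have h1 := (hfu.sub (MRel.jackB a)).specTo_repr e
      rw [repr_eq_zero_of_mem_lowerOf _ hlow hlt] at h1
      exact Finsupp.mem_support_iff.1 he (h1.unique specTo_zero)
    have hgen : ∀ g : tAlg n (genPar r), g • f = weight (genPar r) a g • f := by
      intro g
      obtain ⟨x, hx⟩ := hI.2.2 g g.2
      have hx' : g • f = x • f := hx
      rw [← eigenvalue_eq_weight hlow g hx', hx']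
    refine ⟨u, hulow, smul_eq_weight_smul hulow (fun i => ?_) fun i => ?_⟩
    · have h1 := hgen ⟨hz _ i, hz_mem_tAlg _ i⟩
      rw [weight_hz] at h1
      have h2 : MRel p lam (zWeight (genPar r) a.1 a.2 i • f) (hz p i • u) := h1 ▸ hfu.hz i
      exact h2.unique (hfu.smul (specTo_zWeight _ _ _))
    · have h1 := hgen ⟨ht _ (zetaElt r i), ht_zeta_mem_tAlg _ i⟩
      rw [weight_ht] at h1
      have h2 : MRel p lam (zetaPow _ (tWeight a.1 a.2 i) • f) (ht p (zetaElt r i) • u) :=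
        h1 ▸ hfu.ht _
      exact h2.unique (hfu.smul (specTo_zetaPow _))
  choose u hu hu' using key
  refine ⟨unitriBasis (jackB p lam) finite_Iio_jackIdx hu, fun a g => ?_⟩
  rw [unitriBasis_apply]
  exact hu' a g

end Generic
end RCA
end

/-! ### The equivalence of the five conditions -/

theorem lemma7p1 (r n : ℕ) [NeZero r] (hn : 0 < n) (lam : RPartition r n)
    (c0 : ℂ) (hc0 : c0 ≠ 0) (d : {j : ZMod r // j ≠ 0} → ℂ) :
    LocallyFinite (fun E : excHyper lam => (E : Set (ℂ × ({j : ZMod r // j ≠ 0} → ℂ)))) ∧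
    List.TFAE [
      -- (a) every nonzero weight space of `M(λ)` is one-dimensional
      ∀ α : tAlg n (point c0 d) →ₐ[ℂ] ℂ,
        weightSpace (point c0 d) (M (point c0 d) lam) α ≠ ⊥ →
          Module.finrank ℂ (weightSpace (point c0 d) (M (point c0 d) lam) α) = 1,
      -- (b) adjacent weights differ
      ∀ (μ : Fin n → ℕ) (T : SYT lam) (i j : Fin n), (i : ℕ) + 1 = j →
        wt c0 d μ T i ≠ wt c0 d μ T j,
      -- (c) the parameters avoid the exceptional hyperplanes
      ∀ E ∈ excHyper lam, (c0, d) ∉ E,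
      -- (d) all `f_{μ,T}` are well-defined
      ∀ (μ : Fin n → ℕ) (T : SYT lam), JackWellDefined lam (point c0 d) μ T,
      -- (e) all `σ_i` are well-defined on all of `M(λ)`
      ∀ (i j : Fin n), (i : ℕ) + 1 = j → ∀ α : tAlg n (point c0 d) →ₐ[ℂ] ℂ,
        SigmaDefinedOn (point c0 d) lam i j α] := by
  refine ⟨locallyFinite_excHyper lam, ?_⟩
  -- The three arguments leading to (b) separate a residue modulo `r` from the eigenvalue of `z_i`;
  -- injectivity of `j ↦ ζ^j` translates this into `wt`.
  have hb_of_ne (h : ∀ (a : JackIdx lam) (i j : Fin n), (i : ℕ) + 1 = j →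
      zWeight (point c0 d) a.1 a.2 i = zWeight (point c0 d) a.1 a.2 j →
      tWeight a.1 a.2 i ≠ tWeight a.1 a.2 j) (μ : Fin n → ℕ) (T : SYT lam) (i j : Fin n)
      (hij : (i : ℕ) + 1 = j) : wt c0 d μ T i ≠ wt c0 d μ T j := by
    rw [wt_eq, wt_eq]
    intro h1
    exact h (μ, T) i j hij (congrArg Prod.fst h1) (zetaPow_injective ℂ (congrArg Prod.snd h1))
  have hbc (hb : ∀ (μ : Fin n → ℕ) (T : SYT lam) (i j : Fin n), (i : ℕ) + 1 = j →
      wt c0 d μ T i ≠ wt c0 d μ T j) : ∀ E ∈ excHyper lam, (c0, d) ∉ E := by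
    intro E hE hmem
    obtain ⟨μ, T, i, j, hij, h⟩ := exists_wt_eq_of_mem hE hmem
    exact hb μ T i j hij h
  tfae_have 1 → 2 := fun h => hb_of_ne fun a i j hij hz =>
    tWeight_ne_of_injective (point c0 d) hc0 (injective_weight_of_finrank _ h) a hij hz
  tfae_have 2 → 3 := hbc
  tfae_have 3 → 1 := fun h α hα =>
    finrank_weightSpace (injective_weight_of_avoid hc0 h) hα
  tfae_have 3 → 4 := fun h => jackWellDefined_of_injective (injective_weight_of_avoid hc0 h)
  tfae_have 4 → 2 := by
    intro h
    obtain ⟨f, hf⟩ := exists_eigenbasis_of_jackWellDefined h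
    exact hb_of_ne fun a i j hij hz => tWeight_ne_of_eigenbasis hf hc0 a hij hz
  tfae_have 3 → 5 := fun h i j hij α =>
    sigmaDefinedOn_of_injective (injective_weight_of_avoid hc0 h) (fun a hz =>
      tWeight_ne_of_injective (point c0 d) hc0 (injective_weight_of_avoid hc0 h) a hij hz) α
  tfae_have 5 → 2 := fun h => hb_of_ne fun a i j hij hz =>
    ne_of_sigmaDefinedOn a (h i j hij _) hz
  tfae_finish
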